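/- Let $\mathfrak B$ be a unital C$^*$-algebra. A free C$^*$-dynamical system $(\mathfrak A,\mathrm{SO}(2),\alpha)$ with fixed point algebra $\mathfrak B$ consists of a unital C$^*$-algebra $\mathfrak A$, a strongly continuous action $\alpha$ of $\mathrm{SO}(2)$ on $\mathfrak A$ by $^*$-automorphisms such that the span of the functions $g\mapsto x\,\alpha_g(y)$, $x,y\in\mathfrak A$, is dense in $C(\mathrm{SO}(2),\mathfrak A)$, and an identification of $\mathfrak B$ with the fixed point algebra $\mathfrak A^{\mathrm{SO}(2)}$ (an injective unital $^*$-homomorphism $\mathfrak B\to\mathfrak A$ with this range). Two such systems are equivalent if there is an $\mathrm{SO}(2)$-equivariant $^*$-isomorphism between them that is the identity on $\mathfrak B$; let $\mathrm{Ext}(\mathfrak B,\mathrm{SO}(2))$ be the set of equivalence classes. For $k\in\mathbb Z$ let $A(k)=\{x\in\mathfrak A:\alpha_g(x)=\chi(g)^k x \text{ for all } g\}$, where $\chi$ sends the rotation by the angle $\theta$ to $e^{i\theta}$. A Morita equivalence $\mathfrak B$-bimodule is a $\mathfrak B$-bimodule $N$ that is a full right and a full left Hilbert $\mathfrak B$-module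 with inner products $\langle\cdot,\cdot\rangle_{\mathfrak B}$ and ${}_{\mathfrak B}\langle\cdot,\cdot\rangle$, where either action is adjointable for the inner product of the other side and ${}_{\mathfrak B}\langle x,y\rangle z=x\langle y,z\rangle_{\mathfrak B}$. Let $\mathrm{Pic}(\mathfrak B)$ be the set of classes of such bimodules modulo bimodule isomorphisms preserving both inner products. For such an $N$ let $\bar N=\{\tilde x:x\in N\}$ be its dual bimodule, and let $N(0)=\mathfrak B$, $N(k)=N^{\otimes k}$ and $N(-k)=\bar N^{\otimes k}$ for $k>0$ (tensor products of Hilbert modules over $\mathfrak B$). Then: 1. For every free C$^*$-dynamical system $(\mathfrak A,\mathrm{SO}(2),\alpha)$ with fixed point algebra $\mathfrak B$ and every $k\in\mathbb Z$, the isotypic component $A(k)$ is a Morita equivalence $\mathfrak B$-bimodule with ${}_{\mathfrak B}\langle x,y\rangle=xy^*$ and $\langle x,y\rangle_{\mathfrak B}=x^*y$. 2. The map $\mathrm{Ext}(\mathfrak B,\mathrm{SO}(2))\to\mathrm{Pic}(\mathfrak B)$, $[(\mathfrak A,\mathrm{SO}(2),\alpha)]\mapsto[A(1)]$, is well defined and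 bijective. 3. Let $N$ be a Morita equivalence $\mathfrak B$-bimodule. There is exactly one family of bimodule isomorphisms $\Psi_{k,l}:N(k)\otimes_{\mathfrak B}N(l)\to N(k+l)$, $k,l\in\mathbb Z$, preserving the right inner products, which is associative, that is, $\Psi_{k_1+k_2,k_3}(\Psi_{k_1,k_2}\otimes\mathrm{id})=\Psi_{k_1,k_2+k_3}(\mathrm{id}\otimes\Psi_{k_2,k_3})$, and for which $\Psi_{0,k}(b\otimes x)=bx$, $\Psi_{k,0}(x\otimes b)=xb$, $\Psi_{k,1}$ and $\Psi_{-k,-1}$ are the identity of $N^{\otimes k}\otimes_{\mathfrak B}N=N^{\otimes(k+1)}$ and of $\bar N^{\otimes k}\otimes_{\mathfrak B}\bar N=\bar N^{\otimes(k+1)}$ for $k>0$, $\Psi_{1,-1}(x\otimes\tilde y)={}_{\mathfrak B}\langle x,y\rangle$ and $\Psi_{-1,1}(\tilde x\otimes y)=\langle x,y\rangle_{\mathfrak B}$. The inverse of the bijection in 2 sends $[N]$ to the class of the system given by this factor system: the class of $(\mathfrak A,\mathrm{SO}(2),\alpha)$ is the preimage of $[N]$ if and only if there are bimodule isomorphisms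 $\varphi_k:N(k)\to A(k)$, $k\in\mathbb Z$, preserving the right inner products, such that $\varphi_0$ is the given identification of $\mathfrak B$ with $A(0)$ and $\varphi_{k+l}(\Psi_{k,l}(x\otimes y))=\varphi_k(x)\varphi_l(y)$ for all $k,l\in\mathbb Z$, $x\in N(k)$, $y\in N(l)$. -/

import Mathlib

open scoped TensorProduct MulOpposite ComplexConjugate
open MulOpposite UniformSpace

universe u

noncomputable section

/-- A complex `B`-bimodule with a positive semi-definite `B`-valued right inner product for which
the left action of `B` is by adjointable maps. -/
structure PreCorrespondence (B : Type u) [CStarAlgebra B] where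
  carrier : Type u
  [addCommGroup : AddCommGroup carrier]
  [module : Module ℂ carrier]
  [leftModule : Module B carrier]
  [rightModule : Module Bᵐᵒᵖ carrier]
  [smulCommClass : SMulCommClass B Bᵐᵒᵖ carrier]
  [leftTower : IsScalarTower ℂ B carrier]
  [rightTower : IsScalarTower ℂ Bᵐᵒᵖ carrier]
  rinner : carrier → carrier → B
  rinner_add_right : ∀ x y z, rinner x (y + z) = rinner x y + rinner x z
  rinner_op_smul_right : ∀ x y (b : B), rinner x (op b • y) = rinner x y * b
  star_rinner : ∀ x y, star (rinner x y) = rinner y x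
  rinner_smul_left : ∀ (b : B) x y, rinner (b • x) y = rinner x (star b • y)
  rinner_self_nonneg : ∀ x, ∃ b, rinner x x = star b * b

attribute [instance] PreCorrespondence.addCommGroup PreCorrespondence.module
  PreCorrespondence.leftModule PreCorrespondence.rightModule PreCorrespondence.smulCommClass
  PreCorrespondence.leftTower PreCorrespondence.rightTower

namespace PreCorrespondence

variable {B : Type u} [CStarAlgebra B] (P : PreCorrespondence B)

theorem rinner_add_left (x y z : P.carrier) :
    P.rinner (x + y) z = P.rinner x z + P.rinner y z := by
  rw [← P.star_rinner z, P.rinner_add_right, star_add, P.star_rinner, P.star_rinner]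

theorem complex_smul_eq (c : ℂ) (x : P.carrier) : c • x = op (c • (1 : B)) • x := by
  rw [op_smul, smul_assoc, op_one, one_smul]

theorem rinner_smul_right (c : ℂ) (x y : P.carrier) :
    P.rinner x (c • y) = c • P.rinner x y := by
  rw [P.complex_smul_eq, P.rinner_op_smul_right, mul_smul_comm, mul_one]

theorem rinner_smul_left_complex (c : ℂ) (x y : P.carrier) :
    P.rinner (c • x) y = conj c • P.rinner x y := by
  rw [← P.star_rinner y, P.rinner_smul_right, star_smul, P.star_rinner]; rfl

theorem rinner_op_smul_left (b : B) (x y : P.carrier) :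
    P.rinner (op b • x) y = star b * P.rinner x y := by
  rw [← P.star_rinner y, P.rinner_op_smul_right, star_mul, P.star_rinner]

/-- The inner product as a sesquilinear map. -/
def sesq : P.carrier →ₗ⋆[ℂ] P.carrier →ₗ[ℂ] B where
  toFun x :=
    { toFun := fun y => P.rinner x y
      map_add' := P.rinner_add_right x
      map_smul' := fun c y => P.rinner_smul_right c x y }
  map_add' x y := LinearMap.ext fun z => P.rinner_add_left x y z
  map_smul' c x := LinearMap.ext fun z => P.rinner_smul_left_complex c x z

theorem sesq_apply (x y : P.carrier) : P.sesq x y = P.rinner x y := rfl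

theorem rinner_sum_sum {ι : Type*} (s : Finset ι) (x y : ι → P.carrier) :
    P.rinner (∑ i ∈ s, x i) (∑ j ∈ s, y j) = ∑ i ∈ s, ∑ j ∈ s, P.rinner (x i) (y j) := by
  simp only [← P.sesq_apply, map_sum, LinearMap.sum_apply]
  exact Finset.sum_comm

theorem rinner_sub_self (x y : P.carrier) : P.rinner (x - y) (x - y) =
    P.rinner x x - P.rinner x y - P.rinner y x + P.rinner y y := by
  simp only [← P.sesq_apply, map_sub, LinearMap.sub_apply]; abel

theorem norm_rinner_sq_le (x y : P.carrier) :
    ‖P.rinner x y‖ ^ 2 ≤ ‖P.rinner x x‖ * ‖P.rinner y y‖ := by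
  let _ := CStarAlgebra.spectralOrder B
  let _ := CStarAlgebra.spectralOrderedRing B
  have hpos : ∀ z, 0 ≤ P.rinner z z := fun z => by
    obtain ⟨b, hb⟩ := P.rinner_self_nonneg z
    rw [hb]; exact star_mul_self_nonneg b
  set a := P.rinner x y with ha
  have hyx : P.rinner y x = star a := (P.star_rinner x y).symm
  -- for every `t > ‖⟨x, x⟩‖`, `a* a ≤ t ⟨y, y⟩`
  have key : ∀ t : ℝ, ‖P.rinner x x‖ < t → ‖a‖ ^ 2 ≤ t * ‖P.rinner y y‖ := by
    intro t ht
    have ht0 : 0 < t := lt_of_le_of_lt (norm_nonneg _) ht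
    have h1 : 0 ≤ star a * P.rinner x x * a - (t : ℂ) • (star a * a) - (t : ℂ) • (star a * a)
        + (t : ℂ) • (t : ℂ) • P.rinner y y := by
      refine (hpos (op a • x - (t : ℂ) • y)).trans_eq ?_
      rw [P.rinner_sub_self]
      simp only [P.rinner_op_smul_left, P.rinner_op_smul_right, P.rinner_smul_right,
        P.rinner_smul_left_complex, Complex.conj_ofReal, ← ha, hyx, mul_assoc,
        smul_mul_assoc, mul_smul_comm]
    have h2 : star a * P.rinner x x * a ≤ t • (star a * a) := by
      refine (CStarAlgebra.star_left_conjugate_le_norm_smul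
        (hb := (hpos x).isSelfAdjoint)).trans ?_
      exact smul_le_smul_of_nonneg_right ht.le (star_mul_self_nonneg a)
    have h3 : t • (star a * a) ≤ t • t • P.rinner y y := by
      have h4 : (0 : B) ≤ t • (star a * a) - t • (star a * a) - t • (star a * a)
        + t • t • P.rinner y y := by
        refine h1.trans ?_
        simp only [Complex.coe_smul]
        gcongr
      simpa [add_comm, ← sub_eq_add_neg] using h4
    have h5 : star a * a ≤ t • P.rinner y y := (smul_le_smul_iff_of_pos_left ht0).1 h3
    have := CStarAlgebra.norm_le_norm_of_nonneg_of_le (star_mul_self_nonneg a) h5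
    rwa [CStarRing.norm_star_mul_self, norm_smul, Real.norm_of_nonneg ht0.le, ← pow_two] at this
  refine le_of_forall_pos_le_add fun ε hε => ?_
  have hN : 0 < ‖P.rinner y y‖ + 1 := by positivity
  refine (key (‖P.rinner x x‖ + ε / (‖P.rinner y y‖ + 1))
    (lt_add_of_pos_right _ (by positivity))).trans ?_
  rw [add_mul]
  gcongr
  rw [div_mul_eq_mul_div, div_le_iff₀ hN]
  gcongr
  linarith

theorem norm_rinner_le (x y : P.carrier) :
    ‖P.rinner x y‖ ≤ √‖P.rinner x x‖ * √‖P.rinner y y‖ := by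
  rw [← Real.sqrt_mul (norm_nonneg _)]
  exact Real.le_sqrt_of_sq_le (P.norm_rinner_sq_le x y)

/-- The seminorm `‖x‖ = ‖⟨x, x⟩‖ ^ (1 / 2)`. -/
instance : SeminormedAddCommGroup P.carrier :=
  { P.addCommGroup, AddGroupSeminorm.toSeminormedAddCommGroup
    { toFun := fun x : P.carrier => √‖P.rinner x x‖
      map_zero' := by simp [← P.sesq_apply]
      neg' := fun x => by simp [← P.sesq_apply]
      add_le' := fun x y => by
        refine Real.sqrt_le_iff.2 ⟨by positivity, ?_⟩
        have h1 := P.norm_rinner_le x y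
        have h2 := P.norm_rinner_le y x
        have h3 := Real.sq_sqrt (norm_nonneg (P.rinner x x))
        have h4 := Real.sq_sqrt (norm_nonneg (P.rinner y y))
        have h5 : P.rinner (x + y) (x + y) =
          P.rinner x x + P.rinner x y + P.rinner y x + P.rinner y y := by
          rw [P.rinner_add_left, P.rinner_add_right, P.rinner_add_right]; abel
        have h6 : ‖P.rinner (x + y) (x + y)‖ ≤
          ‖P.rinner x x‖ + ‖P.rinner x y‖ + ‖P.rinner y x‖ + ‖P.rinner y y‖ := by
          rw [h5]
          exact (norm_add_le _ _).trans (by gcongr; exact norm_add₃_le)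
        nlinarith } with }

theorem norm_def (x : P.carrier) : ‖x‖ = √‖P.rinner x x‖ := rfl

theorem norm_sq (x : P.carrier) : ‖x‖ ^ 2 = ‖P.rinner x x‖ :=
  Real.sq_sqrt (norm_nonneg _)

instance : NormedSpace ℂ P.carrier :=
  { P.module with
    norm_smul_le := fun c x => by
      refine (pow_le_pow_iff_left₀ (norm_nonneg _) (by positivity) two_ne_zero).1 ?_
      rw [mul_pow, P.norm_sq, P.norm_sq, P.rinner_smul_right, P.rinner_smul_left_complex,
        norm_smul, norm_smul, RCLike.norm_conj, ← mul_assoc, ← pow_two] }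

theorem norm_smul_le_left (b : B) (x : P.carrier) : ‖b • x‖ ≤ ‖b‖ * ‖x‖ := by
  let _ := CStarAlgebra.spectralOrder B
  let _ := CStarAlgebra.spectralOrderedRing B
  have hpos : ∀ z, 0 ≤ P.rinner z z := fun z => by
    obtain ⟨b, hb⟩ := P.rinner_self_nonneg z
    rw [hb]; exact star_mul_self_nonneg b
  have h1 : star b * b ≤ ((‖b‖ ^ 2 : ℝ) : ℂ) • (1 : B) := by
    have := CStarAlgebra.star_mul_le_algebraMap_norm_sq (a := b)
    rwa [Algebra.algebraMap_eq_smul_one, ← Complex.coe_smul] at this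
  obtain ⟨c, hc⟩ := CStarAlgebra.nonneg_iff_eq_star_mul_self.1 (sub_nonneg.2 h1)
  have h2 : P.rinner (c • x) (c • x) =
      (‖b‖ ^ 2 : ℝ) • P.rinner x x - P.rinner (b • x) (b • x) := by
    rw [P.rinner_smul_left, P.rinner_smul_left, ← mul_smul, ← mul_smul, ← hc, sub_smul,
      smul_assoc, one_smul, ← P.sesq_apply, map_sub, map_smul, Complex.coe_smul]
    rfl
  have h3 : P.rinner (b • x) (b • x) ≤ (‖b‖ ^ 2 : ℝ) • P.rinner x x :=
    sub_nonneg.1 (h2 ▸ hpos _)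
  refine (pow_le_pow_iff_left₀ (norm_nonneg _) (by positivity) two_ne_zero).1 ?_
  rw [mul_pow, P.norm_sq, P.norm_sq]
  refine (CStarAlgebra.norm_le_norm_of_nonneg_of_le (hpos _) h3).trans_eq ?_
  rw [norm_smul, Real.norm_of_nonneg (by positivity)]

theorem norm_smul_le_right (b : Bᵐᵒᵖ) (x : P.carrier) : ‖b • x‖ ≤ ‖b‖ * ‖x‖ := by
  refine (pow_le_pow_iff_left₀ (norm_nonneg _) (by positivity) two_ne_zero).1 ?_
  obtain ⟨b, rfl⟩ := op_surjective b
  rw [mul_pow, P.norm_sq, P.norm_sq, P.rinner_op_smul_left, P.rinner_op_smul_right, norm_op]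
  refine (norm_mul_le _ _).trans ?_
  rw [norm_star, pow_two, mul_assoc]
  gcongr
  refine (norm_mul_le _ _).trans_eq (mul_comm _ _)

instance : UniformContinuousConstSMul B P.carrier :=
  ⟨fun b => AddMonoidHomClass.uniformContinuous_of_bound
    (DistribSMul.toAddMonoidHom P.carrier b) ‖b‖ (P.norm_smul_le_left b)⟩

instance : UniformContinuousConstSMul Bᵐᵒᵖ P.carrier :=
  ⟨fun b => AddMonoidHomClass.uniformContinuous_of_bound
    (DistribSMul.toAddMonoidHom P.carrier b) ‖b‖ (P.norm_smul_le_right b)⟩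

/-- The inner product on the completion, the continuous extension of `P.rinner`. -/
def completionInner (x y : Completion P.carrier) : B :=
  (Completion.isDenseInducing_coe.prodMap Completion.isDenseInducing_coe).extend
    (fun p : P.carrier × P.carrier => P.rinner p.1 p.2) (x, y)

theorem continuous_rinner : Continuous fun p : P.carrier × P.carrier => P.rinner p.1 p.2 := by
  let f : P.carrier →L⋆[ℂ] P.carrier →L[ℂ] B := LinearMap.mkContinuous₂ P.sesq 1 fun x y => by
    rw [one_mul]; exact P.norm_rinner_le x y
  exact (f.continuous.comp continuous_fst).clm_apply continuous_snd

theorem completionInner_coe (x y : P.carrier) :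
    P.completionInner (x : Completion P.carrier) (y : Completion P.carrier) = P.rinner x y :=
  (Completion.isDenseInducing_coe.prodMap Completion.isDenseInducing_coe).extend_eq
    P.continuous_rinner (x, y)

theorem continuous_completionInner :
    Continuous fun p : Completion P.carrier × Completion P.carrier =>
      P.completionInner p.1 p.2 := by
  let inner' : P.carrier →+ P.carrier →+ B :=
    { toFun := fun x => (P.sesq x).toAddMonoidHom
      map_zero' := by ext x; simp
      map_add' := fun x y => by ext z; simp }
  have : Continuous fun p : P.carrier × P.carrier => inner' p.1 p.2 := P.continuous_rinner
  exact (Completion.isDenseInducing_toCompl P.carrier).extend_Z_bilin (Completion.isDenseInducing_toCompl P.carrier) this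

end PreCorrespondence

/-- A correspondence over `B`: a `B`-bimodule which is a right Hilbert `B`-module (complete for the
norm `‖x‖ = ‖⟨x, x⟩‖ ^ (1 / 2)`) on which `B` acts from the left by adjointable maps. The right
action of `b` is `op b • x`. -/
structure Correspondence (B : Type u) [CStarAlgebra B] where
  carrier : Type u
  [normedAddCommGroup : NormedAddCommGroup carrier]
  [normedSpace : NormedSpace ℂ carrier]
  [completeSpace : CompleteSpace carrier]
  [leftModule : Module B carrier]
  [rightModule : Module Bᵐᵒᵖ carrier]
  [smulCommClass : SMulCommClass B Bᵐᵒᵖ carrier]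
  [leftTower : IsScalarTower ℂ B carrier]
  [rightTower : IsScalarTower ℂ Bᵐᵒᵖ carrier]
  rinner : carrier → carrier → B
  rinner_add_right : ∀ x y z, rinner x (y + z) = rinner x y + rinner x z
  rinner_op_smul_right : ∀ x y (b : B), rinner x (op b • y) = rinner x y * b
  star_rinner : ∀ x y, star (rinner x y) = rinner y x
  rinner_smul_left : ∀ (b : B) x y, rinner (b • x) y = rinner x (star b • y)
  rinner_self_nonneg : ∀ x, ∃ b, rinner x x = star b * b
  norm_sq_eq_rinner : ∀ x, ‖x‖ ^ 2 = ‖rinner x x‖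

attribute [instance] Correspondence.normedAddCommGroup Correspondence.normedSpace
  Correspondence.completeSpace Correspondence.leftModule Correspondence.rightModule
  Correspondence.smulCommClass Correspondence.leftTower Correspondence.rightTower

variable {B : Type u} [CStarAlgebra B]

theorem exists_star_mul_self_of_mem_closure {s : Set B} (hs : ∀ a ∈ s, ∃ b, a = star b * b) {a : B}
    (ha : a ∈ closure s) : ∃ b, a = star b * b := by
  let _ := CStarAlgebra.spectralOrder B
  let _ := CStarAlgebra.spectralOrderedRing B
  rw [← CStarAlgebra.nonneg_iff_eq_star_mul_self]
  refine closure_minimal (fun c hc => ?_) (CStarAlgebra.isClosed_nonneg (A := B)) ha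
  exact CStarAlgebra.nonneg_iff_eq_star_mul_self.2 (hs c hc)

/-- The Hausdorff completion of a pre-correspondence. -/
def PreCorrespondence.completion (P : PreCorrespondence B) : Correspondence B where
  carrier := Completion P.carrier
  rinner := P.completionInner
  rinner_add_right x y z := by
    have hc := P.continuous_completionInner
    refine Completion.induction_on₃ x y z (isClosed_eq ?_ ?_) fun x y z => ?_
    · exact hc.comp (continuous_fst.prodMk (by fun_prop))
    · exact (hc.comp (continuous_fst.prodMk (continuous_fst.comp continuous_snd))).add
        (hc.comp (continuous_fst.prodMk (continuous_snd.comp continuous_snd)))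
    · rw [← Completion.coe_add]
      simp only [P.completionInner_coe, P.rinner_add_right]
  rinner_op_smul_right x y b := by
    have hc := P.continuous_completionInner
    refine Completion.induction_on₂ x y (isClosed_eq ?_ ?_) fun x y => ?_
    · exact hc.comp (continuous_fst.prodMk ((uniformContinuous_const_smul _).continuous.comp continuous_snd))
    · exact hc.mul continuous_const
    · rw [← Completion.coe_smul]
      simp only [P.completionInner_coe, P.rinner_op_smul_right]
  star_rinner x y := by
    have hc := P.continuous_completionInner
    refine Completion.induction_on₂ x y (isClosed_eq ?_ ?_) fun x y => ?_
    · exact hc.star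
    · exact hc.comp (continuous_snd.prodMk continuous_fst)
    · simp only [P.completionInner_coe, P.star_rinner]
  rinner_smul_left b x y := by
    have hc := P.continuous_completionInner
    refine Completion.induction_on₂ x y (isClosed_eq ?_ ?_) fun x y => ?_
    · exact hc.comp (((uniformContinuous_const_smul _).continuous.comp continuous_fst).prodMk continuous_snd)
    · exact hc.comp (continuous_fst.prodMk ((uniformContinuous_const_smul _).continuous.comp continuous_snd))
    · rw [← Completion.coe_smul, ← Completion.coe_smul]
      simp only [P.completionInner_coe, P.rinner_smul_left]
  rinner_self_nonneg x := by
    have hc : Continuous fun x => P.completionInner x x :=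
      P.continuous_completionInner.comp (continuous_id.prodMk continuous_id)
    refine exists_star_mul_self_of_mem_closure
      (s := Set.range fun x : P.carrier => P.rinner x x) ?_ ?_
    · rintro _ ⟨x, rfl⟩; exact P.rinner_self_nonneg x
    · refine closure_mono ?_ (hc.range_subset_closure_image_dense Completion.denseRange_coe ⟨x, rfl⟩)
      rintro _ ⟨_, ⟨y, rfl⟩, rfl⟩
      exact ⟨y, (P.completionInner_coe y y).symm⟩
  norm_sq_eq_rinner x := by
    have hc : Continuous fun x => P.completionInner x x :=
      P.continuous_completionInner.comp (continuous_id.prodMk continuous_id)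
    refine Completion.induction_on x (isClosed_eq (by fun_prop) hc.norm) fun x => ?_
    rw [Completion.norm_coe, P.completionInner_coe, P.norm_sq]

theorem exists_eq_star_mul_self_of_conjugates {C : Type*} [CStarAlgebra C] {a : C}
    (ha : IsSelfAdjoint a) (h : ∀ d e : C, star d * a * d = -(star e * e) → e = 0) :
    ∃ c, a = star c * c := by
  let _ := CStarAlgebra.spectralOrder C
  let _ := CStarAlgebra.spectralOrderedRing C
  have hd : 0 ≤ a⁻ := CFC.negPart_nonneg a
  have hd3 : 0 ≤ a⁻ * a⁻ * a⁻ := by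
    have := star_left_conjugate_nonneg hd a⁻
    rwa [hd.isSelfAdjoint.star_eq] at this
  obtain ⟨e, he⟩ := CStarAlgebra.nonneg_iff_eq_star_mul_self.1 hd3
  have hada : star a⁻ * a * a⁻ = -(star e * e) := by
    rw [← he, hd.isSelfAdjoint.star_eq]
    nth_rw 2 [← CFC.posPart_sub_negPart a ha]
    rw [mul_sub, CFC.negPart_mul_posPart, zero_sub, neg_mul]
  have hd0 : a⁻ = 0 := by
    have h0 : a⁻ * a⁻ * a⁻ = 0 := by rw [he, h _ _ hada, mul_zero]
    have h1 : star (star a⁻ * a⁻) * (star a⁻ * a⁻) = 0 := by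
      rw [star_mul, star_star, hd.isSelfAdjoint.star_eq, ← mul_assoc, h0, zero_mul]
    exact (CStarRing.star_mul_self_eq_zero_iff _).1 ((CStarRing.star_mul_self_eq_zero_iff _).1 h1)
  exact CStarAlgebra.nonneg_iff_eq_star_mul_self.1 ((CFC.negPart_eq_zero_iff a ha).1 hd0)

namespace Correspondence

/-- Forget the norm of a correspondence. -/
def toPre (M : Correspondence B) : PreCorrespondence B where
  carrier := M.carrier
  rinner := M.rinner
  rinner_add_right := M.rinner_add_right
  rinner_op_smul_right := M.rinner_op_smul_right
  star_rinner := M.star_rinner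
  rinner_smul_left := M.rinner_smul_left
  rinner_self_nonneg := M.rinner_self_nonneg

variable (M N : Correspondence B)

theorem rinner_sum_sum {ι : Type*} (s : Finset ι) (x y : ι → M.carrier) :
    M.rinner (∑ i ∈ s, x i) (∑ j ∈ s, y j) = ∑ i ∈ s, ∑ j ∈ s, M.rinner (x i) (y j) :=
  M.toPre.rinner_sum_sum s x y

theorem rinner_sum_right {ι : Type*} (s : Finset ι) (x : M.carrier) (y : ι → M.carrier) :
    M.rinner x (∑ j ∈ s, y j) = ∑ j ∈ s, M.rinner x (y j) :=
  map_sum (M.toPre.sesq x) y s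

theorem rinner_add_left (x y z : M.carrier) :
    M.rinner (x + y) z = M.rinner x z + M.rinner y z :=
  M.toPre.rinner_add_left x y z

theorem rinner_smul_right (c : ℂ) (x y : M.carrier) :
    M.rinner x (c • y) = c • M.rinner x y :=
  M.toPre.rinner_smul_right c x y

theorem rinner_smul_left_complex (c : ℂ) (x y : M.carrier) :
    M.rinner (c • x) y = conj c • M.rinner x y :=
  M.toPre.rinner_smul_left_complex c x y

theorem rinner_op_smul_left (b : B) (x y : M.carrier) :
    M.rinner (op b • x) y = star b * M.rinner x y :=
  M.toPre.rinner_op_smul_left b x y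

/-- Gram matrices are positive in the matrix algebra over `B`. -/
theorem exists_gram {n : ℕ} (x : Fin n → M.carrier) :
    ∃ c : Fin n → Fin n → B, ∀ i j, M.rinner (x i) (x j) = ∑ k, star (c k i) * c k j := by
  let _ := CStarAlgebra.spectralOrder B
  let _ := CStarAlgebra.spectralOrderedRing B
  let a : CStarMatrix (Fin n) (Fin n) B := CStarMatrix.ofMatrix fun i j => M.rinner (x i) (x j)
  have ha : IsSelfAdjoint a := by
    ext i j
    rw [CStarMatrix.star_apply]
    exact M.star_rinner _ _
  obtain ⟨c, hc⟩ := exists_eq_star_mul_self_of_conjugates ha fun d e hde => by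
    ext i j
    have h1 : (star d * a * d) j j =
        M.rinner (∑ i, op (d i j) • x i) (∑ k, op (d k j) • x k) := by
      rw [M.rinner_sum_sum, CStarMatrix.mul_apply, Finset.sum_comm]
      refine Finset.sum_congr rfl fun k _ => ?_
      rw [CStarMatrix.mul_apply, Finset.sum_mul]
      refine Finset.sum_congr rfl fun i _ => ?_
      rw [M.rinner_op_smul_left, M.rinner_op_smul_right, CStarMatrix.star_apply, mul_assoc]
      rfl
    obtain ⟨b, hb⟩ := M.rinner_self_nonneg (∑ i, op (d i j) • x i)
    have h2 : 0 ≤ -((star e * e) j j) := by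
      rw [← CStarMatrix.neg_apply, ← hde, h1, hb]
      exact star_mul_self_nonneg b
    have h3 : (star e * e) j j = ∑ i, star (e i j) * e i j := by
      rw [CStarMatrix.mul_apply]; rfl
    have h4 : ∑ i, star (e i j) * e i j = 0 :=
      le_antisymm (h3 ▸ neg_nonneg.1 h2) (Finset.sum_nonneg fun i _ => star_mul_self_nonneg _)
    have h5 := (Finset.sum_eq_zero_iff_of_nonneg
      fun i _ => star_mul_self_nonneg (e i j)).1 h4 i (Finset.mem_univ i)
    exact CStarRing.star_mul_self_eq_zero_iff _ |>.1 h5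
  refine ⟨fun k i => c k i, fun i j => ?_⟩
  have := congrArg (fun m : CStarMatrix (Fin n) (Fin n) B => m i j) hc
  simp only [CStarMatrix.mul_apply, CStarMatrix.star_apply] at this
  exact this

/-- The algebraic tensor product over `ℂ` underlying the interior tensor product; `B` acts from the
left on the first and from the right on the second factor. -/
def TensorCarrier : Type u := M.carrier ⊗[ℂ] N.carrier

namespace TensorCarrier

instance : AddCommGroup (TensorCarrier M N) :=
  inferInstanceAs (AddCommGroup (M.carrier ⊗[ℂ] N.carrier))

instance : Module ℂ (TensorCarrier M N) :=
  inferInstanceAs (Module ℂ (M.carrier ⊗[ℂ] N.carrier))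

instance : Module B (TensorCarrier M N) :=
  inferInstanceAs (Module B (M.carrier ⊗[ℂ] N.carrier))

instance : IsScalarTower ℂ B (TensorCarrier M N) :=
  inferInstanceAs (IsScalarTower ℂ B (M.carrier ⊗[ℂ] N.carrier))

instance : Module Bᵐᵒᵖ (TensorCarrier M N) :=
  Module.compHom (M.carrier ⊗[ℂ] N.carrier)
    ((Module.End.lTensorAlgHom ℂ N.carrier M.carrier).comp
      (Algebra.lsmul ℂ ℂ N.carrier : Bᵐᵒᵖ →ₐ[ℂ] Module.End ℂ N.carrier)).toRingHom

variable {M N} in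
/-- The elementary tensor `x ⊗ y`. -/
def tmul (x : M.carrier) (y : N.carrier) : TensorCarrier M N := x ⊗ₜ[ℂ] y

variable {M N}

theorem smul_tmul (b : B) (x : M.carrier) (y : N.carrier) : b • tmul x y = tmul (b • x) y := rfl

theorem op_smul_tmul (b : Bᵐᵒᵖ) (x : M.carrier) (y : N.carrier) :
    b • tmul x y = tmul x (b • y) := rfl

theorem complex_smul_tmul (c : ℂ) (x : M.carrier) (y : N.carrier) :
    c • tmul x y = tmul (c • x) y := rfl

@[elab_as_elim]
theorem induction {p : TensorCarrier M N → Prop} (t : TensorCarrier M N)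
    (h : ∀ x y, p (tmul x y)) (hadd : ∀ s t, p s → p t → p (s + t)) : p t :=
  TensorProduct.induction_on t
    (by simpa [tmul] using h 0 0)
    h hadd

theorem exists_eq_sum (t : TensorCarrier M N) :
    ∃ (n : ℕ) (x : Fin n → M.carrier) (y : Fin n → N.carrier), t = ∑ i, tmul (x i) (y i) := by
  induction t using induction with
  | h x y => exact ⟨1, fun _ => x, fun _ => y, by simp⟩
  | hadd s t hs ht =>
    obtain ⟨n, x, y, rfl⟩ := hs
    obtain ⟨m, x', y', rfl⟩ := ht
    exact ⟨n + m, Fin.append x x', Fin.append y y', by simp [Fin.sum_univ_add]⟩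

variable (M N)

instance : IsScalarTower ℂ Bᵐᵒᵖ (TensorCarrier M N) where
  smul_assoc c b t := by
    induction t using induction with
    | h x y =>
      rw [op_smul_tmul, op_smul_tmul, smul_assoc]
      exact TensorProduct.tmul_smul c x (b • y)
    | hadd s t hs ht => rw [smul_add, smul_add, smul_add, hs, ht]

instance : SMulCommClass B Bᵐᵒᵖ (TensorCarrier M N) where
  smul_comm a b t := by
    induction t using induction with
    | h x y => rfl
    | hadd s t hs ht => rw [smul_add, smul_add, smul_add, smul_add, hs, ht]

/-- The sesquilinear map with `⟨x₁ ⊗ y₁, x₂ ⊗ y₂⟩ = ⟨y₁, ⟨x₁, x₂⟩ • y₂⟩`. -/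
def sesq : TensorCarrier M N →ₗ⋆[ℂ] TensorCarrier M N →ₗ[ℂ] B :=
  TensorProduct.lift (LinearMap.mk₂'ₛₗ (starRingEnd ℂ) (starRingEnd ℂ)
    (fun x y => TensorProduct.lift (LinearMap.mk₂ ℂ
      (fun x' y' => N.rinner y (M.rinner x x' • y'))
      (fun x₁ x₂ y' => by rw [M.rinner_add_right, add_smul, N.rinner_add_right])
      (fun c x' y' => by rw [M.rinner_smul_right, smul_assoc, N.rinner_smul_right])
      (fun x' y₁ y₂ => by rw [smul_add, N.rinner_add_right])
      (fun c x' y' => by rw [smul_comm, N.rinner_smul_right])))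
    (fun x₁ x₂ y => TensorProduct.ext' fun x' y' => by
      change N.rinner y (M.rinner (x₁ + x₂) x' • y') =
        N.rinner y (M.rinner x₁ x' • y') + N.rinner y (M.rinner x₂ x' • y')
      rw [M.rinner_add_left, add_smul, N.rinner_add_right])
    (fun c x y => TensorProduct.ext' fun x' y' => by
      change N.rinner y (M.rinner (c • x) x' • y') = conj c • N.rinner y (M.rinner x x' • y')
      rw [M.rinner_smul_left_complex, smul_assoc, N.rinner_smul_right])
    (fun x y₁ y₂ => TensorProduct.ext' fun x' y' => by
      change N.rinner (y₁ + y₂) (M.rinner x x' • y') =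
        N.rinner y₁ (M.rinner x x' • y') + N.rinner y₂ (M.rinner x x' • y')
      rw [N.rinner_add_left])
    (fun c x y => TensorProduct.ext' fun x' y' => by
      change N.rinner (c • y) (M.rinner x x' • y') = conj c • N.rinner y (M.rinner x x' • y')
      rw [N.rinner_smul_left_complex]))

theorem sesq_tmul (x x' : M.carrier) (y y' : N.carrier) :
    sesq M N (tmul x y) (tmul x' y') = N.rinner y (M.rinner x x' • y') := rfl

end TensorCarrier

/-- The algebraic tensor product of two correspondences with its semi-inner product. -/
def preTensor : PreCorrespondence B where
  carrier := TensorCarrier M N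
  rinner := fun s t => TensorCarrier.sesq M N s t
  rinner_add_right s := map_add _
  rinner_op_smul_right s t b := by
    induction s using TensorCarrier.induction with
    | h x y =>
      induction t using TensorCarrier.induction with
      | h x' y' =>
        rw [TensorCarrier.op_smul_tmul, TensorCarrier.sesq_tmul, TensorCarrier.sesq_tmul,
          smul_comm, N.rinner_op_smul_right]
      | hadd t t' h h' => rw [smul_add, map_add, map_add, h, h', add_mul]
    | hadd s s' h h' => rw [map_add, LinearMap.add_apply, LinearMap.add_apply, h, h', add_mul]
  star_rinner s t := by
    induction s using TensorCarrier.induction with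
    | h x y =>
      induction t using TensorCarrier.induction with
      | h x' y' =>
        rw [TensorCarrier.sesq_tmul, TensorCarrier.sesq_tmul, N.star_rinner, N.rinner_smul_left,
          M.star_rinner]
      | hadd t t' h h' => rw [map_add, map_add, LinearMap.add_apply, star_add, h, h']
    | hadd s s' h h' => rw [map_add, map_add, LinearMap.add_apply, star_add, h, h']
  rinner_smul_left b s t := by
    induction s using TensorCarrier.induction with
    | h x y =>
      induction t using TensorCarrier.induction with
      | h x' y' =>
        rw [TensorCarrier.smul_tmul, TensorCarrier.smul_tmul, TensorCarrier.sesq_tmul,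
          TensorCarrier.sesq_tmul, M.rinner_smul_left]
      | hadd t t' h h' => rw [smul_add, map_add, map_add, h, h']
    | hadd s s' h h' =>
      rw [smul_add, map_add, map_add, LinearMap.add_apply, LinearMap.add_apply, h, h']
  rinner_self_nonneg t := by
    let _ := CStarAlgebra.spectralOrder B
    let _ := CStarAlgebra.spectralOrderedRing B
    rw [← CStarAlgebra.nonneg_iff_eq_star_mul_self]
    obtain ⟨n, x, y, rfl⟩ := TensorCarrier.exists_eq_sum t
    obtain ⟨c, hc⟩ := M.exists_gram x
    have h : TensorCarrier.sesq M N (∑ i, TensorCarrier.tmul (x i) (y i))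
        (∑ i, TensorCarrier.tmul (x i) (y i)) =
        ∑ k, N.rinner (∑ i, c k i • y i) (∑ j, c k j • y j) := by
      simp only [map_sum, LinearMap.sum_apply, TensorCarrier.sesq_tmul, N.rinner_sum_sum, hc,
        Finset.sum_smul, N.rinner_smul_left, ← mul_smul]
      rw [Finset.sum_comm]
      simp only [N.rinner_sum_right]
      exact (Finset.sum_congr rfl fun i _ => Finset.sum_comm).trans Finset.sum_comm
    rw [h]
    refine Finset.sum_nonneg fun k _ => ?_
    obtain ⟨b, hb⟩ := N.rinner_self_nonneg (∑ i, c k i • y i)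
    rw [hb]; exact star_mul_self_nonneg b

/-- The (interior) tensor product `M ⊗_B N` of correspondences: the Hausdorff completion of the
algebraic tensor product for the inner product
`⟨x₁ ⊗ y₁, x₂ ⊗ y₂⟩ = ⟨y₁, ⟨x₁, x₂⟩ • y₂⟩`. (The vectors `(x • b) ⊗ y - x ⊗ (b • y)` have length
zero, so that this is balanced over `B`.) -/
def tensor : Correspondence B := (preTensor M N).completion

variable {M N}

/-- The elementary tensor `x ⊗ y` in `M ⊗_B N`. -/
def tmul (x : M.carrier) (y : N.carrier) : (tensor M N).carrier :=
  Completion.coe' (α := (preTensor M N).carrier) (TensorCarrier.tmul x y)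

theorem rinner_tmul (x x' : M.carrier) (y y' : N.carrier) :
    (tensor M N).rinner (tmul x y) (tmul x' y') = N.rinner y (M.rinner x x' • y') :=
  (preTensor M N).completionInner_coe _ _

theorem tmul_balanced (x : M.carrier) (b : B) (y : N.carrier) :
    tmul (op b • x) y = tmul x (b • y) := by
  have h : ‖tmul (op b • x) y - tmul x (b • y)‖ ^ 2 = 0 := by
    rw [norm_sq_eq_rinner, norm_eq_zero]
    refine ((tensor M N).toPre.rinner_sub_self (tmul (op b • x) y) (tmul x (b • y))).trans ?_
    change (tensor M N).rinner _ _ - (tensor M N).rinner _ _ - (tensor M N).rinner _ _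
      + (tensor M N).rinner _ _ = 0
    simp only [rinner_tmul, M.rinner_op_smul_left, M.rinner_op_smul_right, N.rinner_smul_left,
      ← mul_smul, mul_assoc]
    abel
  exact sub_eq_zero.1 (norm_eq_zero.1 (pow_eq_zero_iff two_ne_zero |>.1 h))

end Correspondence

namespace Correspondence

/-- `B` as a correspondence over itself, with `⟨a, b⟩ = a* b`. -/
def self (B : Type u) [CStarAlgebra B] : Correspondence B where
  carrier := B
  rinner a b := star a * b
  rinner_add_right a b c := mul_add _ _ _
  rinner_op_smul_right a b c := (mul_assoc _ _ _).symm
  star_rinner a b := by rw [star_mul, star_star]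
  rinner_smul_left a b c := by rw [smul_eq_mul, smul_eq_mul, star_mul, mul_assoc]
  rinner_self_nonneg a := ⟨a, rfl⟩
  norm_sq_eq_rinner a := by rw [CStarRing.norm_star_mul_self, pow_two]

/-- Isomorphisms of correspondences: bijective bimodule maps preserving the inner product. -/
@[ext]
structure Iso (M N : Correspondence B) where
  toEquiv : M.carrier ≃ₗ[ℂ] N.carrier
  map_smul_left : ∀ (b : B) x, toEquiv (b • x) = b • toEquiv x
  map_smul_right : ∀ (b : Bᵐᵒᵖ) x, toEquiv (b • x) = b • toEquiv x
  map_rinner : ∀ x y, N.rinner (toEquiv x) (toEquiv y) = M.rinner x y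

instance (M N : Correspondence B) : CoeFun (Iso M N) fun _ => M.carrier → N.carrier :=
  ⟨fun φ => φ.toEquiv⟩

/-- The tensor powers of a correspondence: `B`, `M`, `M ⊗ M`, `(M ⊗ M) ⊗ M`, ... -/
def pow (M : Correspondence B) : ℕ → Correspondence B
  | 0 => self B
  | 1 => M
  | n + 2 => tensor (pow M (n + 1)) M

end Correspondence

/-- A Hilbert `B`-bimodule: a `B`-bimodule which is both a right and a left Hilbert `B`-module (for
the same norm), where either action is adjointable for the inner product of the other side and
`_B⟨x, y⟩ z = x ⟨y, z⟩_B`. (That the left and the right norm agree is a consequence of the other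
properties of an equivalence bimodule.) -/
structure HilbertBimodule (B : Type u) [CStarAlgebra B] extends Correspondence B where
  linner : carrier → carrier → B
  linner_add_left : ∀ x y z, linner (x + y) z = linner x z + linner y z
  linner_smul_left : ∀ (b : B) x y, linner (b • x) y = b * linner x y
  star_linner : ∀ x y, star (linner x y) = linner y x
  linner_op_smul_left : ∀ (b : B) x y, linner (op b • x) y = linner x (op (star b) • y)
  linner_self_nonneg : ∀ x, ∃ b, linner x x = star b * b
  norm_sq_eq_linner : ∀ x, ‖x‖ ^ 2 = ‖linner x x‖
  linner_smul : ∀ x y z, linner x y • z = op (rinner y z) • x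

namespace HilbertBimodule

/-- A Morita equivalence `B`-bimodule is a Hilbert bimodule for which both inner products are
full. -/
structure IsMorita (N : HilbertBimodule B) : Prop where
  dense_rinner :
    Dense (Submodule.span ℂ (Set.range fun p : N.carrier × N.carrier => N.rinner p.1 p.2) : Set B)
  dense_linner :
    Dense (Submodule.span ℂ (Set.range fun p : N.carrier × N.carrier => N.linner p.1 p.2) : Set B)

/-- Isomorphisms of Hilbert bimodules preserve the bimodule structure and both inner products. -/
structure Iso (M N : HilbertBimodule B) extends
    Correspondence.Iso M.toCorrespondence N.toCorrespondence where
  map_linner : ∀ x y, N.linner (toEquiv x) (toEquiv y) = M.linner x y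

/-- The conjugate vector space underlying the dual bimodule. -/
def DualCarrier (N : HilbertBimodule B) : Type u := N.carrier

variable (N : HilbertBimodule B)

/-- The element `x̃` of the dual bimodule given by `x`. -/
def toDual (x : N.carrier) : N.DualCarrier := x

/-- The element `x` underlying the element `x̃` of the dual bimodule. -/
def ofDual (x : N.DualCarrier) : N.carrier := x

instance : NormedAddCommGroup N.DualCarrier := inferInstanceAs (NormedAddCommGroup N.carrier)

instance : CompleteSpace N.DualCarrier := inferInstanceAs (CompleteSpace N.carrier)

instance : NormedSpace ℂ N.DualCarrier where
  smul c x := N.toDual (conj c • N.ofDual x)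
  one_smul x := by
    change conj (1 : ℂ) • N.ofDual x = N.ofDual x
    rw [map_one, one_smul]
  mul_smul c d x := by
    change conj (c * d) • N.ofDual x = conj c • conj d • N.ofDual x
    rw [map_mul, mul_smul]
  smul_zero c := smul_zero (A := N.carrier) (conj c)
  smul_add c x y := smul_add (conj c) (N.ofDual x) (N.ofDual y)
  add_smul c d x := by
    change conj (c + d) • N.ofDual x = conj c • N.ofDual x + conj d • N.ofDual x
    rw [map_add, add_smul]
  zero_smul x := by
    change conj (0 : ℂ) • N.ofDual x = 0
    rw [map_zero, zero_smul]
  norm_smul_le c x := by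
    change ‖conj c • N.ofDual x‖ ≤ ‖c‖ * ‖N.ofDual x‖
    rw [norm_smul, RCLike.norm_conj]

instance : Module B N.DualCarrier where
  smul b x := N.toDual (op (star b) • N.ofDual x)
  one_smul x := by
    change op (star (1 : B)) • N.ofDual x = N.ofDual x
    rw [star_one, op_one, one_smul]
  mul_smul a b x := by
    change op (star (a * b)) • N.ofDual x = op (star a) • op (star b) • N.ofDual x
    rw [star_mul, op_mul, mul_smul]
  smul_zero b := smul_zero (A := N.carrier) (op (star b))
  smul_add b x y := smul_add (op (star b)) (N.ofDual x) (N.ofDual y)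
  add_smul a b x := by
    change op (star (a + b)) • N.ofDual x = op (star a) • N.ofDual x + op (star b) • N.ofDual x
    rw [star_add, op_add, add_smul]
  zero_smul x := by
    change op (star (0 : B)) • N.ofDual x = 0
    rw [star_zero, op_zero, zero_smul]

instance : Module Bᵐᵒᵖ N.DualCarrier where
  smul b x := N.toDual (star (unop b) • N.ofDual x)
  one_smul x := by
    change star (unop (1 : Bᵐᵒᵖ)) • N.ofDual x = N.ofDual x
    rw [unop_one, star_one, one_smul]
  mul_smul a b x := by
    change star (unop (a * b)) • N.ofDual x = star (unop a) • star (unop b) • N.ofDual x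
    rw [unop_mul, star_mul, mul_smul]
  smul_zero b := smul_zero (A := N.carrier) (star (unop b))
  smul_add b x y := smul_add (star (unop b)) (N.ofDual x) (N.ofDual y)
  add_smul a b x := by
    change star (unop (a + b)) • N.ofDual x =
      star (unop a) • N.ofDual x + star (unop b) • N.ofDual x
    rw [unop_add, star_add, add_smul]
  zero_smul x := by
    change star (unop (0 : Bᵐᵒᵖ)) • N.ofDual x = 0
    rw [unop_zero, star_zero, zero_smul]

instance : SMulCommClass B Bᵐᵒᵖ N.DualCarrier where
  smul_comm a b x := (smul_comm (star (unop b)) (op (star a)) (N.ofDual x)).symm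

instance : IsScalarTower ℂ B N.DualCarrier where
  smul_assoc c b x := by
    change op (star (c • b)) • N.ofDual x = conj c • op (star b) • N.ofDual x
    rw [star_smul, op_smul, smul_assoc]; rfl

instance : IsScalarTower ℂ Bᵐᵒᵖ N.DualCarrier where
  smul_assoc c b x := by
    change star (unop (c • b)) • N.ofDual x = conj c • star (unop b) • N.ofDual x
    rw [unop_smul, star_smul, smul_assoc]; rfl

/-- The dual bimodule: the conjugate space with `b • x̃ = (x • b*)~`, `x̃ • b = (b* • x)~`,
`⟨x̃, ỹ⟩_B = _B⟨x, y⟩` and `_B⟨x̃, ỹ⟩ = ⟨x, y⟩_B`. -/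
def dual : HilbertBimodule B where
  carrier := N.DualCarrier
  rinner x y := N.linner (N.ofDual x) (N.ofDual y)
  rinner_add_right x y z := by
    rw [← N.star_linner, ← N.star_linner (N.ofDual y), ← N.star_linner (N.ofDual z), ← star_add]
    exact congrArg star (N.linner_add_left _ _ _)
  rinner_op_smul_right x y b := by
    change N.linner (N.ofDual x) (star b • N.ofDual y) = _
    rw [← N.star_linner, N.linner_smul_left, star_mul, star_star, N.star_linner]
  star_rinner x y := N.star_linner _ _
  rinner_smul_left b x y := by
    change N.linner (op (star b) • N.ofDual x) (N.ofDual y) =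
      N.linner (N.ofDual x) (op (star (star b)) • N.ofDual y)
    rw [N.linner_op_smul_left]
  rinner_self_nonneg x := N.linner_self_nonneg _
  norm_sq_eq_rinner x := N.norm_sq_eq_linner _
  linner x y := N.rinner (N.ofDual x) (N.ofDual y)
  linner_add_left x y z := N.toCorrespondence.rinner_add_left _ _ _
  linner_smul_left b x y := by
    change N.rinner (op (star b) • N.ofDual x) (N.ofDual y) = _
    rw [N.toCorrespondence.rinner_op_smul_left, star_star]
  star_linner x y := N.star_rinner _ _
  linner_op_smul_left b x y := by
    change N.rinner (star b • N.ofDual x) (N.ofDual y) =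
      N.rinner (N.ofDual x) (star (star b) • N.ofDual y)
    rw [N.rinner_smul_left]
  linner_self_nonneg x := N.rinner_self_nonneg _
  norm_sq_eq_linner x := N.norm_sq_eq_rinner _
  linner_smul x y z := by
    change op (star (N.rinner (N.ofDual x) (N.ofDual y))) • N.ofDual z =
      star (N.linner (N.ofDual y) (N.ofDual z)) • N.ofDual x
    rw [N.star_rinner, N.star_linner, N.linner_smul]

/-- The correspondences `N(k)`: `N(0) = B`, `N(k) = N^{⊗ k}` and `N(-k) = N̄^{⊗ k}` for `k > 0`. -/
def zpow : ℤ → Correspondence B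
  | Int.ofNat n => N.toCorrespondence.pow n
  | Int.negSucc n => N.dual.toCorrespondence.pow (n + 1)

/-- The factor system associated with `N`: isomorphisms `N(k) ⊗_B N(l) ≅ N(k + l)` that are
associative, are given by the actions of `B` if `k = 0` or `l = 0`, by the tensor product if `k` and
`l` have the same sign, and by the two inner products if `{k, l} = {1, -1}`. By associativity, this
determines the isomorphisms for all `k` and `l`. -/
@[ext]
structure FactorSystem where
  Ψ : ∀ {k l m : ℤ}, k + l = m → Correspondence.Iso ((N.zpow k).tensor (N.zpow l)) (N.zpow m)
  assoc : ∀ {k₁ k₂ k₃ k₁₂ k₂₃ m : ℤ} (h₁₂ : k₁ + k₂ = k₁₂) (h₂₃ : k₂ + k₃ = k₂₃)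
    (h : k₁₂ + k₃ = m) (h' : k₁ + k₂₃ = m)
    (x : (N.zpow k₁).carrier) (y : (N.zpow k₂).carrier) (z : (N.zpow k₃).carrier),
    Ψ h (Correspondence.tmul (Ψ h₁₂ (Correspondence.tmul x y)) z) =
      Ψ h' (Correspondence.tmul x (Ψ h₂₃ (Correspondence.tmul y z)))
  zero_left : ∀ (k : ℤ) (b : B) (x : (N.zpow k).carrier),
    Ψ (zero_add k) (Correspondence.tmul (M := N.zpow 0) b x) = b • x
  zero_right : ∀ (k : ℤ) (x : (N.zpow k).carrier) (b : B),
    Ψ (add_zero k) (Correspondence.tmul (N := N.zpow 0) x b) = op b • x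
  pos : ∀ (n : ℕ) (u : ((N.toCorrespondence.pow (n + 1)).tensor N.toCorrespondence).carrier),
    Ψ (k := Int.ofNat (n + 1)) (l := Int.ofNat 1) (m := Int.ofNat (n + 2)) rfl u = u
  neg : ∀ (n : ℕ)
    (u : ((N.dual.toCorrespondence.pow (n + 1)).tensor N.dual.toCorrespondence).carrier),
    Ψ (k := Int.negSucc n) (l := Int.negSucc 0) (m := Int.negSucc (n + 1)) rfl u = u
  one_neg_one : ∀ x y : N.carrier,
    Ψ (k := Int.ofNat 1) (l := Int.negSucc 0) (m := Int.ofNat 0) rfl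
      (Correspondence.tmul (M := N.toCorrespondence) (N := N.dual.toCorrespondence)
        x (N.toDual y)) = N.linner x y
  neg_one_one : ∀ x y : N.carrier,
    Ψ (k := Int.negSucc 0) (l := Int.ofNat 1) (m := Int.ofNat 0) rfl
      (Correspondence.tmul (M := N.dual.toCorrespondence) (N := N.toCorrespondence)
        (N.toDual x) y) = N.rinner x y

end HilbertBimodule

/-- Morita equivalence `B`-bimodules. -/
structure MoritaBimodule (B : Type u) [CStarAlgebra B] extends HilbertBimodule B where
  isMorita : toHilbertBimodule.IsMorita

namespace MoritaBimodule

/-- Isomorphism of Morita equivalence bimodules. -/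
instance setoid (B : Type u) [CStarAlgebra B] : Setoid (MoritaBimodule B) where
  r M N := Nonempty (HilbertBimodule.Iso M.toHilbertBimodule N.toHilbertBimodule)
  iseqv :=
    { refl := fun M => ⟨⟨⟨LinearEquiv.refl ℂ _, fun _ _ => rfl, fun _ _ => rfl, fun _ _ => rfl⟩,
        fun _ _ => rfl⟩⟩
      symm := by
        rintro M N ⟨φ⟩
        refine ⟨⟨⟨φ.toEquiv.symm, fun b x => ?_, fun b x => ?_, fun x y => ?_⟩, fun x y => ?_⟩⟩
        · rw [LinearEquiv.symm_apply_eq, φ.map_smul_left, LinearEquiv.apply_symm_apply]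
        · rw [LinearEquiv.symm_apply_eq, φ.map_smul_right, LinearEquiv.apply_symm_apply]
        · rw [← φ.map_rinner, LinearEquiv.apply_symm_apply, LinearEquiv.apply_symm_apply]
        · rw [← φ.map_linner, LinearEquiv.apply_symm_apply, LinearEquiv.apply_symm_apply]
      trans := by
        rintro M N P ⟨φ⟩ ⟨ψ⟩
        refine ⟨⟨⟨φ.toEquiv.trans ψ.toEquiv, fun b x => ?_, fun b x => ?_, fun x y => ?_⟩,
          fun x y => ?_⟩⟩
        · simp only [LinearEquiv.trans_apply, φ.map_smul_left, ψ.map_smul_left]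
        · simp only [LinearEquiv.trans_apply, φ.map_smul_right, ψ.map_smul_right]
        · simp only [LinearEquiv.trans_apply, φ.map_rinner, ψ.map_rinner]
        · simp only [LinearEquiv.trans_apply, φ.map_linner, ψ.map_linner] }

end MoritaBimodule

/-- The set `Pic(B)` of isomorphism classes of Morita equivalence `B`-bimodules. -/
def Pic (B : Type u) [CStarAlgebra B] : Type (u + 1) := Quotient (MoritaBimodule.setoid B)

/-- The class of a Morita equivalence bimodule. -/
def MoritaBimodule.toPic (N : MoritaBimodule B) : Pic B := Quotient.mk _ N

/-- A C*-dynamical system: a strongly continuous action of a topological group `G` by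
`*`-automorphisms on a unital C*-algebra. -/
structure CStarDynamicalSystem (G : Type*) [Group G] [TopologicalSpace G] where
  A : Type u
  [cstarAlgebra : CStarAlgebra A]
  α : G →* (A ≃⋆ₐ[ℂ] A)
  continuous_apply : ∀ x, Continuous fun g => α g x

attribute [instance] CStarDynamicalSystem.cstarAlgebra

namespace CStarDynamicalSystem

variable {G : Type*} [Group G] [TopologicalSpace G] (S : CStarDynamicalSystem.{u} G)

/-- The Ellwood map `A ⊗ A → C(G, A)`, `x ⊗ y ↦ (g ↦ x α_g(y))`. -/
def ellwood : S.A ⊗[ℂ] S.A →ₗ[ℂ] C(G, S.A) :=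
  TensorProduct.lift (LinearMap.mk₂ ℂ
    (fun x y => ⟨fun g => x * S.α g y, continuous_const.mul (S.continuous_apply y)⟩)
    (fun x x' y => ContinuousMap.ext fun g => add_mul x x' _)
    (fun c x y => ContinuousMap.ext fun g => smul_mul_assoc c x _)
    (fun x y y' => ContinuousMap.ext fun g => by
      change x * S.α g (y + y') = x * S.α g y + x * S.α g y'
      rw [map_add, mul_add])
    (fun c x y => ContinuousMap.ext fun g => by
      change x * S.α g (c • y) = c • (x * S.α g y)
      rw [map_smul, mul_smul_comm]))

/-- Freeness: the Ellwood map has dense range. (For compact `G`, the compact-open topology of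
`C(G, A)` is the one of the supremum norm.) -/
def IsFree : Prop := DenseRange S.ellwood

end CStarDynamicalSystem

/-- The group `SO(2)`. -/
abbrev SO2 : Type := Matrix.specialOrthogonalGroup (Fin 2) ℝ

/-- The fundamental character of `SO(2)`, sending the rotation by `θ` to `e^{iθ}`. -/
def SO2.character (g : SO2) : ℂ := ⟨g.1 0 0, g.1 1 0⟩

theorem SO2.conj_character_mul (g : SO2) : conj g.character * g.character = 1 := by
  obtain ⟨h1, h2, h3⟩ := Matrix.mem_specialOrthogonalGroup_fin_two_iff.1 g.2
  rw [h2] at h3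
  apply Complex.ext
  · simp [SO2.character]; nlinarith
  · simp [SO2.character]; ring

theorem SO2.character_mul_conj (g : SO2) : g.character * conj g.character = 1 := by
  rw [mul_comm, g.conj_character_mul]

theorem SO2.character_ne_zero (g : SO2) : g.character ≠ 0 := fun h => by
  simpa [h] using g.conj_character_mul

/-- A free C*-dynamical system with structure group `SO(2)` and fixed point algebra `B`; the latter
is identified with the fixed points by means of `ι`. -/
structure FreeSystem (B : Type u) [CStarAlgebra B] extends CStarDynamicalSystem.{u} SO2 where
  isFree : toCStarDynamicalSystem.IsFree
  ι : B →⋆ₐ[ℂ] A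
  ι_injective : Function.Injective ι
  range_ι : Set.range ι = {x | ∀ g, α g x = x}

namespace FreeSystem

variable (S : FreeSystem B)

theorem α_ι (g : SO2) (b : B) : S.α g (S.ι b) = S.ι b := by
  have h : S.ι b ∈ {x | ∀ g, S.α g x = x} := S.range_ι ▸ ⟨b, rfl⟩
  exact h g

/-- The element of `B` corresponding to a fixed point of the action (and `0` for other
elements). -/
def toB (x : S.A) : B :=
  open Classical in if h : ∃ b, S.ι b = x then h.choose else 0

theorem ι_toB {x : S.A} (hx : ∀ g, S.α g x = x) : S.ι (S.toB x) = x := by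
  have h : ∃ b, S.ι b = x := by
    have h : x ∈ {x | ∀ g, S.α g x = x} := hx
    rwa [← S.range_ι] at h
  rw [toB, dif_pos h]
  exact h.choose_spec

/-- The isotypic component `A(k) = {x | α_g(x) = χ(g)^k x for all g}`. -/
def isotypicSubmodule (k : ℤ) : Submodule ℂ S.A where
  carrier := {x | ∀ g, S.α g x = g.character ^ k • x}
  add_mem' := fun hx hy g => by rw [map_add, hx g, hy g, smul_add]
  zero_mem' := fun g => by rw [map_zero, smul_zero]
  smul_mem' := fun c x hx g => by rw [map_smul, hx g, smul_comm]

theorem isClosed_isotypicSubmodule (k : ℤ) : IsClosed (S.isotypicSubmodule k : Set S.A) := by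
  have h : (S.isotypicSubmodule k : Set S.A) = ⋂ g, {x | S.α g x = g.character ^ k • x} := by
    ext x; simp [isotypicSubmodule]
  rw [h]
  refine isClosed_iInter fun g => isClosed_eq ?_ (by fun_prop)
  exact (StarAlgEquiv.isometry (S.α g)).continuous

theorem star_mul_fixed {k : ℤ} (x y : S.isotypicSubmodule k) (g : SO2) :
    S.α g (star (x : S.A) * y) = star (x : S.A) * y := by
  rw [map_mul, map_star, x.2 g, y.2 g, star_smul, smul_mul_smul_comm, star_zpow₀, ← mul_zpow]
  rw [show star g.character * g.character = 1 from g.conj_character_mul, one_zpow, one_smul]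

theorem mul_star_fixed {k : ℤ} (x y : S.isotypicSubmodule k) (g : SO2) :
    S.α g ((x : S.A) * star (y : S.A)) = (x : S.A) * star (y : S.A) := by
  rw [map_mul, map_star, x.2 g, y.2 g, star_smul, smul_mul_smul_comm, star_zpow₀, ← mul_zpow]
  rw [show g.character * star g.character = 1 from g.character_mul_conj, one_zpow, one_smul]

/-- The isotypic component `A(k)` as a type, a `B`-bimodule by multiplication in `A`. -/
def IsotypicCarrier (k : ℤ) : Type u := S.isotypicSubmodule k

/-- The inclusion of an isotypic component into `A`. -/
def val {k : ℤ} (x : S.IsotypicCarrier k) : S.A := x.1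

section

variable {S} {k : ℤ}

theorem val_injective : Function.Injective (S.val (k := k)) := Subtype.val_injective

instance : NormedAddCommGroup (S.IsotypicCarrier k) :=
  inferInstanceAs (NormedAddCommGroup (S.isotypicSubmodule k))

instance : NormedSpace ℂ (S.IsotypicCarrier k) :=
  inferInstanceAs (NormedSpace ℂ (S.isotypicSubmodule k))

instance : CompleteSpace (S.IsotypicCarrier k) :=
  (S.isClosed_isotypicSubmodule k).completeSpace_coe

instance : SMul B (S.IsotypicCarrier k) where
  smul b x := ⟨S.ι b * S.val x, fun g => by
    rw [map_mul, S.α_ι, show S.α g (S.val x) = _ from x.2 g, mul_smul_comm]; rfl⟩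

instance : SMul Bᵐᵒᵖ (S.IsotypicCarrier k) where
  smul b x := ⟨S.val x * S.ι (unop b), fun g => by
    rw [map_mul, S.α_ι, show S.α g (S.val x) = _ from x.2 g, smul_mul_assoc]; rfl⟩

theorem val_add (x y : S.IsotypicCarrier k) : S.val (x + y) = S.val x + S.val y := rfl

theorem val_zero : S.val (0 : S.IsotypicCarrier k) = 0 := rfl

theorem val_smul_complex (c : ℂ) (x : S.IsotypicCarrier k) : S.val (c • x) = c • S.val x := rfl

theorem val_smul (b : B) (x : S.IsotypicCarrier k) : S.val (b • x) = S.ι b * S.val x := rfl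

theorem val_op_smul (b : Bᵐᵒᵖ) (x : S.IsotypicCarrier k) :
    S.val (b • x) = S.val x * S.ι (unop b) := rfl

theorem norm_val (x : S.IsotypicCarrier k) : ‖S.val x‖ = ‖x‖ := rfl

instance : Module B (S.IsotypicCarrier k) where
  one_smul x := val_injective (by rw [val_smul, map_one, one_mul])
  mul_smul a b x := val_injective (by simp only [val_smul, map_mul, mul_assoc])
  smul_zero b := val_injective (by rw [val_smul, val_zero, mul_zero])
  smul_add b x y := val_injective (by simp only [val_smul, val_add, mul_add])
  add_smul a b x := val_injective (by simp only [val_smul, val_add, map_add, add_mul])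
  zero_smul x := val_injective (by rw [val_smul, map_zero, zero_mul, val_zero])

instance : Module Bᵐᵒᵖ (S.IsotypicCarrier k) where
  one_smul x := val_injective (by rw [val_op_smul, unop_one, map_one, mul_one])
  mul_smul a b x := val_injective (by simp only [val_op_smul, unop_mul, map_mul, mul_assoc])
  smul_zero b := val_injective (by rw [val_op_smul, val_zero, zero_mul])
  smul_add b x y := val_injective (by simp only [val_op_smul, val_add, add_mul])
  add_smul a b x := val_injective (by simp only [val_op_smul, val_add, unop_add, map_add, mul_add])
  zero_smul x := val_injective (by rw [val_op_smul, unop_zero, map_zero, mul_zero, val_zero])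

instance : SMulCommClass B Bᵐᵒᵖ (S.IsotypicCarrier k) where
  smul_comm a b x := val_injective (by simp only [val_smul, val_op_smul, mul_assoc])

instance : IsScalarTower ℂ B (S.IsotypicCarrier k) where
  smul_assoc c b x := val_injective (by
    simp only [val_smul, val_smul_complex, map_smul, smul_mul_assoc])

instance : IsScalarTower ℂ Bᵐᵒᵖ (S.IsotypicCarrier k) where
  smul_assoc c b x := val_injective (by
    simp only [val_op_smul, val_smul_complex, unop_smul, map_smul, mul_smul_comm])

theorem ι_toB_star_mul (x y : S.IsotypicCarrier k) :
    S.ι (S.toB (star (S.val x) * S.val y)) = star (S.val x) * S.val y :=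
  S.ι_toB (S.star_mul_fixed x y)

theorem ι_toB_mul_star (x y : S.IsotypicCarrier k) :
    S.ι (S.toB (S.val x * star (S.val y))) = S.val x * star (S.val y) :=
  S.ι_toB (S.mul_star_fixed x y)

end

theorem exists_of_ι_eq {b : B} {x : S.A} (h : S.ι b = star x * x) : ∃ c, b = star c * c := by
  let _ := CStarAlgebra.spectralOrder S.A
  let _ := CStarAlgebra.spectralOrderedRing S.A
  refine exists_eq_star_mul_self_of_conjugates ?_ fun d e hde => ?_
  · exact S.ι_injective (by rw [map_star, h, star_mul, star_star])
  · have h1 : star (x * S.ι d) * (x * S.ι d) = -(star (S.ι e) * S.ι e) := by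
      rw [← map_star, ← map_mul, ← map_neg, ← hde, map_mul, map_mul, h, star_mul, map_star]
      simp only [mul_assoc]
    have h2 : star (S.ι e) * S.ι e = 0 := by
      refine le_antisymm ?_ (star_mul_self_nonneg _)
      rw [← neg_nonneg, ← h1]
      exact star_mul_self_nonneg _
    exact S.ι_injective (((CStarRing.star_mul_self_eq_zero_iff _).1 h2).trans (map_zero S.ι).symm)

theorem norm_ι (b : B) : ‖S.ι b‖ = ‖b‖ := NonUnitalStarAlgHom.norm_map S.ι S.ι_injective b

/-- The isotypic component `A(k)` as a Hilbert `B`-bimodule, with `⟨x, y⟩_B = x* y` and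
`_B⟨x, y⟩ = x y*`. -/
def isotypic (k : ℤ) : HilbertBimodule B where
  carrier := S.IsotypicCarrier k
  rinner x y := S.toB (star (S.val x) * S.val y)
  rinner_add_right x y z := S.ι_injective (by
    rw [map_add, ι_toB_star_mul, ι_toB_star_mul, ι_toB_star_mul, val_add, mul_add])
  rinner_op_smul_right x y b := S.ι_injective (by
    rw [map_mul, ι_toB_star_mul, ι_toB_star_mul, val_op_smul, unop_op, mul_assoc])
  star_rinner x y := S.ι_injective (by
    simp only [map_star, ι_toB_star_mul, star_mul, star_star])
  rinner_smul_left b x y := S.ι_injective (by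
    simp only [val_smul, star_mul, map_star, mul_assoc])
  rinner_self_nonneg x := S.exists_of_ι_eq (ι_toB_star_mul x x)
  norm_sq_eq_rinner x := by
    rw [← S.norm_ι, ι_toB_star_mul, CStarRing.norm_star_mul_self, pow_two, norm_val]
  linner x y := S.toB (S.val x * star (S.val y))
  linner_add_left x y z := S.ι_injective (by
    rw [map_add, ι_toB_mul_star, ι_toB_mul_star, ι_toB_mul_star, val_add, add_mul])
  linner_smul_left b x y := S.ι_injective (by
    rw [map_mul, ι_toB_mul_star, ι_toB_mul_star, val_smul, mul_assoc])
  star_linner x y := S.ι_injective (by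
    simp only [map_star, ι_toB_mul_star, star_mul, star_star])
  linner_op_smul_left b x y := S.ι_injective (by
    simp only [val_op_smul, unop_op, star_mul, map_star, star_star, mul_assoc])
  linner_self_nonneg x := S.exists_of_ι_eq (x := star (S.val x)) (by
    rw [star_star]; exact ι_toB_mul_star x x)
  norm_sq_eq_linner x := by
    rw [← S.norm_ι, ι_toB_mul_star, CStarRing.norm_self_mul_star, pow_two, norm_val]
  linner_smul x y z := val_injective (by
    simp only [val_smul, val_op_smul, unop_op, ι_toB_mul_star, ι_toB_star_mul, mul_assoc])

/-- `A` is the C*-dynamical system given by the factor system `F` of `N`: there are isomorphisms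
`φ_k : N(k) ≅ A(k)` that are the given identification for `k = 0` and turn the maps
`Ψ_{k,l} : N(k) ⊗_B N(l) → N(k + l)` into the multiplication of `A`. -/
def HasFactorSystem {N : HilbertBimodule B} (F : N.FactorSystem) : Prop :=
  ∃ φ : ∀ k : ℤ, Correspondence.Iso (N.zpow k) (S.isotypic k).toCorrespondence,
    (∀ b : B, S.val (φ 0 b) = S.ι b) ∧
    ∀ {k l m : ℤ} (h : k + l = m) (x : (N.zpow k).carrier) (y : (N.zpow l).carrier),
      S.val (φ m (F.Ψ h (Correspondence.tmul x y))) = S.val (φ k x) * S.val (φ l y)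

/-- Equivalence of free systems: `SO(2)`-equivariant `*`-isomorphisms over `B`. -/
instance setoid (B : Type u) [CStarAlgebra B] : Setoid (FreeSystem B) where
  r S T := ∃ φ : S.A ≃⋆ₐ[ℂ] T.A,
    (∀ b, φ (S.ι b) = T.ι b) ∧ ∀ (g : SO2) (x : S.A), φ (S.α g x) = T.α g (φ x)
  iseqv :=
    { refl := fun S => ⟨StarAlgEquiv.refl ℂ _, fun _ => rfl, fun _ _ => rfl⟩
      symm := by
        rintro S T ⟨φ, h1, h2⟩
        refine ⟨φ.symm, fun b => ?_, fun g x => ?_⟩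
        · rw [← h1, StarAlgEquiv.symm_apply_apply]
        · apply EquivLike.injective φ
          rw [h2, StarAlgEquiv.apply_symm_apply, StarAlgEquiv.apply_symm_apply]
      trans := by
        rintro S T U ⟨φ, h1, h2⟩ ⟨ψ, h3, h4⟩
        exact ⟨φ.trans ψ, fun b => by simp [h1, h3], fun g x => by simp [h2, h4]⟩ }

end FreeSystem

/-- The set `Ext(B, SO(2))` of equivalence classes of free C*-dynamical systems with structure group
`SO(2)` and fixed point algebra `B`. -/
def FreeExt (B : Type u) [CStarAlgebra B] : Type (u + 1) := Quotient (FreeSystem.setoid B)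

/-- The class of a free C*-dynamical system. -/
def FreeSystem.toFreeExt (S : FreeSystem B) : FreeExt B := Quotient.mk _ S

end

/-! An action of SO(2) is a ℤ-grading up to completion. Averaging against χ^(-k) gives contractive
projections P_k of A onto A(k); the A(k) together span a dense subspace (`dense_iSup_isoSub`), and
P_0 is faithful on positive elements (`eq_zero_of_proj_zero_star_mul_self`). Taking the k-th Fourier
coefficient of g ↦ x α_g(y) and then P_0 gives P_{-k}(x) P_k(y), so freeness makes 1 a limit of sums
of products from A(-k)A(k) (`IsFree.one_mem_closure`). This is the fullness in part 1. It also makes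
A(k)A(l) dense in A(k+l), so that multiplication becomes an isomorphism A(k) ⊗ A(l) ≅ A(k+l)
(`mulIso`).

Surjectivity: on the two-sided Fock module of N, with summands N^{⊗n}, B and N̄^{⊗n}, the creation
operators satisfy t(x)*t(y) = ⟨x,y⟩ and t(x)t(y)* = _B⟨x,y⟩ (`HilbertBimodule.exists_covariantRep`).
Multiplying t by the character inside C(SO(2), C), with C the adjointable operators, puts N in
degree one for the translation action. The C*-algebra generated by π(B) and χ·t(N) is the desired
system (`CovariantRep.freeSystem`, `CovariantRep.oneIso`): the two relations cancel mixed products,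
and the P_k show that degrees 0 and 1 contain nothing beyond π(B) and χ·t(N). Freeness follows from
fullness in degrees 1 and -1 alone (`isFree_of_one_mem_closure`).

Injectivity is a graph argument: for u : A(1) ≅ A'(1), the C*-algebra generated in A × A' by the
pairs (b, b) and (x, u x) projects bijectively onto both factors (`equiv_of_iso`).

Factor systems need no coherence computation. Once a system with A(1) ≅ N is known, its
multiplication is transported to the N(k), and associativity is that of A (`factorSystem`).
Conversely, any factor system agrees with multiplication in the prescribed degrees, and
associativity propagates this to all degrees (`eq_factorSystem`). This gives uniqueness, and since
the system was arbitrary it also shows that every system over [N] has the factor system. In the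
other direction φ_1 alone suffices, because it automatically preserves the left inner product
(`HilbertBimodule.linner_eq_of_iso`). -/

noncomputable section

variable {B : Type u} [CStarAlgebra B]

/-! ### SO(2) as the circle: the character and the parametrisation by angles. -/

namespace SO2

/-- A rotation matrix is determined by its first column. Hence identities in SO(2) can be checked on
characters. -/
theorem character_injective : Function.Injective SO2.character := by
  intro g h hgh
  obtain ⟨h1, h2, -⟩ := Matrix.mem_specialOrthogonalGroup_fin_two_iff.1 g.2
  obtain ⟨h1', h2', -⟩ := Matrix.mem_specialOrthogonalGroup_fin_two_iff.1 h.2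
  have hr : g.1 0 0 = h.1 0 0 := congrArg Complex.re hgh
  have hi : g.1 1 0 = h.1 1 0 := congrArg Complex.im hgh
  apply Subtype.ext
  ext i j
  fin_cases i <;> fin_cases j <;> simp_all

theorem character_one : (1 : SO2).character = 1 := by
  apply Complex.ext <;> simp [SO2.character]

theorem character_mul (g h : SO2) : (g * h).character = g.character * h.character := by
  obtain ⟨h1, h2, -⟩ := Matrix.mem_specialOrthogonalGroup_fin_two_iff.1 g.2
  apply Complex.ext
  · simp [SO2.character, Matrix.mul_apply, Fin.sum_univ_two, h2]; ring
  · simp [SO2.character, Matrix.mul_apply, Fin.sum_univ_two, ← h1]; ring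

theorem continuous_character : Continuous SO2.character := by
  have h : SO2.character = fun g : SO2 => ((g.1 0 0 : ℝ) : ℂ) + (g.1 1 0 : ℝ) * Complex.I := by
    ext g; apply Complex.ext <;> simp [SO2.character]
  rw [h]
  have hc : ∀ i j, Continuous fun g : SO2 => g.1 i j :=
    fun i j => continuous_subtype_val.matrix_elem i j
  exact (Complex.continuous_ofReal.comp (hc 0 0)).add
    ((Complex.continuous_ofReal.comp (hc 1 0)).mul continuous_const)

theorem norm_character (g : SO2) : ‖g.character‖ = 1 := by
  have h := congrArg norm g.conj_character_mul
  rw [norm_mul, RCLike.norm_conj, norm_one] at h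
  nlinarith [norm_nonneg g.character]

theorem norm_character_zpow (g : SO2) (k : ℤ) : ‖g.character ^ k‖ = 1 := by
  rw [norm_zpow, g.norm_character, one_zpow]

/-- The rotation with a given value of the fundamental character. -/
def ofCircle (z : Circle) : SO2 :=
  ⟨!![(z : ℂ).re, -(z : ℂ).im; (z : ℂ).im, (z : ℂ).re], by
    rw [Matrix.of_mem_specialOrthogonalGroup_fin_two_iff]
    refine ⟨rfl, rfl, ?_⟩
    have := Circle.normSq_coe z
    rw [Complex.normSq_apply] at this
    nlinarith⟩

theorem character_ofCircle (z : Circle) : (ofCircle z).character = z := by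
  apply Complex.ext <;> simp [SO2.character, ofCircle]

theorem continuous_ofCircle : Continuous ofCircle := by
  refine Continuous.subtype_mk ?_ _
  refine continuous_matrix fun i j => ?_
  fin_cases i <;> fin_cases j <;> simp <;> fun_prop

theorem ofCircle_surjective : Function.Surjective ofCircle := fun g =>
  ⟨⟨g.character, mem_sphere_zero_iff_norm.2 g.norm_character⟩,
    character_injective (character_ofCircle _)⟩

/-- Compactness gives C(SO(2), E) the supremum norm, and makes it a C*-algebra when E is one. -/
instance : CompactSpace SO2 := ofCircle_surjective.compactSpace continuous_ofCircle

/-- The circle group of angles. -/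
abbrev Angle : Type := AddCircle (2 * Real.pi)

instance : Fact (0 < 2 * Real.pi) := ⟨Real.two_pi_pos⟩

/-- The rotation by a given angle. -/
def rot (t : Angle) : SO2 := ofCircle (AddCircle.toCircle t)

/-- The dictionary between degrees of the grading and Fourier monomials on the circle of angles. -/
theorem character_rot_zpow (t : Angle) (k : ℤ) : (rot t).character ^ k = fourier k t := by
  rw [rot, character_ofCircle, fourier_apply, AddCircle.toCircle_zsmul, Circle.coe_zpow]

theorem rot_add (s t : Angle) : rot (s + t) = rot s * rot t :=
  character_injective (by
    rw [character_mul]; simp only [rot, character_ofCircle, AddCircle.toCircle_add, Circle.coe_mul])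

theorem rot_zero : rot 0 = 1 :=
  character_injective (by rw [character_one, rot, character_ofCircle]; simp)

theorem continuous_rot : Continuous rot :=
  continuous_ofCircle.comp AddCircle.continuous_toCircle

theorem rot_surjective : Function.Surjective rot := fun g => by
  obtain ⟨z, rfl⟩ := ofCircle_surjective g
  obtain ⟨t, rfl⟩ := (AddCircle.homeomorphCircle Real.two_pi_pos.ne').surjective z
  exact ⟨t, by rw [rot, AddCircle.homeomorphCircle_apply]⟩

end SO2

/-- A `*`-homomorphism between C*-algebras as a continuous linear map. -/
def StarAlgHom.toCLM {C D : Type*} [CStarAlgebra C] [CStarAlgebra D] (p : C →⋆ₐ[ℂ] D) : C →L[ℂ] D :=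
  LinearMap.mkContinuous p.toAlgHom.toLinearMap 1 fun x => by
    rw [one_mul]; exact NonUnitalStarAlgHom.norm_apply_le p x

theorem StarAlgHom.toCLM_apply {C D : Type*} [CStarAlgebra C] [CStarAlgebra D] (p : C →⋆ₐ[ℂ] D)
    (x : C) : p.toCLM x = p x := rfl

/-! ### Isotypic components of circle actions and the Fourier projections onto them. -/

namespace CStarDynamicalSystem

open SO2 MeasureTheory AddCircle

section Isotypic

variable (X : CStarDynamicalSystem.{u} SO2)

/-- The isotypic component of degree `k`. -/
def isoSub (k : ℤ) : Submodule ℂ X.A where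
  carrier := {x | ∀ g, X.α g x = g.character ^ k • x}
  add_mem' := fun hx hy g => by rw [map_add, hx g, hy g, smul_add]
  zero_mem' := fun g => by rw [map_zero, smul_zero]
  smul_mem' := fun c x hx g => by rw [map_smul, hx g, smul_comm]

variable {X}

theorem mem_isoSub {k : ℤ} {x : X.A} :
    x ∈ X.isoSub k ↔ ∀ g, X.α g x = g.character ^ k • x := Iff.rfl

theorem mem_isoSub_zero {x : X.A} : x ∈ X.isoSub 0 ↔ ∀ g, X.α g x = x := by
  simp [mem_isoSub]

theorem mem_isoSub_of_rot {k : ℤ} {x : X.A}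
    (h : ∀ t : Angle, X.α (rot t) x = fourier k t • x) : x ∈ X.isoSub k := fun g => by
  obtain ⟨t, rfl⟩ := rot_surjective g
  rw [h, character_rot_zpow]

theorem α_rot {k : ℤ} {x : X.A} (hx : x ∈ X.isoSub k) (t : Angle) :
    X.α (rot t) x = fourier k t • x := by
  rw [hx, character_rot_zpow]

theorem mul_mem_isoSub {k l : ℤ} {x y : X.A} (hx : x ∈ X.isoSub k) (hy : y ∈ X.isoSub l) :
    x * y ∈ X.isoSub (k + l) := fun g => by
  rw [map_mul, hx g, hy g, smul_mul_smul_comm, zpow_add₀ g.character_ne_zero]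

theorem star_mem_isoSub {k : ℤ} {x : X.A} (hx : x ∈ X.isoSub k) :
    star x ∈ X.isoSub (-k) := fun g => by
  rw [map_star, hx g, star_smul, star_zpow₀, zpow_neg, ← inv_zpow]
  congr 2
  exact eq_inv_of_mul_eq_one_left g.conj_character_mul

theorem one_mem_isoSub : (1 : X.A) ∈ X.isoSub 0 := fun g => by simp

variable (X)

theorem norm_α (g : SO2) (x : X.A) : ‖X.α g x‖ = ‖x‖ :=
  NonUnitalStarAlgHom.norm_map (X.α g) (EquivLike.injective _) x

/-- The action of a group element as a continuous linear map. -/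
def αL (g : SO2) : X.A →L[ℂ] X.A :=
  LinearMap.mkContinuous
    { toFun := X.α g
      map_add' := map_add _
      map_smul' := map_smul _ } 1 fun x => by rw [one_mul]; exact (X.norm_α g x).le

theorem αL_apply (g : SO2) (x : X.A) : X.αL g x = X.α g x := rfl

theorem continuous_orbit (x : X.A) : Continuous fun t : Angle => X.α (rot t) x :=
  (X.continuous_apply x).comp continuous_rot

theorem integrable_of_continuous {E : Type*} [NormedAddCommGroup E] {f : Angle → E}
    (hf : Continuous f) : Integrable f haarAddCircle :=
  hf.integrable_of_hasCompactSupport (HasCompactSupport.of_compactSpace f)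

theorem integrable_orbit (x : X.A) (k : ℤ) :
    Integrable (fun t : Angle => fourier k t • X.α (rot t) x) haarAddCircle :=
  integrable_of_continuous ((fourier k).continuous.smul (X.continuous_orbit x))

/-- The projection onto the isotypic component of degree `k`. -/
def proj (k : ℤ) : X.A →L[ℂ] X.A :=
  LinearMap.mkContinuous
    { toFun := fun x => fourierCoeff (fun t : Angle => X.α (rot t) x) k
      map_add' := fun x y => by
        simp only [fourierCoeff, map_add, smul_add]
        exact integral_add (X.integrable_orbit x _) (X.integrable_orbit y _)
      map_smul' := fun c x => by
        simp only [fourierCoeff, map_smul, RingHom.id_apply, smul_comm _ c]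
        exact integral_smul c _ } 1 fun x => by
    -- Automorphisms are isometric and Haar measure has mass one, so averaging is contractive.
    refine (norm_integral_le_of_norm_le_const (C := ‖x‖) (ae_of_all _ fun t => ?_)).trans_eq ?_
    · rw [norm_smul, X.norm_α, fourier_apply, Circle.norm_coe, one_mul]
    · simp

theorem proj_apply (k : ℤ) (x : X.A) :
    X.proj k x = ∫ t : Angle, fourier (-k) t • X.α (rot t) x ∂haarAddCircle := rfl

/-- Acting by the rotation s translates the integration variable; by invariance of Haar measure only
the phase e^{iks} remains. -/
theorem proj_mem (k : ℤ) (x : X.A) : X.proj k x ∈ X.isoSub k := by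
  refine mem_isoSub_of_rot fun s => ?_
  rw [← X.αL_apply, proj_apply, ← ContinuousLinearMap.integral_comp_comm _ (X.integrable_orbit x _),
    ← integral_smul]
  have h : ∀ t : Angle, X.αL (rot s) (fourier (-k) t • X.α (rot t) x) =
      (fun r : Angle => fourier k s • fourier (-k) r • X.α (rot r) x) (s + t) := fun t => by
    simp only
    rw [map_smul, αL_apply, rot_add, map_mul, StarAlgEquiv.aut_mul, StarAlgEquiv.trans_apply,
      smul_smul]
    congr 1
    simp only [← character_rot_zpow, rot_add, character_mul, mul_zpow, ← mul_assoc, ← zpow_add₀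
      (character_ne_zero _), add_neg_cancel, zpow_zero, one_mul]
  simp only [h]
  exact integral_add_left_eq_self (μ := haarAddCircle)
    (fun r : Angle => fourier k s • fourier (-k) r • X.α (rot r) x) s

variable {X}

theorem integral_fourier (k : ℤ) :
    ∫ t : Angle, fourier k t ∂haarAddCircle = if k = 0 then 1 else 0 := by
  have h := congrFun (fourierCoeff_fourier (T := 2 * Real.pi) k) 0
  simp only [fourierCoeff, neg_zero, fourier_zero, one_smul] at h
  rw [h, Pi.single_apply]
  simp only [eq_comm]

theorem proj_of_mem {j : ℤ} {x : X.A} (hx : x ∈ X.isoSub j) (k : ℤ) :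
    X.proj k x = if j = k then x else 0 := by
  rw [proj_apply]
  simp only [α_rot hx, smul_smul, ← fourier_add]
  rw [integral_smul_const, integral_fourier, ite_smul, one_smul, zero_smul]
  congr 1
  rw [neg_add_eq_zero]
  exact propext eq_comm

theorem proj_self {k : ℤ} {x : X.A} (hx : x ∈ X.isoSub k) : X.proj k x = x := by
  rw [proj_of_mem hx, if_pos rfl]

/-- A homogeneous right factor leaves the integral as a phase, which shifts the degree of the
coefficient taken of x. -/
theorem proj_mul_of_mem {j : ℤ} {a : X.A} (ha : a ∈ X.isoSub j) (k : ℤ) (x : X.A) :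
    X.proj k (x * a) = X.proj (k - j) x * a := by
  rw [proj_apply, proj_apply]
  change _ = (ContinuousLinearMap.mul ℂ X.A).flip a _
  rw [← ContinuousLinearMap.integral_comp_comm _ (X.integrable_orbit x _)]
  congr 1
  ext t
  rw [map_smul, ContinuousLinearMap.flip_apply, ContinuousLinearMap.mul_apply', map_mul, α_rot ha,
    mul_smul_comm, smul_smul, ← fourier_add]
  congr 3
  ring

theorem map_proj {Y : CStarDynamicalSystem.{u} SO2} (p : X.A →L[ℂ] Y.A)
    (hp : ∀ g x, p (X.α g x) = Y.α g (p x)) (k : ℤ) (x : X.A) :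
    p (X.proj k x) = Y.proj k (p x) := by
  rw [proj_apply, proj_apply, ← ContinuousLinearMap.integral_comp_comm _ (X.integrable_orbit x _)]
  simp only [map_smul, hp]

/-- The zero coefficients are summable, so the Fourier series converges pointwise to f, and its sum
is 0. -/
theorem eval_zero_of_fourierCoeff_eq_zero (f : C(Angle, ℂ)) (hf : ∀ k, fourierCoeff f k = 0) :
    f 0 = 0 := by
  have h0 : fourierCoeff f = 0 := funext hf
  have h := has_pointwise_sum_fourier_series_of_summable (f := f) (by rw [h0]; exact summable_zero) 0
  simp only [h0, Pi.zero_apply, zero_smul] at h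
  exact h.unique hasSum_zero

variable (X) in
-- Hahn–Banach: if a functional f vanishes on the closed span V, the scalar function t ↦ f(α_t x)
-- has Fourier coefficients f(P_k x) = 0, hence its value f(x) at t = 0 vanishes.
theorem dense_iSup_isoSub : Dense ((⨆ k, X.isoSub k : Submodule ℂ X.A) : Set X.A) := by
  rw [Submodule.dense_iff_topologicalClosure_eq_top, eq_top_iff]
  intro x _
  set V := (⨆ k, X.isoSub k).topologicalClosure
  -- Closedness of V makes A/V a normed space, whose points are separated by functionals.
  have : IsClosed (V : Set X.A) := Submodule.isClosed_topologicalClosure _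
  rw [← Submodule.Quotient.mk_eq_zero V]
  refine SeparatingDual.eq_zero_of_forall_dual_eq_zero (R := ℂ) fun f => ?_
  let fq : X.A →L[ℂ] ℂ := f.comp V.mkQL
  let F : C(Angle, ℂ) := ⟨fun t => fq (X.α (rot t) x), fq.continuous.comp (X.continuous_orbit x)⟩
  have hF : F 0 = 0 := eval_zero_of_fourierCoeff_eq_zero F fun k => by
    have h1 : fourierCoeff F k = fq (X.proj k x) := by
      rw [proj_apply, ← ContinuousLinearMap.integral_comp_comm _ (X.integrable_orbit x _)]
      simp only [map_smul]
      rfl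
    have h2 : X.proj k x ∈ V :=
      Submodule.le_topologicalClosure _ (Submodule.mem_iSup_of_mem k (X.proj_mem k x))
    rw [h1]
    change f (Submodule.Quotient.mk _) = 0
    rw [(Submodule.Quotient.mk_eq_zero V).2 h2, map_zero]
  have h : F 0 = fq x := by simp [F, rot_zero]
  rw [h] at hF
  exact hF

variable (X) in
-- Faithfulness of the conditional expectation P_0. For y = x*x all α_t(y) are positive, and α_t(y)
-- ≥ y - ε for t in a neighbourhood U of 0. Integrating yields 0 ≥ μ(U)(y - ε) with μ(U) > 0, so ‖y‖
-- ≤ ε for every ε > 0.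
theorem eq_zero_of_proj_zero_star_mul_self (x : X.A) (h : X.proj 0 (star x * x) = 0) : x = 0 := by
  let _ := CStarAlgebra.spectralOrder X.A
  let _ := CStarAlgebra.spectralOrderedRing X.A
  rw [← CStarRing.star_mul_self_eq_zero_iff, ← norm_le_zero_iff]
  refine le_of_forall_pos_le_add fun ε hε => ?_
  rw [zero_add]
  set y := star x * x
  have hy : 0 ≤ y := star_mul_self_nonneg x
  have hpos : ∀ t : Angle, 0 ≤ X.α (rot t) y := fun t => by
    rw [map_mul, map_star]; exact star_mul_self_nonneg _
  let U : Set Angle := {t | ‖y - X.α (rot t) y‖ < ε}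
  have hU : IsOpen U := isOpen_lt (continuous_const.sub (X.continuous_orbit y)).norm continuous_const
  have hU0 : (0 : Angle) ∈ U := by simp [U, rot_zero, hε]
  have hμ : 0 < haarAddCircle.real U :=
    ENNReal.toReal_pos (hU.measure_pos _ ⟨0, hU0⟩).ne' (measure_ne_top _ _)
  have hle : ∀ t, U.indicator (fun _ => y - algebraMap ℝ X.A ε) t ≤ X.α (rot t) y := fun t => by
    by_cases ht : t ∈ U
    · rw [Set.indicator_of_mem ht, sub_le_comm]
      have hsa : IsSelfAdjoint (y - X.α (rot t) y) :=
        hy.isSelfAdjoint.sub (hpos t).isSelfAdjoint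
      exact hsa.le_algebraMap_norm_self.trans (algebraMap_mono X.A (le_of_lt ht))
    · rw [Set.indicator_of_notMem ht]
      exact hpos t
  have hint : haarAddCircle.real U • (y - algebraMap ℝ X.A ε) ≤ 0 := by
    rw [← integral_indicator_const _ hU.measurableSet, ← h, proj_apply]
    refine integral_mono ((integrable_const _).indicator hU.measurableSet) (X.integrable_orbit _ _)
      fun t => ?_
    simpa using hle t
  have hyε : y ≤ algebraMap ℝ X.A ε := by
    rw [← sub_nonpos]
    rw [← smul_zero (haarAddCircle.real U)] at hint
    exact (smul_le_smul_iff_of_pos_left hμ).1 hint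
  exact (CStarAlgebra.norm_le_iff_le_algebraMap y hε.le hy).2 hyε

/-- An equivariant `*`-homomorphism that is injective on the fixed points is injective. -/
theorem injective_of_injective_fixed {Y : CStarDynamicalSystem.{u} SO2} (p : X.A →⋆ₐ[ℂ] Y.A)
    (hp : ∀ g x, p (X.α g x) = Y.α g (p x)) (h0 : ∀ x ∈ X.isoSub 0, p x = 0 → x = 0) :
    Function.Injective p := by
  refine (injective_iff_map_eq_zero p).2 fun x hx => ?_
  -- If p(x) = 0, then p(P_0(x*x)) = P_0(p(x*x)) = 0. Injectivity on fixed points kills P_0(x*x),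
  -- and faithfulness of P_0 kills x.
  refine X.eq_zero_of_proj_zero_star_mul_self x (h0 _ (X.proj_mem 0 _) ?_)
  have h := map_proj p.toCLM hp 0 (star x * x)
  rwa [p.toCLM_apply, p.toCLM_apply, map_mul p, hx, mul_zero, map_zero] at h

end Isotypic

end CStarDynamicalSystem

/-! ### Freeness implies that 1 is approximated by products from A(-k)A(k). -/

namespace CStarDynamicalSystem

open SO2 MeasureTheory AddCircle

variable (X : CStarDynamicalSystem.{u} SO2)

/-- The Fourier coefficient of degree `k` of functions on `SO(2)`. -/
def coeff (E : Type*) [NormedAddCommGroup E] [NormedSpace ℂ E] (k : ℤ) :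
    C(SO2, E) →L[ℂ] E :=
  LinearMap.mkContinuous
    { toFun := fun f => fourierCoeff (fun t : Angle => f (rot t)) k
      map_add' := fun f h => by
        simp only [fourierCoeff, ContinuousMap.add_apply, smul_add]
        exact integral_add
          (integrable_of_continuous ((fourier _).continuous.smul (f.continuous.comp continuous_rot)))
          (integrable_of_continuous ((fourier _).continuous.smul (h.continuous.comp continuous_rot)))
      map_smul' := fun c f => by
        simp only [fourierCoeff, ContinuousMap.smul_apply, RingHom.id_apply, smul_comm _ c]
        exact integral_smul c _ } 1 fun f => by
    refine (norm_integral_le_of_norm_le_const (C := ‖f‖) (ae_of_all _ fun t => ?_)).trans_eq ?_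
    · rw [norm_smul, fourier_apply, Circle.norm_coe, one_mul]
      exact f.norm_coe_le_norm _
    · simp

theorem coeff_apply {E : Type*} [NormedAddCommGroup E] [NormedSpace ℂ E] (k : ℤ) (f : C(SO2, E)) :
    coeff E k f = ∫ t : Angle, fourier (-k) t • f (rot t) ∂haarAddCircle := rfl

theorem coeff_ellwood (k : ℤ) (x y : X.A) :
    coeff X.A k (X.ellwood (x ⊗ₜ y)) = x * X.proj k y := by
  rw [coeff_apply, proj_apply]
  change _ = ContinuousLinearMap.mul ℂ X.A x _
  rw [← ContinuousLinearMap.integral_comp_comm _ (X.integrable_orbit y _)]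
  congr 1
  ext t
  rw [map_smul]
  rfl

/-- The function `g ↦ χ(g) ^ k a`. -/
def charFun {E : Type*} [NormedAddCommGroup E] [NormedSpace ℂ E] (k : ℤ) (a : E) : C(SO2, E) :=
  ⟨fun g => g.character ^ k • a,
    (continuous_character.zpow₀ k fun g => Or.inl g.character_ne_zero).smul continuous_const⟩

theorem coeff_charFun {E : Type*} [NormedAddCommGroup E] [NormedSpace ℂ E] [CompleteSpace E]
    (k : ℤ) (a : E) : coeff E k (charFun k a) = a := by
  rw [coeff_apply]
  have h : ∀ t : Angle, fourier (-k) t • charFun k a (rot t) = a := fun t => by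
    change fourier (-k) t • (rot t).character ^ k • a = a
    rw [character_rot_zpow, smul_smul, ← fourier_add, neg_add_cancel, fourier_zero, one_smul]
  simp only [h]
  rw [integral_const]
  simp

variable {X}

/-- The continuous map "k-th Fourier coefficient, then P_0" sends the Ellwood image of x ⊗ y to
P_{-k}(x) P_k(y) and the function g ↦ χ(g)^k 1 to 1. That function is a limit of Ellwood images. -/
theorem IsFree.one_mem_closure (hX : X.IsFree) (k : ℤ) :
    (1 : X.A) ∈ closure (Submodule.span ℂ
      {z | ∃ x ∈ X.isoSub (-k), ∃ y ∈ X.isoSub k, z = x * y} : Set X.A) := by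
  set V := Submodule.span ℂ {z | ∃ x ∈ X.isoSub (-k), ∃ y ∈ X.isoSub k, z = x * y}
  let L : C(SO2, X.A) →L[ℂ] X.A := (X.proj 0).comp (coeff X.A k)
  have hL : ∀ t, L (X.ellwood t) ∈ V := fun t => by
    induction t using TensorProduct.induction_on with
    | zero => rw [map_zero, map_zero]; exact V.zero_mem
    | tmul x y =>
      change X.proj 0 (coeff X.A k _) ∈ V
      rw [coeff_ellwood, proj_mul_of_mem (X.proj_mem k y), zero_sub]
      exact Submodule.subset_span ⟨_, X.proj_mem _ _, _, X.proj_mem _ _, rfl⟩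
    | add s t hs ht => rw [map_add, map_add]; exact V.add_mem hs ht
  have h1 : L (charFun k 1) = 1 := by
    change X.proj 0 (coeff X.A k _) = 1
    rw [coeff_charFun, proj_self one_mem_isoSub]
  rw [← h1]
  refine closure_mono ?_ (image_closure_subset_closure_image L.continuous ⟨_, hX (charFun k 1), rfl⟩)
  rintro _ ⟨_, ⟨t, rfl⟩, rfl⟩
  exact hL t

end CStarDynamicalSystem

/-! ### Part 1 of the theorem: isotypic components are Morita equivalence bimodules. -/

namespace HilbertBimodule

variable (N : HilbertBimodule B)

theorem linner_smul_right (b : B) (x y : N.carrier) :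
    N.linner x (b • y) = N.linner x y * star b := by
  rw [← N.star_linner, N.linner_smul_left, star_mul, N.star_linner]

/-- The span of the right inner products is a right ideal and that of the left ones a left ideal.
Multiplying approximants of 1 by b therefore approximates b inside the same span. -/
theorem isMorita_of_one_mem
    (hr : (1 : B) ∈ closure (Submodule.span ℂ
      (Set.range fun p : N.carrier × N.carrier => N.rinner p.1 p.2) : Set B))
    (hl : (1 : B) ∈ closure (Submodule.span ℂ
      (Set.range fun p : N.carrier × N.carrier => N.linner p.1 p.2) : Set B)) :
    N.IsMorita := by
  constructor
  · intro b
    refine closure_mono ?_ (image_closure_subset_closure_image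
      (f := fun c : B => c * b) (by fun_prop) ⟨1, hr, one_mul b⟩)
    rintro _ ⟨c, hc, rfl⟩
    change c * b ∈ _
    refine Submodule.span_induction ?_ ?_ ?_ ?_ hc
    · rintro _ ⟨p, rfl⟩
      refine Submodule.subset_span ⟨(p.1, op b • p.2), N.rinner_op_smul_right _ _ _⟩
    · rw [zero_mul]; exact Submodule.zero_mem _
    · intro x y _ _ hx hy; rw [add_mul]; exact Submodule.add_mem _ hx hy
    · intro c x _ hx; rw [smul_mul_assoc]; exact Submodule.smul_mem _ c hx
  · intro b
    refine closure_mono ?_ (image_closure_subset_closure_image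
      (f := fun c : B => b * c) (by fun_prop) ⟨1, hl, mul_one b⟩)
    rintro _ ⟨c, hc, rfl⟩
    change b * c ∈ _
    refine Submodule.span_induction ?_ ?_ ?_ ?_ hc
    · rintro _ ⟨p, rfl⟩
      refine Submodule.subset_span ⟨(b • p.1, p.2), N.linner_smul_left _ _ _⟩
    · rw [mul_zero]; exact Submodule.zero_mem _
    · intro x y _ _ hx hy; rw [mul_add]; exact Submodule.add_mem _ hx hy
    · intro c x _ hx; rw [mul_smul_comm]; exact Submodule.smul_mem _ c hx

end HilbertBimodule

namespace FreeSystem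

variable (S : FreeSystem B)

theorem isometry_ι : Isometry S.ι := NonUnitalStarAlgHom.isometry S.ι S.ι_injective

/-- An injective *-homomorphism is isometric, so closures in B can be tested in A. -/
theorem one_mem_closure_of_ι {s : Set B} {t : Set S.A} (hst : t ⊆ S.ι '' s)
    (h : (1 : S.A) ∈ closure (Submodule.span ℂ t : Set S.A)) :
    (1 : B) ∈ closure (Submodule.span ℂ s : Set B) := by
  rw [S.isometry_ι.isUniformInducing.isInducing.closure_eq_preimage_closure_image, Set.mem_preimage,
    map_one]
  refine closure_mono ?_ h
  have : S.ι '' (Submodule.span ℂ s : Set B) =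
      (Submodule.map S.ι.toCLM.toLinearMap (Submodule.span ℂ s) : Set S.A) := rfl
  rw [this, Submodule.map_span]
  exact Submodule.span_mono hst

/-- Since A(-k) = A(k)*, products from A(-k)A(k) are right inner products on A(k), and those from
A(k)A(-k) are left ones. The density of freeness is used in degree k and in degree -k. -/
theorem isMorita (k : ℤ) : (S.isotypic k).IsMorita := by
  refine HilbertBimodule.isMorita_of_one_mem _ ?_ ?_
  · refine S.one_mem_closure_of_ι ?_ (S.isFree.one_mem_closure k)
    rintro _ ⟨x, hx, y, hy, rfl⟩
    have hx' : star x ∈ S.isoSub k := by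
      have := CStarDynamicalSystem.star_mem_isoSub hx
      rwa [neg_neg] at this
    -- `isoSub` and `isotypicSubmodule` unfold to the same membership condition, so `hx'` serves for
    -- both.
    refine ⟨_, ⟨((⟨star x, hx'⟩ : S.IsotypicCarrier k), (⟨y, hy⟩ : S.IsotypicCarrier k)), rfl⟩, ?_⟩
    refine (ι_toB_star_mul _ _).trans ?_
    change star (star x) * y = _
    rw [star_star]
  · have h := S.isFree.one_mem_closure (-k)
    rw [neg_neg] at h
    refine S.one_mem_closure_of_ι ?_ h
    rintro _ ⟨x, hx, y, hy, rfl⟩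
    have hy' : star y ∈ S.isoSub k := by
      have := CStarDynamicalSystem.star_mem_isoSub hy
      rwa [neg_neg] at this
    refine ⟨_, ⟨((⟨x, hx⟩ : S.IsotypicCarrier k), (⟨star y, hy'⟩ : S.IsotypicCarrier k)), rfl⟩, ?_⟩
    refine (ι_toB_mul_star _ _).trans ?_
    change x * star (star y) = _
    rw [star_star]

end FreeSystem

/-! ### Calculus of interior tensor products and their isomorphisms. -/

namespace Correspondence

variable {M N P : Correspondence B}

theorem norm_eq_sqrt (x : M.carrier) : ‖x‖ = √‖M.rinner x x‖ := by
  rw [← M.norm_sq_eq_rinner, Real.sqrt_sq (norm_nonneg x)]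

theorem eq_of_rinner_sub_self {x y : M.carrier} (h : M.rinner (x - y) (x - y) = 0) : x = y := by
  have h1 := M.norm_sq_eq_rinner (x - y)
  rw [h, norm_zero] at h1
  exact sub_eq_zero.1 (norm_eq_zero.1 (pow_eq_zero_iff two_ne_zero |>.1 h1))

theorem norm_smul_le_left (b : B) (x : M.carrier) : ‖b • x‖ ≤ ‖b‖ * ‖x‖ := by
  rw [norm_eq_sqrt, norm_eq_sqrt x]
  exact M.toPre.norm_smul_le_left b x

theorem norm_smul_le_right (b : Bᵐᵒᵖ) (x : M.carrier) : ‖b • x‖ ≤ ‖b‖ * ‖x‖ := by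
  rw [norm_eq_sqrt, norm_eq_sqrt x]
  exact M.toPre.norm_smul_le_right b x

theorem continuous_smul_left (b : B) : Continuous fun x : M.carrier => b • x := by
  refine AddMonoidHomClass.continuous_of_bound (DistribSMul.toAddMonoidHom M.carrier b) ‖b‖
    (norm_smul_le_left b)

theorem continuous_smul_right (b : Bᵐᵒᵖ) : Continuous fun x : M.carrier => b • x := by
  refine AddMonoidHomClass.continuous_of_bound (DistribSMul.toAddMonoidHom M.carrier b) ‖b‖
    (norm_smul_le_right b)

theorem norm_rinner_le (x y : M.carrier) : ‖M.rinner x y‖ ≤ ‖x‖ * ‖y‖ := by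
  rw [norm_eq_sqrt, norm_eq_sqrt]
  exact M.toPre.norm_rinner_le x y

/-- The inner product with a fixed vector on the left. -/
def rinnerL (x : M.carrier) : M.carrier →L[ℂ] B :=
  LinearMap.mkContinuous (M.toPre.sesq x) ‖x‖ fun y => norm_rinner_le x y

theorem continuous_rinner_right (x : M.carrier) : Continuous fun y => M.rinner x y :=
  (rinnerL x).continuous

theorem continuous_rinner_left (y : M.carrier) : Continuous fun x => M.rinner x y := by
  have h : (fun x => M.rinner x y) = fun x => star (M.rinner y x) := by
    ext x; rw [M.star_rinner]
  rw [h]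
  exact (continuous_rinner_right y).star

theorem add_tmul (x x' : M.carrier) (y : N.carrier) : tmul (x + x') y = tmul x y + tmul x' y := by
  refine Eq.trans ?_ (Completion.coe_add (α := (preTensor M N).carrier) _ _)
  exact congrArg (Completion.coe' (α := (preTensor M N).carrier)) (TensorProduct.add_tmul x x' y)

theorem tmul_add (x : M.carrier) (y y' : N.carrier) : tmul x (y + y') = tmul x y + tmul x y' := by
  refine Eq.trans ?_ (Completion.coe_add (α := (preTensor M N).carrier) _ _)
  exact congrArg (Completion.coe' (α := (preTensor M N).carrier)) (TensorProduct.tmul_add x y y')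

theorem smul_tmul (b : B) (x : M.carrier) (y : N.carrier) : b • tmul x y = tmul (b • x) y :=
  (Completion.coe_smul (X := (preTensor M N).carrier) b _).symm

theorem op_smul_tmul (b : Bᵐᵒᵖ) (x : M.carrier) (y : N.carrier) : b • tmul x y = tmul x (b • y) :=
  (Completion.coe_smul (X := (preTensor M N).carrier) b _).symm

theorem complex_smul_tmul (c : ℂ) (x : M.carrier) (y : N.carrier) :
    c • tmul x y = tmul (c • x) y :=
  (Completion.coe_smul (X := (preTensor M N).carrier) c _).symm

theorem tmul_smul (c : ℂ) (x : M.carrier) (y : N.carrier) : tmul x (c • y) = c • tmul x y := by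
  rw [complex_smul_tmul]
  exact congrArg (Completion.coe' (α := (preTensor M N).carrier))
    (TensorProduct.smul_tmul c x y).symm

/-- A closed additive property of elementary tensors holds for all vectors. -/
@[elab_as_elim]
theorem tensor_induction {p : (tensor M N).carrier → Prop} (u : (tensor M N).carrier)
    (hc : IsClosed {u | p u}) (h : ∀ x y, p (tmul x y)) (hadd : ∀ u v, p u → p v → p (u + v)) :
    p u := by
  refine Completion.induction_on (α := (preTensor M N).carrier) u hc fun t => ?_
  refine TensorCarrier.induction (M := M) (N := N)
    (p := fun t => p (Completion.coe' (α := (preTensor M N).carrier) t)) t h fun s t hs ht => ?_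
  have h1 := hadd _ _ hs ht
  have h2 := Completion.coe_add (α := (preTensor M N).carrier) s t
  exact h2 ▸ h1

theorem norm_tmul_le (x : M.carrier) (y : N.carrier) : ‖tmul x y‖ ≤ ‖x‖ * ‖y‖ := by
  refine (pow_le_pow_iff_left₀ (norm_nonneg _) (by positivity) two_ne_zero).1 ?_
  rw [norm_sq_eq_rinner, rinner_tmul]
  refine (norm_rinner_le _ _).trans ?_
  have h1 : ‖M.rinner x x • y‖ ≤ ‖M.rinner x x‖ * ‖y‖ := norm_smul_le_left _ _
  calc ‖y‖ * ‖M.rinner x x • y‖ ≤ ‖y‖ * (‖x‖ ^ 2 * ‖y‖) := by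
        rw [M.norm_sq_eq_rinner]; gcongr
    _ = _ := by ring

/-- The elementary tensors with a fixed vector on the left. -/
def tmulL (N : Correspondence B) (x : M.carrier) : N.carrier →L[ℂ] (tensor M N).carrier :=
  LinearMap.mkContinuous
    { toFun := fun y => tmul x y
      map_add' := tmul_add x
      map_smul' := fun c y => tmul_smul c x y } ‖x‖ fun y => norm_tmul_le x y

theorem continuous_tmul_right (x : M.carrier) : Continuous fun y : N.carrier => tmul x y :=
  (tmulL N x).continuous

theorem continuous_tmul_left (y : N.carrier) : Continuous fun x : M.carrier => tmul x y :=
  (LinearMap.mkContinuous (σ := RingHom.id ℂ)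
    { toFun := fun x : M.carrier => tmul x y
      map_add' := fun x x' => add_tmul x x' y
      map_smul' := fun c x => (complex_smul_tmul c x y).symm } ‖y‖ fun x =>
        (norm_tmul_le x y).trans_eq (mul_comm _ _)).continuous

/-- Extend a bounded linear map from the algebraic tensor product to `M ⊗_B N`. -/
def extendTensor {E : Type*} [NormedAddCommGroup E] [NormedSpace ℂ E] [CompleteSpace E]
    (g : (preTensor M N).carrier →L[ℂ] E) : (tensor M N).carrier →L[ℂ] E :=
  g.extend (Completion.toComplL (𝕜 := ℂ) (E := (preTensor M N).carrier))

theorem extendTensor_tmul {E : Type*} [NormedAddCommGroup E] [NormedSpace ℂ E] [CompleteSpace E]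
    (g : (preTensor M N).carrier →L[ℂ] E) (x : M.carrier) (y : N.carrier) :
    extendTensor g (tmul x y) = g (TensorCarrier.tmul x y) :=
  ContinuousLinearMap.extend_eq g Completion.denseRange_coe
    (Completion.isUniformInducing_coe _) _

theorem Iso.norm_map (φ : Iso M N) (x : M.carrier) : ‖φ x‖ = ‖x‖ := by
  rw [norm_eq_sqrt, norm_eq_sqrt, φ.map_rinner]

theorem Iso.continuous (φ : Iso M N) : Continuous φ :=
  AddMonoidHomClass.continuous_of_bound φ.toEquiv 1 fun x => by
    rw [one_mul]; exact (φ.norm_map x).le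

/-- The inverse isomorphism. -/
def Iso.symm (φ : Iso M N) : Iso N M where
  toEquiv := φ.toEquiv.symm
  map_smul_left b x := by
    rw [LinearEquiv.symm_apply_eq, φ.map_smul_left, LinearEquiv.apply_symm_apply]
  map_smul_right b x := by
    rw [LinearEquiv.symm_apply_eq, φ.map_smul_right, LinearEquiv.apply_symm_apply]
  map_rinner x y := by
    rw [← φ.map_rinner, LinearEquiv.apply_symm_apply, LinearEquiv.apply_symm_apply]

theorem Iso.apply_symm_apply (φ : Iso M N) (x : N.carrier) : φ (φ.symm x) = x :=
  φ.toEquiv.apply_symm_apply x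

theorem Iso.injective (φ : Iso M N) : Function.Injective φ := φ.toEquiv.injective

theorem Iso.surjective (φ : Iso M N) : Function.Surjective φ := φ.toEquiv.surjective

/-- Composition of isomorphisms. -/
def Iso.trans (φ : Iso M N) (ψ : Iso N P) : Iso M P where
  toEquiv := φ.toEquiv.trans ψ.toEquiv
  map_smul_left b x := by simp only [LinearEquiv.trans_apply, φ.map_smul_left, ψ.map_smul_left]
  map_smul_right b x := by simp only [LinearEquiv.trans_apply, φ.map_smul_right, ψ.map_smul_right]
  map_rinner x y := by simp only [LinearEquiv.trans_apply, φ.map_rinner, ψ.map_rinner]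

theorem Iso.trans_apply (φ : Iso M N) (ψ : Iso N P) (x : M.carrier) : φ.trans ψ x = ψ (φ x) := rfl

theorem Iso.ext_apply {φ ψ : Iso M N} (h : ∀ x, φ x = ψ x) : φ = ψ :=
  Iso.ext (LinearEquiv.ext h)

/-- Isomorphisms are continuous, and sums of elementary tensors are dense. -/
theorem Iso.ext_tmul {φ ψ : Iso (tensor M N) P} (h : ∀ x y, φ (tmul x y) = ψ (tmul x y)) :
    φ = ψ := by
  refine Iso.ext_apply fun u => ?_
  induction u using tensor_induction with
  | hc => exact isClosed_eq φ.continuous ψ.continuous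
  | h x y => exact h x y
  | hadd u v hu hv => rw [map_add, map_add, hu, hv]

/-- A bimodule map with dense range that preserves the inner products is an isomorphism. -/
def isoOfDense (L : M.carrier →ₗ[ℂ] N.carrier) (hl : ∀ (b : B) x, L (b • x) = b • L x)
    (hr : ∀ (b : Bᵐᵒᵖ) x, L (b • x) = b • L x)
    (hin : ∀ x y, N.rinner (L x) (L y) = M.rinner x y) (hd : DenseRange L) : Iso M N where
  toEquiv := LinearEquiv.ofBijective L (by
    -- The range of an isometry on a complete space is closed; being dense as well, it is
    -- everything.
    have hiso : Isometry L := AddMonoidHomClass.isometry_of_norm L fun x => by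
      rw [norm_eq_sqrt, norm_eq_sqrt, hin]
    refine ⟨hiso.injective, ?_⟩
    rw [← Set.range_eq_univ]
    rw [← hd.closure_range]
    exact hiso.isClosedEmbedding.isClosed_range.closure_eq.symm)
  map_smul_left := hl
  map_smul_right := hr
  map_rinner := hin

/-- The isomorphism defined on `M ⊗_B N` by a bilinear map that preserves the inner products. -/
def tensorIso (f : M.carrier →ₗ[ℂ] N.carrier →ₗ[ℂ] P.carrier)
    (hl : ∀ (b : B) x y, f (b • x) y = b • f x y) (hr : ∀ (b : Bᵐᵒᵖ) x y, f x (b • y) = b • f x y)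
    (hin : ∀ x x' y y', P.rinner (f x y) (f x' y') = N.rinner y (M.rinner x x' • y'))
    (hd : Dense (Submodule.span ℂ (Set.range fun p : M.carrier × N.carrier => f p.1 p.2) :
      Set P.carrier)) : Iso (tensor M N) P := by
  let g : TensorCarrier M N →ₗ[ℂ] P.carrier := TensorProduct.lift f
  have hg : ∀ x y, g (TensorCarrier.tmul x y) = f x y := fun x y => rfl
  -- Preserving inner products makes g isometric for the seminorm. It is thus bounded by 1 and
  -- extends to the completion; in particular no separate check of B-balancedness is needed.
  have hgin : ∀ s t, P.rinner (g s) (g t) = TensorCarrier.sesq M N s t := fun s t => by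
    induction s using TensorCarrier.induction with
    | h x y =>
      induction t using TensorCarrier.induction with
      | h x' y' => rw [hg, hg, hin, TensorCarrier.sesq_tmul]
      | hadd t t' h h' => rw [map_add, map_add, P.rinner_add_right, h, h']
    | hadd s s' h h' => rw [map_add, map_add, P.rinner_add_left, h, h', LinearMap.add_apply]
  let g' : (preTensor M N).carrier →ₗ[ℂ] P.carrier := g
  let L := extendTensor (LinearMap.mkContinuous g' 1 fun t => by
    rw [norm_eq_sqrt, one_mul, (preTensor M N).norm_def]
    exact (congrArg (fun b => √‖b‖) (hgin t t)).le)
  have hL : ∀ x y, L (tmul x y) = f x y := fun x y => extendTensor_tmul _ x y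
  refine isoOfDense L.toLinearMap (fun b u => ?_) (fun b u => ?_) (fun u v => ?_) ?_
  · change L (b • u) = b • L u
    induction u using tensor_induction with
    | hc => exact isClosed_eq (L.continuous.comp (continuous_smul_left b))
              ((continuous_smul_left b).comp L.continuous)
    | h x y => rw [smul_tmul, hL, hL, hl]
    | hadd u v hu hv => rw [smul_add, map_add, map_add, smul_add, hu, hv]
  · change L (b • u) = b • L u
    induction u using tensor_induction with
    | hc => exact isClosed_eq (L.continuous.comp (continuous_smul_right b))
              ((continuous_smul_right b).comp L.continuous)
    | h x y => rw [op_smul_tmul, hL, hL, hr]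
    | hadd u v hu hv => rw [smul_add, map_add, map_add, smul_add, hu, hv]
  · change P.rinner (L u) (L v) = _
    induction u using tensor_induction with
    | hc => exact isClosed_eq ((continuous_rinner_left (L v)).comp L.continuous)
              (continuous_rinner_left v)
    | h x y =>
      induction v using tensor_induction with
      | hc => exact isClosed_eq ((continuous_rinner_right _).comp L.continuous)
                (continuous_rinner_right _)
      | h x' y' => rw [hL, hL, hin, rinner_tmul]
      | hadd u v hu hv => rw [map_add, rinner_add_right, rinner_add_right, hu, hv]
    | hadd u v hu hv => rw [map_add, rinner_add_left, rinner_add_left, hu, hv]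
  · have h : Submodule.span ℂ (Set.range fun p : M.carrier × N.carrier => f p.1 p.2) ≤
        LinearMap.range L.toLinearMap := by
      rw [Submodule.span_le]
      rintro _ ⟨p, rfl⟩
      exact ⟨tmul p.1 p.2, hL _ _⟩
    exact hd.mono h

theorem tensorIso_tmul (f : M.carrier →ₗ[ℂ] N.carrier →ₗ[ℂ] P.carrier) (hl) (hr) (hin) (hd)
    (x : M.carrier) (y : N.carrier) : tensorIso f hl hr hin hd (tmul x y) = f x y :=
  extendTensor_tmul _ x y

end Correspondence

/-! ### Multiplication as an isomorphism A(k) ⊗ A(l) ≅ A(k+l). -/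

namespace FreeSystem

open CStarDynamicalSystem

variable (S : FreeSystem B)

/-- Write z = z·1 and approximate 1 by sums of x y with x in A(-l) and y in A(l). Then z(xy) =
(zx)y, and zx has degree m - l = k. -/
theorem mem_closure_span_mul {k l m : ℤ} (h : k + l = m) {z : S.A} (hz : z ∈ S.isoSub m) :
    z ∈ closure (Submodule.span ℂ
      {w | ∃ x ∈ S.isoSub k, ∃ y ∈ S.isoSub l, w = x * y} : Set S.A) := by
  refine closure_mono ?_ (image_closure_subset_closure_image
      (f := fun c : S.A => z * c) (by fun_prop) ⟨1, S.isFree.one_mem_closure l, mul_one z⟩)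
  rintro _ ⟨c, hc, rfl⟩
  change z * c ∈ _
  refine Submodule.span_induction ?_ ?_ ?_ ?_ hc
  · rintro _ ⟨x, hx, y, hy, rfl⟩
    refine Submodule.subset_span ⟨z * x, ?_, y, hy, (mul_assoc _ _ _).symm⟩
    have := mul_mem_isoSub hz hx
    rwa [← h, add_neg_cancel_right] at this
  · rw [mul_zero]; exact Submodule.zero_mem _
  · intro x y _ _ hx hy; rw [mul_add]; exact Submodule.add_mem _ hx hy
  · intro c x _ hx; rw [mul_smul_comm]; exact Submodule.smul_mem _ c hx

variable {S}

/-- An element of `A` of degree `k` as an element of `A(k)`. -/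
def isoMk {k : ℤ} (x : S.A) (hx : x ∈ S.isoSub k) : (S.isotypic k).carrier :=
  (⟨x, hx⟩ : S.isotypicSubmodule k)

variable (S) in
/-- The inclusion of `A(k)` into `A` as a linear map. -/
def valL (k : ℤ) : (S.isotypic k).carrier →L[ℂ] S.A := (S.isotypicSubmodule k).subtypeL

variable {k l m : ℤ}

theorem valL_isoMk (x : S.A) (hx : x ∈ S.isoSub k) : S.valL k (isoMk x hx) = x := rfl

theorem valL_mem (x : (S.isotypic k).carrier) : S.valL k x ∈ S.isoSub k := x.2

theorem valL_injective : Function.Injective (S.valL k) := Subtype.val_injective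

theorem valL_smul (b : B) (x : (S.isotypic k).carrier) :
    S.valL k (b • x) = S.ι b * S.valL k x := rfl

theorem valL_op_smul (b : Bᵐᵒᵖ) (x : (S.isotypic k).carrier) :
    S.valL k (b • x) = S.valL k x * S.ι (unop b) := rfl

theorem ι_rinner (x y : (S.isotypic k).carrier) :
    S.ι ((S.isotypic k).rinner x y) = star (S.valL k x) * S.valL k y :=
  ι_toB_star_mul (S := S) (k := k) x y

theorem ι_linner (x y : (S.isotypic k).carrier) :
    S.ι ((S.isotypic k).linner x y) = S.valL k x * star (S.valL k y) :=
  ι_toB_mul_star (S := S) (k := k) x y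

/-- The multiplication of `A` on isotypic components. -/
def mulL (h : k + l = m) :
    (S.isotypic k).carrier →ₗ[ℂ] (S.isotypic l).carrier →ₗ[ℂ] (S.isotypic m).carrier :=
  LinearMap.mk₂ ℂ (fun x y => isoMk (S.valL k x * S.valL l y)
      (h ▸ mul_mem_isoSub (valL_mem x) (valL_mem y)))
    (fun x x' y => valL_injective (by simp only [valL_isoMk, map_add, add_mul]))
    (fun c x y => valL_injective (by simp only [valL_isoMk, map_smul, smul_mul_assoc]))
    (fun x y y' => valL_injective (by simp only [valL_isoMk, map_add, mul_add]))
    (fun c x y => valL_injective (by simp only [valL_isoMk, map_smul, mul_smul_comm]))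

theorem valL_mulL (h : k + l = m) (x : (S.isotypic k).carrier) (y : (S.isotypic l).carrier) :
    S.valL m (mulL h x y) = S.valL k x * S.valL l y := rfl

variable {M N : Correspondence B}

/-- Multiplication in `A` as an isomorphism `M ⊗_B N ≅ A(k + l)` for `M ≅ A(k)` and `N ≅ A(l)`. -/
def mulIso (h : k + l = m) (φ : Correspondence.Iso M (S.isotypic k).toCorrespondence)
    (ψ : Correspondence.Iso N (S.isotypic l).toCorrespondence) :
    Correspondence.Iso (M.tensor N) (S.isotypic m).toCorrespondence :=
  Correspondence.tensorIso (P := (S.isotypic m).toCorrespondence)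
    ((mulL (S := S) h).compl₁₂ φ.toEquiv.toLinearMap ψ.toEquiv.toLinearMap)
    (fun b x y => by
      change mulL h (φ (b • x)) (ψ y) = b • mulL h (φ x) (ψ y)
      refine valL_injective ?_
      rw [φ.map_smul_left, valL_smul, valL_mulL, valL_mulL, valL_smul, ← mul_assoc])
    (fun b x y => by
      change mulL h (φ x) (ψ (b • y)) = b • mulL h (φ x) (ψ y)
      refine valL_injective ?_
      rw [ψ.map_smul_right, valL_op_smul, valL_mulL, valL_mulL, valL_op_smul, mul_assoc])
    (fun x x' y y' => S.ι_injective (by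
      -- In A this is (xy)*(x'y') = y*((x*x')y'), the defining formula of the tensor inner product.
      change S.ι ((S.isotypic m).rinner (mulL h (φ x) (ψ y)) (mulL h (φ x') (ψ y'))) = _
      rw [← ψ.map_rinner, ψ.map_smul_left, ← φ.map_rinner, ι_rinner, ι_rinner, valL_smul,
        ι_rinner, valL_mulL, valL_mulL, star_mul]
      simp only [mul_assoc]))
    (by
      intro z
      -- A(m) carries the topology induced from A, so the density of A(k)A(l) may be tested there.
      have hind : Topology.IsInducing (S.valL m) := Topology.IsInducing.subtypeVal
      rw [hind.closure_eq_preimage_closure_image]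
      refine closure_mono ?_ (S.mem_closure_span_mul h (valL_mem z))
      rw [show ∀ s : Submodule ℂ (S.isotypic m).carrier, S.valL m '' (s : Set (S.isotypic m).carrier) =
        (s.map (S.valL m).toLinearMap : Set S.A) from fun s => rfl, Submodule.map_span]
      refine Submodule.span_mono ?_
      rintro _ ⟨x, hx, y, hy, rfl⟩
      obtain ⟨x', hx'⟩ := φ.surjective (isoMk x hx)
      obtain ⟨y', hy'⟩ := ψ.surjective (isoMk y hy)
      refine ⟨_, ⟨(x', y'), rfl⟩, ?_⟩
      change S.valL m (mulL h (φ x') (ψ y')) = _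
      rw [valL_mulL, hx', hy', valL_isoMk, valL_isoMk])

theorem valL_mulIso_tmul (h : k + l = m)
    (φ : Correspondence.Iso M (S.isotypic k).toCorrespondence)
    (ψ : Correspondence.Iso N (S.isotypic l).toCorrespondence) (x : M.carrier) (y : N.carrier) :
    S.valL m (mulIso h φ ψ (Correspondence.tmul x y)) = S.valL k (φ x) * S.valL l (ψ y) :=
  congrArg (S.valL m) (Correspondence.tensorIso_tmul _ _ _ _ _ x y)

variable (S) in
/-- The identification of `B` with `A(0)`. -/
def zeroIso : Correspondence.Iso (Correspondence.self B) (S.isotypic 0).toCorrespondence where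
  toEquiv := LinearEquiv.ofBijective
    { toFun := fun b : B => isoMk (k := 0) (S.ι b) (mem_isoSub_zero.2 fun g => S.α_ι g b)
      map_add' := fun a b => valL_injective (map_add S.ι a b)
      map_smul' := fun c b => valL_injective (by
        change S.ι (c • (show B from b)) = c • S.ι b
        exact map_smul S.ι c (show B from b)) }
    ⟨fun a b hab => S.ι_injective (congrArg (S.valL 0) hab), fun x => by
      refine ⟨S.toB (S.valL 0 x), valL_injective ?_⟩
      exact S.ι_toB (mem_isoSub_zero.1 (valL_mem x))⟩
  map_smul_left a b := valL_injective (map_mul S.ι a (show B from b))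
  map_smul_right a b := valL_injective (map_mul S.ι (show B from b) (unop a))
  map_rinner a b := S.ι_injective ((ι_rinner _ _).trans (by
    change star (S.ι (show B from a)) * S.ι (show B from b) =
      S.ι (star (show B from a) * (show B from b))
    rw [map_mul, map_star]))

end FreeSystem

/-- By _B⟨x,y⟩z = x⟨y,z⟩_B the left inner product is determined, as an operator on N, by the
bimodule structure and the right one. The difference d of the two candidates thus acts as zero on N,
so d·_B⟨p,q⟩ = _B⟨dp,q⟩ = 0; fullness on the left gives dB = 0 and d = d·1 = 0. -/
theorem HilbertBimodule.linner_eq_of_iso {M N : HilbertBimodule B} (hN : N.IsMorita)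
    (φ : Correspondence.Iso M.toCorrespondence N.toCorrespondence) (x y : M.carrier) :
    N.linner (φ x) (φ y) = M.linner x y := by
  set d := N.linner (φ x) (φ y) - M.linner x y with hd
  have h1 : ∀ z : N.carrier, d • z = 0 := fun z => by
    obtain ⟨w, rfl⟩ := φ.surjective z
    rw [hd, sub_smul, N.linner_smul, φ.map_rinner, ← φ.map_smul_left, M.linner_smul,
      φ.map_smul_right, sub_self]
  have h2 : ∀ b : B, d * b = 0 := fun b => by
    refine closure_minimal ?_ (isClosed_eq (f := fun b : B => d * b) (by fun_prop) continuous_const)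
      (hN.dense_linner b)
    intro c hc
    change d * c = 0
    refine Submodule.span_induction ?_ ?_ ?_ ?_ hc
    · rintro _ ⟨p, rfl⟩
      have h0 : N.linner (0 : N.carrier) p.2 = 0 := by
        have := N.linner_add_left 0 0 p.2
        rw [add_zero] at this
        exact left_eq_add.1 this
      change d * N.linner p.1 p.2 = 0
      rw [← N.linner_smul_left, h1, h0]
    · rw [mul_zero]
    · intro x y _ _ hx hy; rw [mul_add, hx, hy, add_zero]
    · intro c x _ hx; rw [mul_smul_comm, hx, smul_zero]
  have := h2 1
  rwa [mul_one, hd, sub_eq_zero] at this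

/-! ### The isomorphisms N(k) ≅ A(k) and the factor system of a free system. -/

namespace FreeSystem

open CStarDynamicalSystem

variable {S : FreeSystem B} {N : HilbertBimodule B}

/-- The conjugate-linear isomorphism `N ≅ A(-1)` given by `N ≅ A(1)`. -/
def dualMap (φ : HilbertBimodule.Iso N (S.isotypic 1)) :
    N.dual.carrier →ₗ[ℂ] (S.isotypic (Int.negSucc 0)).carrier where
  -- The degree -1 is written as `Int.negSucc 0`, the constructor form on which `zpow` is defined.
  toFun x := isoMk (k := Int.negSucc 0) (star (S.valL 1 (φ.toIso (N.ofDual x))))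
    (show _ ∈ S.isoSub (-1) from star_mem_isoSub (valL_mem _))
  map_add' x y := valL_injective (by
    rw [map_add]
    change star (S.valL 1 (φ.toIso (N.ofDual x + N.ofDual y))) = star (S.valL 1 _) + star (S.valL 1 _)
    rw [map_add, map_add, star_add])
  map_smul' c x := valL_injective (by
    rw [map_smul]
    change star (S.valL 1 (φ.toIso (conj c • N.ofDual x))) = c • star (S.valL 1 _)
    rw [map_smul, map_smul, star_smul, show star (conj c) = c from star_star c])

theorem valL_dualMap (φ : HilbertBimodule.Iso N (S.isotypic 1)) (x : N.dual.carrier) :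
    S.valL (Int.negSucc 0) (dualMap φ x) = star (S.valL 1 (φ.toIso (N.ofDual x))) := rfl

/-- The isomorphism of the dual of `N` with `A(-1)` given by `N ≅ A(1)`. -/
def dualIso (φ : HilbertBimodule.Iso N (S.isotypic 1)) :
    Correspondence.Iso N.dual.toCorrespondence (S.isotypic (Int.negSucc 0)).toCorrespondence where
  toEquiv := LinearEquiv.ofBijective (dualMap φ) (by
    constructor
    · intro x y hxy
      have h := congrArg (S.valL (Int.negSucc 0)) hxy
      rw [valL_dualMap, valL_dualMap] at h
      exact φ.toIso.injective (valL_injective (star_injective h))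
    · intro x
      have hx : star (S.valL (Int.negSucc 0) x) ∈ S.isoSub 1 :=
        star_mem_isoSub (k := -1) (valL_mem x)
      obtain ⟨y, hy⟩ := φ.toIso.surjective (isoMk _ hx)
      refine ⟨N.toDual y, valL_injective ?_⟩
      change star (S.valL 1 (φ.toIso y)) = _
      rw [hy, valL_isoMk, star_star])
  map_smul_left b x := valL_injective (by
    rw [valL_smul]
    change star (S.valL 1 (φ.toIso (op (star b) • N.ofDual x))) =
      S.ι b * star (S.valL 1 (φ.toIso (N.ofDual x)))
    rw [φ.map_smul_right, valL_op_smul, star_mul, unop_op, map_star, star_star])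
  map_smul_right b x := valL_injective (by
    rw [valL_op_smul]
    change star (S.valL 1 (φ.toIso (star (unop b) • N.ofDual x))) =
      star (S.valL 1 (φ.toIso (N.ofDual x))) * S.ι (unop b)
    rw [φ.map_smul_left, valL_smul, star_mul, map_star, star_star])
  map_rinner x y := S.ι_injective (by
    refine (ι_rinner _ _).trans ?_
    change star (star (S.valL 1 (φ.toIso (N.ofDual x)))) * star (S.valL 1 (φ.toIso (N.ofDual y))) =
      S.ι (N.linner (N.ofDual x) (N.ofDual y))
    -- The right inner product of the dual is the left one of N; this is where φ has to preserve
    -- left inner products.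
    rw [star_star, ← φ.map_linner, ι_linner])

/-- Isomorphisms of the tensor powers of `N` with isotypic components. -/
def powIso (d : ℕ → ℤ) (h : ∀ n, d (n + 1) + d 1 = d (n + 2)) {M : Correspondence B}
    (φ₀ : Correspondence.Iso (Correspondence.self B) (S.isotypic (d 0)).toCorrespondence)
    (φ : Correspondence.Iso M (S.isotypic (d 1)).toCorrespondence) :
    ∀ n, Correspondence.Iso (M.pow n) (S.isotypic (d n)).toCorrespondence
  | 0 => φ₀
  | 1 => φ
  -- The same recursion as `pow`, so every tensor power goes to a product in A. The degree function
  -- d treats n ↦ n and n ↦ -n at once.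
  | n + 2 => mulIso (h n) (powIso d h φ₀ φ (n + 1)) φ

/-- The isomorphisms `N(k) ≅ A(k)` given by `N ≅ A(1)`. -/
def zpowIso (φ : HilbertBimodule.Iso N (S.isotypic 1)) :
    ∀ k, Correspondence.Iso (N.zpow k) (S.isotypic k).toCorrespondence
  | Int.ofNat n => powIso Int.ofNat (fun _ => rfl) S.zeroIso φ.toIso n
  | Int.negSucc n => powIso Int.negOfNat (fun _ => rfl) S.zeroIso (dualIso φ) (n + 1)

variable (φ : HilbertBimodule.Iso N (S.isotypic 1))

/-- The factor system given by the multiplication of a free system. -/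
def factorSystem : N.FactorSystem where
  -- Multiplication of A pulled back along N(k) ≅ A(k). Every axiom is checked after applying φ_m
  -- and including into A, where associativity is that of the product.
  Ψ {k l m} h := (mulIso h (zpowIso φ k) (zpowIso φ l)).trans (zpowIso φ m).symm
  assoc {k₁ k₂ k₃ k₁₂ k₂₃ m} h₁₂ h₂₃ h h' x y z := by
    refine (zpowIso φ m).injective (valL_injective ?_)
    simp only [Correspondence.Iso.trans_apply, Correspondence.Iso.apply_symm_apply,
      valL_mulIso_tmul, mul_assoc]
  zero_left k b x := by
    refine (zpowIso φ k).injective (valL_injective ?_)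
    refine (congrArg (S.valL k) ((zpowIso φ k).apply_symm_apply _)).trans ?_
    refine (valL_mulIso_tmul _ _ _ _ _).trans ?_
    rw [Correspondence.Iso.map_smul_left, valL_smul]
    rfl
  zero_right k x b := by
    refine (zpowIso φ k).injective (valL_injective ?_)
    refine (congrArg (S.valL k) ((zpowIso φ k).apply_symm_apply _)).trans ?_
    refine (valL_mulIso_tmul _ _ _ _ _).trans ?_
    rw [Correspondence.Iso.map_smul_right, valL_op_smul]
    rfl
  -- The isomorphism in degree n + 2 is itself defined as multiplication out of degrees n + 1 and 1,
  -- so the composite with its inverse is the identity. The same holds in negative degrees.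
  pos n u := (zpowIso φ (Int.ofNat (n + 2))).injective
    ((zpowIso φ (Int.ofNat (n + 2))).apply_symm_apply _)
  neg n u := (zpowIso φ (Int.negSucc (n + 1))).injective
    ((zpowIso φ (Int.negSucc (n + 1))).apply_symm_apply _)
  one_neg_one x y := (zpowIso φ 0).injective (valL_injective (by
    refine (congrArg (S.valL 0) ((zpowIso φ 0).apply_symm_apply _)).trans ?_
    refine (valL_mulIso_tmul _ _ _ _ _).trans ?_
    change S.valL 1 (φ.toIso x) * star (S.valL 1 (φ.toIso y)) = S.ι (N.linner x y)
    rw [← φ.map_linner, ι_linner]))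
  neg_one_one x y := (zpowIso φ 0).injective (valL_injective (by
    refine (congrArg (S.valL 0) ((zpowIso φ 0).apply_symm_apply _)).trans ?_
    refine (valL_mulIso_tmul _ _ _ _ _).trans ?_
    change star (S.valL 1 (φ.toIso x)) * S.valL 1 (φ.toIso y) = S.ι (N.rinner x y)
    rw [← φ.map_rinner, ι_rinner]))

theorem valL_zpowIso_factorSystem {k l m : ℤ} (h : k + l = m) (x : (N.zpow k).carrier)
    (y : (N.zpow l).carrier) :
    S.valL m (zpowIso φ m ((factorSystem φ).Ψ h (Correspondence.tmul x y))) =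
      S.valL k (zpowIso φ k x) * S.valL l (zpowIso φ l y) :=
  (congrArg (S.valL m) ((zpowIso φ m).apply_symm_apply _)).trans (valL_mulIso_tmul _ _ _ _ _)

theorem hasFactorSystem : S.HasFactorSystem (factorSystem φ) :=
  ⟨zpowIso φ, fun _ => rfl, fun h x y => valL_zpowIso_factorSystem φ h x y⟩

end FreeSystem

/-! ### Uniqueness of the factor system. -/

namespace FreeSystem

open CStarDynamicalSystem Correspondence

variable {S : FreeSystem B} {N : HilbertBimodule B} (φ : HilbertBimodule.Iso N (S.isotypic 1))
  (F : N.FactorSystem)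

/-- The maps `Ψ_{k,l}` of a factor system are given by the multiplication of a free system. -/
def IsMulAt (k l : ℤ) : Prop :=
  ∀ (m : ℤ) (h : k + l = m) (x : (N.zpow k).carrier) (y : (N.zpow l).carrier),
    S.valL m (zpowIso φ m (F.Ψ h (tmul x y))) = S.valL k (zpowIso φ k x) * S.valL l (zpowIso φ l y)

variable {φ F}

theorem continuous_valL_zpowIso (k : ℤ) : Continuous fun x => S.valL k (zpowIso φ k x) :=
  (S.valL k).continuous.comp (zpowIso φ k).continuous

/-- Since Ψ_{k₂,k₃} is onto, an element of N(k₂+k₃) may be taken of the form Ψ(u), and by additivity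
and continuity u = y ⊗ z. Associativity of F then rewrites x·Ψ(y ⊗ z) through the three known
products. -/
theorem IsMulAt.assoc_right {k₁ k₂ k₃ : ℤ} (h₁₂ : IsMulAt φ F k₁ k₂) (h₂₃ : IsMulAt φ F k₂ k₃)
    (h : IsMulAt φ F (k₁ + k₂) k₃) : IsMulAt φ F k₁ (k₂ + k₃) := by
  intro m hm x w
  obtain ⟨u, rfl⟩ := (F.Ψ (rfl : k₂ + k₃ = k₂ + k₃)).surjective w
  induction u using tensor_induction with
  | hc =>
    refine isClosed_eq ?_ ?_
    · exact (continuous_valL_zpowIso m).comp ((F.Ψ hm).continuous.comp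
        ((continuous_tmul_right x).comp (F.Ψ rfl).continuous))
    · exact continuous_const.mul ((continuous_valL_zpowIso _).comp (F.Ψ rfl).continuous)
  | h y z =>
    have hm' : k₁ + k₂ + k₃ = m := by rw [add_assoc, hm]
    rw [← F.assoc rfl rfl hm' hm, h, h₁₂, h₂₃, mul_assoc]
  | hadd u v hu hv => rw [map_add, tmul_add, map_add, map_add, map_add, hu, hv, map_add, map_add, mul_add]

theorem IsMulAt.assoc_left {k₁ k₂ k₃ : ℤ} (h₁₂ : IsMulAt φ F k₁ k₂) (h₂₃ : IsMulAt φ F k₂ k₃)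
    (h : IsMulAt φ F k₁ (k₂ + k₃)) : IsMulAt φ F (k₁ + k₂) k₃ := by
  intro m hm w z
  obtain ⟨u, rfl⟩ := (F.Ψ (rfl : k₁ + k₂ = k₁ + k₂)).surjective w
  induction u using tensor_induction with
  | hc =>
    refine isClosed_eq ?_ ?_
    · exact (continuous_valL_zpowIso m).comp ((F.Ψ hm).continuous.comp
        ((continuous_tmul_left z).comp (F.Ψ rfl).continuous))
    · exact ((continuous_valL_zpowIso _).comp (F.Ψ rfl).continuous).mul continuous_const
  | h x y =>
    have hm' : k₁ + (k₂ + k₃) = m := by rw [← add_assoc, hm]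
    rw [F.assoc rfl rfl hm hm', h, h₁₂, h₂₃, mul_assoc]
  | hadd u v hu hv => rw [map_add, add_tmul, map_add, map_add, map_add, hu, hv, map_add, map_add, add_mul]

variable (φ F)

theorem isMulAt_zero_left (l : ℤ) : IsMulAt φ F 0 l := by
  intro m hm (b : B) y
  obtain rfl : l = m := by rw [← hm, zero_add]
  rw [F.zero_left l b y, Iso.map_smul_left, valL_smul]
  rfl

theorem isMulAt_zero_right (k : ℤ) : IsMulAt φ F k 0 := by
  intro m hm x (b : B)
  obtain rfl : k = m := by rw [← hm, add_zero]
  rw [F.zero_right k x b, Iso.map_smul_right, valL_op_smul]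
  rfl

/-- For n > 0 the normalisation makes Ψ_{n,1} the identity, and the isomorphism in degree n + 1 was
defined by multiplication; n = 0 is the action of B. -/
theorem isMulAt_ofNat_one (n : ℕ) : IsMulAt φ F (Int.ofNat n) 1 := by
  cases n with
  | zero => exact isMulAt_zero_left φ F 1
  | succ n =>
    intro m hm x y
    obtain rfl : Int.ofNat (n + 2) = m := hm
    refine (congrArg (fun u => S.valL (Int.ofNat (n + 2)) (zpowIso φ (Int.ofNat (n + 2)) u))
      (F.pos n (tmul x y))).trans ?_
    exact valL_mulIso_tmul _ _ _ _ _

theorem isMulAt_negSucc_neg_one (n : ℕ) : IsMulAt φ F (Int.negSucc n) (-1) := by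
  intro m hm x y
  obtain rfl : Int.negSucc (n + 1) = m := hm
  refine (congrArg (fun u => S.valL (Int.negSucc (n + 1)) (zpowIso φ (Int.negSucc (n + 1)) u))
    (F.neg n (tmul x y))).trans ?_
  exact valL_mulIso_tmul _ _ _ _ _

theorem isMulAt_one_neg_one : IsMulAt φ F 1 (-1) := by
  intro m hm (x : N.carrier) (y : N.DualCarrier)
  obtain rfl : 0 = m := hm
  refine (congrArg (fun u => S.valL 0 (zpowIso φ 0 u)) (F.one_neg_one x (N.ofDual y))).trans ?_
  change S.ι (N.linner x (N.ofDual y)) = S.valL 1 (φ.toIso x) * star (S.valL 1 (φ.toIso (N.ofDual y)))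
  rw [← φ.map_linner, ι_linner]

theorem isMulAt_neg_one_one : IsMulAt φ F (-1) 1 := by
  intro m hm (x : N.DualCarrier) (y : N.carrier)
  obtain rfl : 0 = m := hm
  refine (congrArg (fun u => S.valL 0 (zpowIso φ 0 u)) (F.neg_one_one (N.ofDual x) y)).trans ?_
  change S.ι (N.rinner (N.ofDual x) y) = star (S.valL 1 (φ.toIso (N.ofDual x))) * S.valL 1 (φ.toIso y)
  rw [← φ.map_rinner, ι_rinner]

/-- For k ≤ -2 write k = (k+1) + (-1). Associativity reduces the pair (k, 1) to (k+1, -1), (-1, 1)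
and (k+1, 0), all of which are prescribed. -/
theorem isMulAt_one_right : ∀ k : ℤ, IsMulAt φ F k 1
  | Int.ofNat n => isMulAt_ofNat_one φ F n
  | Int.negSucc 0 => isMulAt_neg_one_one φ F
  | Int.negSucc (n + 1) =>
    IsMulAt.assoc_left (isMulAt_negSucc_neg_one φ F n) (isMulAt_neg_one_one φ F) (isMulAt_zero_right φ F _)

theorem isMulAt_neg_one_right : ∀ k : ℤ, IsMulAt φ F k (-1)
  | Int.ofNat 0 => isMulAt_zero_left φ F _
  | Int.ofNat (n + 1) =>
    IsMulAt.assoc_left (isMulAt_ofNat_one φ F n) (isMulAt_one_neg_one φ F) (isMulAt_zero_right φ F _)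
  | Int.negSucc n => isMulAt_negSucc_neg_one φ F n

/-- Induction on l by steps of ±1: associativity passes from (k, l) to (k, l ± 1), using the known
cases with second degree ±1. -/
theorem isMulAt (k l : ℤ) : IsMulAt φ F k l := by
  induction l with
  | zero => exact isMulAt_zero_right φ F k
  | succ n ih => exact IsMulAt.assoc_right ih (isMulAt_one_right φ F _) (isMulAt_one_right φ F _)
  | pred n ih => exact IsMulAt.assoc_right ih (isMulAt_neg_one_right φ F _) (isMulAt_neg_one_right φ F _)

theorem eq_factorSystem : F = factorSystem φ := by
  apply HilbertBimodule.FactorSystem.ext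
  funext k l m h
  refine Iso.ext_tmul fun x y => (zpowIso φ m).injective (valL_injective ?_)
  rw [isMulAt φ F k l m h, valL_zpowIso_factorSystem]

end FreeSystem

/-! ### The translation action, a criterion for freeness, and restriction of actions. -/

namespace CStarDynamicalSystem

open SO2

/-- The translation action of `SO(2)` on `C(SO(2), C)`. -/
def translation (C : Type u) [CStarAlgebra C] : CStarDynamicalSystem.{u} SO2 where
  A := C(SO2, C)
  α :=
    { toFun := fun g =>
        { toFun := fun f => f.comp ⟨fun h => h * g, continuous_mul_const g⟩
          invFun := fun f => f.comp ⟨fun h => h * g⁻¹, continuous_mul_const g⁻¹⟩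
          left_inv := fun f => ContinuousMap.ext fun h => by simp
          right_inv := fun f => ContinuousMap.ext fun h => by simp
          map_mul' := fun _ _ => rfl
          map_add' := fun _ _ => rfl
          map_star' := fun _ => rfl
          map_smul' := fun _ _ => rfl }
      map_one' := StarAlgEquiv.ext fun f => ContinuousMap.ext fun h =>
        congrArg f (mul_one h)
      map_mul' := fun g g' => StarAlgEquiv.ext fun f => ContinuousMap.ext fun h =>
        congrArg f (mul_assoc h g g').symm }
  continuous_apply f :=
    (ContinuousMap.curry ⟨fun p : SO2 × SO2 => f (p.2 * p.1),
      f.continuous.comp (continuous_snd.mul continuous_fst)⟩).continuous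

theorem charFun_apply {E : Type*} [NormedAddCommGroup E] [NormedSpace ℂ E] (k : ℤ) (a : E)
    (g : SO2) : charFun k a g = g.character ^ k • a := rfl

theorem charFun_mem {C : Type u} [CStarAlgebra C] (k : ℤ) (a : C) :
    charFun k a ∈ (translation C).isoSub k := fun g => ContinuousMap.ext fun h => by
  change charFun k a (h * g) = g.character ^ k • charFun k a h
  rw [charFun_apply, charFun_apply, character_mul, mul_zpow, mul_smul, smul_comm]

/-- Evaluate the degree k condition at the identity: f(g) = (α_g f)(1) = χ(g)^k f(1). -/
theorem eq_charFun {C : Type u} [CStarAlgebra C] {k : ℤ} {f : C(SO2, C)}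
    (hf : f ∈ (translation C).isoSub k) : f = charFun k (f 1) := by
  ext g
  have h : f (1 * g) = g.character ^ k • f 1 := congrArg (fun f : C(SO2, C) => f 1) (hf g)
  rwa [one_mul] at h

/-- The functions χ^k a make up the isotypic components of the translation action, so this is the
general density of isotypic components. -/
theorem dense_span_charFun (C : Type u) [CStarAlgebra C] {V : Submodule ℂ C(SO2, C)}
    (hV : ∀ k a, charFun k a ∈ V) : Dense (V : Set C(SO2, C)) := by
  refine ((translation C).dense_iSup_isoSub).mono ?_
  exact iSup_le (f := (translation C).isoSub) (a := V) fun k f hf => eq_charFun hf ▸ hV k _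

/-- `g ↦ χ(g) ^ k a` as a linear map in `a`. -/
def charFunL {E : Type*} [NormedAddCommGroup E] [NormedSpace ℂ E] (k : ℤ) : E →L[ℂ] C(SO2, E) :=
  LinearMap.mkContinuous
    { toFun := charFun k
      map_add' := fun a b => ContinuousMap.ext fun g => smul_add _ a b
      map_smul' := fun c a => ContinuousMap.ext fun g => smul_comm _ c a } 1 fun a => by
    refine (ContinuousMap.norm_le _ (by positivity)).2 fun g => ?_
    change ‖charFun k a g‖ ≤ _
    rw [charFun_apply, norm_smul, g.norm_character_zpow]

variable {Y : CStarDynamicalSystem.{u} SO2}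

theorem charFun_mul (k l : ℤ) (a b : Y.A) :
    charFun k a * charFun l b = charFun (k + l) (a * b) := ContinuousMap.ext fun g => by
  rw [ContinuousMap.mul_apply, charFun_apply, charFun_apply, charFun_apply, smul_mul_smul_comm,
    zpow_add₀ g.character_ne_zero]

variable (Y) in
/-- The closure of the range of the Ellwood map. -/
def ellwoodClosure : Submodule ℂ C(SO2, Y.A) := (LinearMap.range Y.ellwood).topologicalClosure

/-- Because χ(g)^j y = α_g(y), multiplying the Ellwood image of x ⊗ z by χ^j y on the right gives
that of x ⊗ zy. -/
theorem mul_charFun_mem_ellwoodClosure {j : ℤ} {y : Y.A} (hy : y ∈ Y.isoSub j) {f : C(SO2, Y.A)}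
    (hf : f ∈ Y.ellwoodClosure) : f * charFun j y ∈ Y.ellwoodClosure := by
  refine closure_mono ?_ (image_closure_subset_closure_image
    (f := fun f : C(SO2, Y.A) => f * charFun j y) (by fun_prop) ⟨f, hf, rfl⟩)
  rintro _ ⟨_, ⟨t, rfl⟩, rfl⟩
  change Y.ellwood t * charFun j y ∈ LinearMap.range Y.ellwood
  induction t using TensorProduct.induction_on with
  | zero => rw [map_zero, zero_mul]; exact Submodule.zero_mem _
  | tmul x z =>
    refine ⟨x ⊗ₜ (z * y), ContinuousMap.ext fun g => ?_⟩
    change x * Y.α g (z * y) = x * Y.α g z * (g.character ^ j • y)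
    rw [map_mul, hy g, mul_assoc]
  | add s t hs ht => rw [map_add, add_mul]; exact Submodule.add_mem _ hs ht

/-- Approximate a by sums of a x y with y in A(j), and split χ^{k+j} axy = (χ^k ax)(χ^j y). -/
theorem charFun_add_mem_ellwoodClosure {j k : ℤ}
    (hj : (1 : Y.A) ∈ closure (Submodule.span ℂ
      {z | ∃ x ∈ Y.isoSub (-j), ∃ y ∈ Y.isoSub j, z = x * y} : Set Y.A))
    (hk : ∀ a, charFun k a ∈ Y.ellwoodClosure) (a : Y.A) :
    charFun (k + j) a ∈ Y.ellwoodClosure := by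
  let V : Submodule ℂ Y.A := Y.ellwoodClosure.comap
    ((charFunL (k + j)).comp (ContinuousLinearMap.mul ℂ Y.A a)).toLinearMap
  have hV : IsClosed (V : Set Y.A) :=
    (Submodule.isClosed_topologicalClosure (LinearMap.range Y.ellwood)).preimage
      ((charFunL (k + j)).comp (ContinuousLinearMap.mul ℂ Y.A a)).continuous
  have h1 : (1 : Y.A) ∈ V := by
    refine closure_minimal ?_ hV hj
    refine SetLike.coe_subset_coe.2 (Submodule.span_le.2 ?_)
    rintro _ ⟨x, -, y, hy, rfl⟩
    change charFun (k + j) (a * (x * y)) ∈ Y.ellwoodClosure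
    rw [← mul_assoc, ← charFun_mul]
    exact mul_charFun_mem_ellwoodClosure hy (hk _)
  have h2 : charFun (k + j) (a * 1) ∈ Y.ellwoodClosure := h1
  rwa [mul_one] at h2

/-- Fullness of the isotypic components of degree `1` and `-1` implies freeness. -/
theorem isFree_of_one_mem_closure
    (h : ∀ j : ℤ, j = 1 ∨ j = -1 → (1 : Y.A) ∈ closure (Submodule.span ℂ
      {z | ∃ x ∈ Y.isoSub (-j), ∃ y ∈ Y.isoSub j, z = x * y} : Set Y.A)) : Y.IsFree := by
  -- Constants are Ellwood images of a ⊗ 1; every other degree is reached from 0 by steps of ±1,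
  -- which is why fullness in these two degrees suffices.
  have hmem : ∀ (k : ℤ) (a : Y.A), charFun k a ∈ Y.ellwoodClosure := fun k => by
    induction k with
    | zero =>
      intro a
      refine Submodule.le_topologicalClosure _ ⟨a ⊗ₜ 1, ContinuousMap.ext fun g => ?_⟩
      change a * Y.α g 1 = g.character ^ (0 : ℤ) • a
      rw [map_one, mul_one, zpow_zero, one_smul]
    | succ n ih => exact charFun_add_mem_ellwoodClosure (h 1 (Or.inl rfl)) ih
    | pred n ih => exact charFun_add_mem_ellwoodClosure (h (-1) (Or.inr rfl)) ih
  have hd := dense_span_charFun Y.A hmem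
  have hc : IsClosed (Y.ellwoodClosure : Set C(SO2, Y.A)) := Submodule.isClosed_topologicalClosure _
  intro f
  have hf := hd f
  rw [hc.closure_eq] at hf
  exact hf

/-- The restriction of a `*`-automorphism to an invariant `*`-subalgebra. -/
def restrictEquiv {A : Type*} [CStarAlgebra A] (D : StarSubalgebra ℂ A) (e : A ≃⋆ₐ[ℂ] A)
    (he : ∀ x ∈ D, e x ∈ D) (he' : ∀ x ∈ D, e.symm x ∈ D) : D ≃⋆ₐ[ℂ] D where
  toFun x := ⟨e x, he x x.2⟩
  invFun x := ⟨e.symm x, he' x x.2⟩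
  left_inv x := Subtype.ext (e.symm_apply_apply x.1)
  right_inv x := Subtype.ext (e.apply_symm_apply x.1)
  map_mul' x y := Subtype.ext (map_mul e x.1 y.1)
  map_add' x y := Subtype.ext (map_add e x.1 y.1)
  map_star' x := Subtype.ext (map_star e x.1)
  map_smul' c x := Subtype.ext (map_smul e c x.1)

theorem α_symm (X : CStarDynamicalSystem.{u} SO2) (g : SO2) (x : X.A) :
    (X.α g).symm x = X.α g⁻¹ x := by
  apply EquivLike.injective (X.α g)
  rw [StarAlgEquiv.apply_symm_apply]
  change x = (X.α g * X.α g⁻¹) x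
  rw [← map_mul, mul_inv_cancel, map_one]
  rfl

/-- The restriction of an action to an invariant `*`-subalgebra. -/
def restrictHom (X : CStarDynamicalSystem.{u} SO2) (D : StarSubalgebra ℂ X.A)
    (hα : ∀ g, ∀ x ∈ D, X.α g x ∈ D) : SO2 →* (D ≃⋆ₐ[ℂ] D) where
  toFun g := restrictEquiv D (X.α g) (hα g) fun x hx => X.α_symm g x ▸ hα g⁻¹ x hx
  map_one' := StarAlgEquiv.ext fun x => Subtype.ext
    (congrArg (fun e : X.A ≃⋆ₐ[ℂ] X.A => e x.1) (map_one X.α))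
  map_mul' g h := StarAlgEquiv.ext fun x => Subtype.ext
    (congrArg (fun e : X.A ≃⋆ₐ[ℂ] X.A => e x.1) (map_mul X.α g h))

/-- The restriction of an action to an invariant closed `*`-subalgebra as a dynamical system. -/
def restrict (X : CStarDynamicalSystem.{u} SO2) (D : StarSubalgebra ℂ X.A)
    (hD : IsClosed (D : Set X.A)) (hα : ∀ g, ∀ x ∈ D, X.α g x ∈ D) :
    CStarDynamicalSystem.{u} SO2 :=
  { A := D
    cstarAlgebra := StarSubalgebra.cstarAlgebra D
    α := X.restrictHom D hα
    continuous_apply := fun x => (X.continuous_apply x.1).subtype_mk _ }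

end CStarDynamicalSystem

/-- A covariant representation of a Hilbert bimodule in a C*-algebra: both inner products are
implemented by the multiplication. -/
structure CovariantRep (N : HilbertBimodule B) (C : Type*) [CStarAlgebra C] where
  π : B →⋆ₐ[ℂ] C
  t : N.carrier → C
  star_t_mul : ∀ x y, star (t x) * t y = π (N.rinner x y)
  t_mul_star : ∀ x y, t x * star (t y) = π (N.linner x y)
  injective : Function.Injective π

/-! ### Covariant representations and the graded *-algebra they generate. -/

namespace CovariantRep

variable {N : HilbertBimodule B} {C : Type*} [CStarAlgebra C] (ρ : CovariantRep N C)

/-- Linearity is forced by the relations: for the defect d, the product d*d expands into values of π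
on inner products that cancel, and the C*-identity gives d = 0. -/
theorem t_add (x y : N.carrier) : ρ.t (x + y) = ρ.t x + ρ.t y := by
  rw [← sub_eq_zero, ← CStarRing.star_mul_self_eq_zero_iff]
  simp only [star_sub, star_add, sub_mul, mul_sub, add_mul, mul_add, ρ.star_t_mul,
    N.rinner_add_right, N.toCorrespondence.rinner_add_left, map_add]
  abel

theorem t_smul (c : ℂ) (x : N.carrier) : ρ.t (c • x) = c • ρ.t x := by
  rw [← sub_eq_zero, ← CStarRing.star_mul_self_eq_zero_iff]
  simp only [star_sub, star_smul, sub_mul, mul_sub, smul_mul_assoc, mul_smul_comm, ρ.star_t_mul,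
    N.toCorrespondence.rinner_smul_right, N.toCorrespondence.rinner_smul_left_complex, map_smul]
  rw [smul_comm c, show star c = conj c from rfl, sub_self, sub_self, smul_zero, sub_zero]

theorem t_op_smul (b : B) (x : N.carrier) : ρ.t (op b • x) = ρ.t x * ρ.π b := by
  rw [← sub_eq_zero, ← CStarRing.star_mul_self_eq_zero_iff]
  simp only [star_sub, star_mul, sub_mul, mul_sub, ← mul_assoc, ρ.star_t_mul,
    N.rinner_op_smul_right, N.toCorrespondence.rinner_op_smul_left, map_mul, map_star]
  simp only [mul_assoc, ρ.star_t_mul, N.toCorrespondence.rinner_op_smul_right, map_mul]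
  simp

/-- The same argument with dd*, since the left inner product is the one that is linear for the left
action. -/
theorem t_smul_left (b : B) (x : N.carrier) : ρ.t (b • x) = ρ.π b * ρ.t x := by
  rw [← sub_eq_zero, ← CStarRing.mul_star_self_eq_zero_iff]
  simp only [star_sub, star_mul, sub_mul, mul_sub, ← mul_assoc, ρ.t_mul_star,
    N.linner_smul_left, N.linner_smul_right, map_mul, map_star]
  simp only [mul_assoc, ρ.t_mul_star, N.linner_smul_right, map_mul, map_star]
  simp

theorem norm_t (x : N.carrier) : ‖ρ.t x‖ = ‖x‖ := by
  rw [← sq_eq_sq₀ (norm_nonneg _) (norm_nonneg _), N.norm_sq_eq_rinner, pow_two,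
    ← CStarRing.norm_star_mul_self, ρ.star_t_mul,
    NonUnitalStarAlgHom.norm_map ρ.π ρ.injective]

/-- The representation of the bimodule as a linear map. -/
def tL : N.carrier →ₗ[ℂ] C where
  toFun := ρ.t
  map_add' := ρ.t_add
  map_smul' := ρ.t_smul

theorem isometry_tL : Isometry ρ.tL := AddMonoidHomClass.isometry_of_norm ρ.tL ρ.norm_t

/-- The image of the bimodule. -/
def rangeT : Submodule ℂ C := LinearMap.range ρ.tL

/-- The adjoints of the image of the bimodule. -/
def rangeTStar : Submodule ℂ C where
  carrier := {c | star c ∈ ρ.rangeT}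
  add_mem' hx hy := by
    simp only [Set.mem_ofPred_eq, star_add] at *
    exact add_mem hx hy
  zero_mem' := by simp
  smul_mem' c x hx := by
    simp only [Set.mem_ofPred_eq, star_smul] at *
    exact Submodule.smul_mem _ _ hx

/-- The image of the coefficient algebra. -/
def rangeπ : Submodule ℂ C := LinearMap.range ρ.π.toAlgHom.toLinearMap

theorem t_mem (x : N.carrier) : ρ.t x ∈ ρ.rangeT := ⟨x, rfl⟩

theorem star_t_mem (x : N.carrier) : star (ρ.t x) ∈ ρ.rangeTStar := by
  change star (star (ρ.t x)) ∈ ρ.rangeT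
  rw [star_star]; exact ρ.t_mem x

theorem π_mem (b : B) : ρ.π b ∈ ρ.rangeπ := ⟨b, rfl⟩

theorem exists_of_mem_rangeT {c : C} (hc : c ∈ ρ.rangeT) : ∃ x, c = ρ.t x := by
  obtain ⟨x, rfl⟩ := hc; exact ⟨x, rfl⟩

theorem exists_of_mem_rangeTStar {c : C} (hc : c ∈ ρ.rangeTStar) : ∃ x, c = star (ρ.t x) := by
  obtain ⟨x, hx⟩ := ρ.exists_of_mem_rangeT hc; exact ⟨x, by rw [← hx, star_star]⟩

theorem exists_of_mem_rangeπ {c : C} (hc : c ∈ ρ.rangeπ) : ∃ b, c = ρ.π b := by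
  obtain ⟨x, rfl⟩ := hc; exact ⟨x, rfl⟩

theorem rangeπ_mul_rangeπ : ρ.rangeπ * ρ.rangeπ ≤ ρ.rangeπ := Submodule.mul_le.2 fun c hc d hd => by
  obtain ⟨a, rfl⟩ := ρ.exists_of_mem_rangeπ hc
  obtain ⟨b, rfl⟩ := ρ.exists_of_mem_rangeπ hd
  rw [← map_mul]; exact ρ.π_mem _

theorem rangeπ_mul_rangeT : ρ.rangeπ * ρ.rangeT ≤ ρ.rangeT := Submodule.mul_le.2 fun c hc d hd => by
  obtain ⟨a, rfl⟩ := ρ.exists_of_mem_rangeπ hc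
  obtain ⟨b, rfl⟩ := ρ.exists_of_mem_rangeT hd
  rw [← t_smul_left]; exact ρ.t_mem _

theorem rangeT_mul_rangeπ : ρ.rangeT * ρ.rangeπ ≤ ρ.rangeT := Submodule.mul_le.2 fun c hc d hd => by
  obtain ⟨a, rfl⟩ := ρ.exists_of_mem_rangeT hc
  obtain ⟨b, rfl⟩ := ρ.exists_of_mem_rangeπ hd
  rw [← t_op_smul]; exact ρ.t_mem _

theorem rangeπ_mul_rangeTStar : ρ.rangeπ * ρ.rangeTStar ≤ ρ.rangeTStar :=
  Submodule.mul_le.2 fun c hc d hd => by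
    obtain ⟨a, rfl⟩ := ρ.exists_of_mem_rangeπ hc
    obtain ⟨b, rfl⟩ := ρ.exists_of_mem_rangeTStar hd
    have : ρ.π a * star (ρ.t b) = star (ρ.t (op (star a) • b)) := by
      rw [t_op_smul, star_mul, map_star, star_star]
    rw [this]; exact ρ.star_t_mem _

theorem rangeT_mul_rangeTStar : ρ.rangeT * ρ.rangeTStar ≤ ρ.rangeπ :=
  Submodule.mul_le.2 fun c hc d hd => by
    obtain ⟨a, rfl⟩ := ρ.exists_of_mem_rangeT hc
    obtain ⟨b, rfl⟩ := ρ.exists_of_mem_rangeTStar hd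
    rw [ρ.t_mul_star]; exact ρ.π_mem _

theorem rangeTStar_mul_rangeT : ρ.rangeTStar * ρ.rangeT ≤ ρ.rangeπ :=
  Submodule.mul_le.2 fun c hc d hd => by
    obtain ⟨a, rfl⟩ := ρ.exists_of_mem_rangeTStar hc
    obtain ⟨b, rfl⟩ := ρ.exists_of_mem_rangeT hd
    rw [ρ.star_t_mul]; exact ρ.π_mem _

/-- The homogeneous part of degree `k` of the algebra generated by a covariant representation. -/
def W : ℤ → Submodule ℂ C
  -- The zeroth power of a subspace consists of the scalars only; the factor `rangeπ` makes degree 0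
  -- equal to π(B) and changes nothing in degree 1.
  | Int.ofNat n => ρ.rangeT ^ n * ρ.rangeπ
  | Int.negSucc n => ρ.rangeTStar ^ (n + 1) * ρ.rangeπ

theorem W_natCast (n : ℕ) : ρ.W n = ρ.rangeT ^ n * ρ.rangeπ := rfl

theorem W_neg_natCast (n : ℕ) : ρ.W (-(n : ℤ)) = ρ.rangeTStar ^ n * ρ.rangeπ := by
  cases n with
  | zero => change ρ.rangeT ^ 0 * ρ.rangeπ = _; rw [pow_zero, pow_zero]
  | succ n => rfl

theorem W_zero : ρ.W 0 = ρ.rangeπ := by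
  change ρ.rangeT ^ 0 * ρ.rangeπ = _
  rw [pow_zero, one_mul]

theorem W_succ (n : ℕ) : ρ.W (n + 1) = ρ.rangeT * ρ.W n := by
  change ρ.rangeT ^ (n + 1) * ρ.rangeπ = _
  rw [pow_succ', mul_assoc, W_natCast]

theorem W_pred (n : ℕ) : ρ.W (-(n : ℤ) - 1) = ρ.rangeTStar * ρ.W (-(n : ℤ)) := by
  rw [show -(n : ℤ) - 1 = -((n + 1 : ℕ) : ℤ) by push_cast; ring, W_neg_natCast, W_neg_natCast,
    pow_succ', mul_assoc]

theorem one_mem_rangeπ : (1 : C) ∈ ρ.rangeπ := map_one ρ.π ▸ ρ.π_mem 1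

theorem W_one_le : ρ.W 1 ≤ ρ.rangeT := by
  have h := ρ.W_succ 0
  rw [Nat.cast_zero, zero_add, W_zero] at h
  rw [h]
  exact ρ.rangeT_mul_rangeπ

theorem rangeT_le : ρ.rangeT ≤ ρ.W 1 := fun c hc => by
  have h := ρ.W_succ 0
  rw [Nat.cast_zero, zero_add, W_zero] at h
  rw [h, ← mul_one c]
  exact Submodule.mul_mem_mul hc ρ.one_mem_rangeπ

theorem rangeTStar_le : ρ.rangeTStar ≤ ρ.W (-1) := fun c hc => by
  have h := ρ.W_pred 0
  rw [Nat.cast_zero, neg_zero, zero_sub, W_zero] at h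
  rw [h, ← mul_one c]
  exact Submodule.mul_mem_mul hc ρ.one_mem_rangeπ

theorem rangeπ_mul_W (k : ℤ) : ρ.rangeπ * ρ.W k ≤ ρ.W k := by
  induction k with
  | zero => rw [W_zero]; exact ρ.rangeπ_mul_rangeπ
  | succ n _ => rw [W_succ, ← mul_assoc]; exact mul_le_mul_left ρ.rangeπ_mul_rangeT _
  | pred n _ => rw [W_pred, ← mul_assoc]; exact mul_le_mul_left ρ.rangeπ_mul_rangeTStar _

/-- In negative degrees t(x) meets an adjoint t(y)*, and their product is absorbed into π(B) by the
left inner product relation. -/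
theorem rangeT_mul_W (k : ℤ) : ρ.rangeT * ρ.W k ≤ ρ.W (k + 1) := by
  induction k with
  | zero => exact (ρ.W_succ 0).ge
  | succ n _ => exact (ρ.W_succ (n + 1)).ge
  | pred n _ =>
    rw [W_pred, ← mul_assoc, sub_add_cancel]
    exact (mul_le_mul_left ρ.rangeT_mul_rangeTStar _).trans (ρ.rangeπ_mul_W _)

theorem rangeTStar_mul_W (k : ℤ) : ρ.rangeTStar * ρ.W k ≤ ρ.W (k - 1) := by
  induction k with
  | zero => exact (ρ.W_pred 0).ge
  | succ n _ =>
    rw [W_succ, ← mul_assoc, add_sub_cancel_right]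
    exact (mul_le_mul_left ρ.rangeTStar_mul_rangeT _).trans (ρ.rangeπ_mul_W _)
  | pred n _ =>
    have := (ρ.W_pred (n + 1)).ge
    rwa [show -((n + 1 : ℕ) : ℤ) = -(n : ℤ) - 1 by push_cast; ring] at this

/-- Peel the generators off the left factor one at a time. -/
theorem W_mul_W (k l : ℤ) : ρ.W k * ρ.W l ≤ ρ.W (k + l) := by
  induction k with
  | zero => rw [W_zero, zero_add]; exact ρ.rangeπ_mul_W l
  | succ n ih =>
    rw [W_succ, mul_assoc, add_right_comm]
    exact (mul_le_mul_right ih _).trans (ρ.rangeT_mul_W _)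
  | pred n ih =>
    rw [W_pred, mul_assoc, sub_add_eq_add_sub]
    exact (mul_le_mul_right ih _).trans (ρ.rangeTStar_mul_W _)

theorem star_mem_W {k : ℤ} {c : C} (hc : c ∈ ρ.W k) : star c ∈ ρ.W (-k) := by
  induction k generalizing c with
  | zero =>
    rw [W_zero] at hc
    obtain ⟨b, rfl⟩ := ρ.exists_of_mem_rangeπ hc
    rw [neg_zero, W_zero, ← map_star]
    exact ρ.π_mem _
  | succ n ih =>
    rw [W_succ] at hc
    refine Submodule.mul_induction_on hc (fun v hv w hw => ?_) fun x y hx hy => ?_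
    · obtain ⟨x, rfl⟩ := ρ.exists_of_mem_rangeT hv
      rw [star_mul, neg_add]
      exact ρ.W_mul_W _ _ (Submodule.mul_mem_mul (ih hw) (ρ.rangeTStar_le (ρ.star_t_mem x)))
    · rw [star_add]; exact add_mem hx hy
  | pred n ih =>
    rw [W_pred] at hc
    refine Submodule.mul_induction_on hc (fun v hv w hw => ?_) fun x y hx hy => ?_
    · obtain ⟨x, rfl⟩ := ρ.exists_of_mem_rangeTStar hv
      rw [star_mul, star_star, show -(-(n : ℤ) - 1) = -(-(n : ℤ)) + 1 by ring]
      exact ρ.W_mul_W _ _ (Submodule.mul_mem_mul (ih hw) (ρ.rangeT_le (ρ.t_mem x)))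
    · rw [star_add]; exact add_mem hx hy

/-- The `*`-algebra generated by a covariant representation. -/
def gradedAlg : StarSubalgebra ℂ C where
  carrier := (⨆ k, ρ.W k : Submodule ℂ C)
  add_mem' := add_mem
  mul_mem' {a b} ha hb := by
    have h : (⨆ k, ρ.W k) * (⨆ k, ρ.W k) ≤ ⨆ k, ρ.W k := by
      simp only [Submodule.iSup_mul, Submodule.mul_iSup]
      exact iSup_le fun k => iSup_le fun l => (ρ.W_mul_W _ _).trans (le_iSup ρ.W _)
    exact h (Submodule.mul_mem_mul ha hb)
  algebraMap_mem' c := by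
    refine Submodule.mem_iSup_of_mem 0 ?_
    rw [W_zero, Algebra.algebraMap_eq_smul_one]
    exact Submodule.smul_mem _ _ ρ.one_mem_rangeπ
  star_mem' {a} ha := by
    refine Submodule.iSup_induction ρ.W (motive := fun a => star a ∈ (⨆ k, ρ.W k : Submodule ℂ C)) ha
      (fun k x hx => Submodule.mem_iSup_of_mem (-k) (ρ.star_mem_W hx)) ?_ fun x y hx hy => ?_
    · rw [star_zero]; exact zero_mem _
    · rw [star_add]; exact add_mem hx hy

/-- The C*-algebra generated by a covariant representation. -/
def alg : StarSubalgebra ℂ C := ρ.gradedAlg.topologicalClosure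

theorem isClosed_alg : IsClosed (ρ.alg : Set C) := StarSubalgebra.isClosed_topologicalClosure _

theorem W_le_alg {k : ℤ} {c : C} (hc : c ∈ ρ.W k) : c ∈ ρ.alg :=
  StarSubalgebra.le_topologicalClosure _ (Submodule.mem_iSup_of_mem (p := ρ.W) k hc)

/-- The isometric image of a complete space is closed, so completing the graded algebra does not
enlarge degree 1; likewise for degree 0 below. -/
theorem isClosed_rangeT : IsClosed (ρ.rangeT : Set C) :=
  ρ.isometry_tL.isClosedEmbedding.isClosed_range

theorem isClosed_rangeπ : IsClosed (ρ.rangeπ : Set C) :=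
  (NonUnitalStarAlgHom.isometry ρ.π ρ.injective).isClosedEmbedding.isClosed_range

theorem one_mem_closure_span_rangeTStar_mul (hN : N.IsMorita) :
    (1 : C) ∈ closure (Submodule.span ℂ {z | ∃ x y, z = star (ρ.t x) * ρ.t y} : Set C) := by
  rw [← map_one ρ.π]
  refine closure_mono ?_ (image_closure_subset_closure_image ρ.π.toCLM.continuous
    ⟨1, hN.dense_rinner 1, rfl⟩)
  rw [show ρ.π.toCLM '' _ = (Submodule.map ρ.π.toCLM.toLinearMap _ : Set C) from rfl,
    Submodule.map_span]
  refine Submodule.span_mono ?_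
  rintro _ ⟨_, ⟨p, rfl⟩, rfl⟩
  exact ⟨p.1, p.2, (ρ.star_t_mul _ _).symm⟩

theorem one_mem_closure_span_mul_rangeTStar (hN : N.IsMorita) :
    (1 : C) ∈ closure (Submodule.span ℂ {z | ∃ x y, z = ρ.t x * star (ρ.t y)} : Set C) := by
  rw [← map_one ρ.π]
  refine closure_mono ?_ (image_closure_subset_closure_image ρ.π.toCLM.continuous
    ⟨1, hN.dense_linner 1, rfl⟩)
  rw [show ρ.π.toCLM '' _ = (Submodule.map ρ.π.toCLM.toLinearMap _ : Set C) from rfl,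
    Submodule.map_span]
  refine Submodule.span_mono ?_
  rintro _ ⟨_, ⟨p, rfl⟩, rfl⟩
  exact ⟨p.1, p.2, (ρ.t_mul_star _ _).symm⟩

end CovariantRep

/-! ### The free system generated by a homogeneous covariant representation. -/

namespace CovariantRep

open CStarDynamicalSystem

variable {N : HilbertBimodule B} {X : CStarDynamicalSystem.{u} SO2} (ρ : CovariantRep N X.A)

theorem W_le_isoSub (hπ : ∀ b, ρ.π b ∈ X.isoSub 0) (ht : ∀ x, ρ.t x ∈ X.isoSub 1)
    (k : ℤ) : ρ.W k ≤ X.isoSub k := by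
  have hR : ρ.W 0 ≤ X.isoSub 0 := fun c hc => by
    rw [W_zero] at hc
    obtain ⟨b, rfl⟩ := ρ.exists_of_mem_rangeπ hc
    exact hπ b
  induction k with
  | zero => exact hR
  | succ n ih =>
    rw [W_succ, Submodule.mul_le]
    intro v hv w hw
    obtain ⟨x, rfl⟩ := ρ.exists_of_mem_rangeT hv
    rw [add_comm]
    exact mul_mem_isoSub (ht x) (ih hw)
  | pred n ih =>
    rw [W_pred, Submodule.mul_le]
    intro v hv w hw
    obtain ⟨x, rfl⟩ := ρ.exists_of_mem_rangeTStar hv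
    rw [sub_eq_neg_add]
    exact mul_mem_isoSub (star_mem_isoSub (ht x)) (ih hw)

/-- P_k is continuous, fixes c, and maps the graded algebra into its degree k part; apply it to
approximants of c. -/
theorem mem_closure_W (hπ : ∀ b, ρ.π b ∈ X.isoSub 0) (ht : ∀ x, ρ.t x ∈ X.isoSub 1)
    {k : ℤ} {c : X.A} (hc : c ∈ ρ.alg) (hck : c ∈ X.isoSub k) :
    c ∈ closure (ρ.W k : Set X.A) := by
  rw [← proj_self hck]
  refine closure_mono ?_ (image_closure_subset_closure_image (X.proj k).continuous ⟨c, hc, rfl⟩)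
  rintro _ ⟨d, hd, rfl⟩
  refine Submodule.iSup_induction ρ.W (motive := fun d => X.proj k d ∈ ρ.W k) hd
    (fun l x hx => ?_) ?_ fun x y hx hy => ?_
  · rw [proj_of_mem (ρ.W_le_isoSub hπ ht l hx)]
    split_ifs with h
    · exact h ▸ hx
    · exact zero_mem _
  · rw [map_zero]; exact zero_mem _
  · rw [map_add]; exact add_mem hx hy

theorem α_mem_alg (hπ : ∀ b, ρ.π b ∈ X.isoSub 0) (ht : ∀ x, ρ.t x ∈ X.isoSub 1)
    (g : SO2) (c : X.A) (hc : c ∈ ρ.alg) : X.α g c ∈ ρ.alg := by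
  refine closure_mono ?_ (image_closure_subset_closure_image (X.αL g).continuous ⟨c, hc, rfl⟩)
  rintro _ ⟨d, hd, rfl⟩
  refine Submodule.iSup_induction ρ.W (motive := fun d => X.αL g d ∈ ⨆ k, ρ.W k) hd
    (fun l x hx => ?_) ?_ fun x y hx hy => ?_
  · rw [αL_apply, ρ.W_le_isoSub hπ ht l hx g]
    exact Submodule.smul_mem _ _ (Submodule.mem_iSup_of_mem l hx)
  · rw [map_zero]; exact zero_mem _
  · rw [map_add]; exact add_mem hx hy

variable (hπ : ∀ b, ρ.π b ∈ X.isoSub 0) (ht : ∀ x, ρ.t x ∈ X.isoSub 1)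

/-- The dynamical system generated by a homogeneous covariant representation. -/
def system : CStarDynamicalSystem.{u} SO2 := X.restrict ρ.alg ρ.isClosed_alg (ρ.α_mem_alg hπ ht)

/-- The inclusion of the generated system. -/
def incl : (ρ.system hπ ht).A →⋆ₐ[ℂ] X.A := ρ.alg.subtype

theorem incl_injective : Function.Injective (ρ.incl hπ ht) := Subtype.val_injective

theorem incl_α (g : SO2) (x : (ρ.system hπ ht).A) :
    ρ.incl hπ ht ((ρ.system hπ ht).α g x) = X.α g (ρ.incl hπ ht x) := rfl

theorem incl_mem (x : (ρ.system hπ ht).A) : ρ.incl hπ ht x ∈ ρ.alg := x.2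

/-- Elements of the generated algebra as elements of the generated system. -/
def lift (c : X.A) (hc : c ∈ ρ.alg) : (ρ.system hπ ht).A := (⟨c, hc⟩ : ρ.alg)

theorem incl_lift (c : X.A) (hc : c ∈ ρ.alg) : ρ.incl hπ ht (ρ.lift hπ ht c hc) = c := rfl

theorem mem_isoSub_iff_incl {k : ℤ} {x : (ρ.system hπ ht).A} :
    x ∈ (ρ.system hπ ht).isoSub k ↔ ρ.incl hπ ht x ∈ X.isoSub k := by
  refine forall_congr' fun g => ?_
  rw [← (ρ.incl_injective hπ ht).eq_iff, incl_α, map_smul]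

theorem π_mem_alg (b : B) : ρ.π b ∈ ρ.alg := ρ.W_le_alg (k := 0) (by rw [W_zero]; exact ρ.π_mem b)

theorem t_mem_alg (x : N.carrier) : ρ.t x ∈ ρ.alg := ρ.W_le_alg (ρ.rangeT_le (ρ.t_mem x))

/-- The coefficient algebra in the generated system. -/
def systemι : B →⋆ₐ[ℂ] (ρ.system hπ ht).A where
  toFun b := ρ.lift hπ ht (ρ.π b) (ρ.π_mem_alg b)
  map_one' := ρ.incl_injective hπ ht (by rw [incl_lift, map_one, map_one])
  map_mul' a b := ρ.incl_injective hπ ht (by rw [incl_lift, map_mul, map_mul, incl_lift, incl_lift])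
  map_zero' := ρ.incl_injective hπ ht (by rw [incl_lift, map_zero, map_zero])
  map_add' a b := ρ.incl_injective hπ ht (by rw [incl_lift, map_add, map_add, incl_lift, incl_lift])
  commutes' c := ρ.incl_injective hπ ht (by rw [incl_lift, AlgHomClass.commutes, AlgHomClass.commutes])
  map_star' a := ρ.incl_injective hπ ht (by rw [incl_lift, map_star, map_star, incl_lift])

theorem incl_systemι (b : B) : ρ.incl hπ ht (ρ.systemι hπ ht b) = ρ.π b := rfl

theorem isometry_incl : Isometry (ρ.incl hπ ht) :=
  NonUnitalStarAlgHom.isometry _ (ρ.incl_injective hπ ht)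

theorem one_mem_closure_of_incl {s : Set X.A} {r : Set (ρ.system hπ ht).A}
    (hsr : s ⊆ ρ.incl hπ ht '' r) (h : (1 : X.A) ∈ closure (Submodule.span ℂ s : Set X.A)) :
    (1 : (ρ.system hπ ht).A) ∈ closure (Submodule.span ℂ r : Set (ρ.system hπ ht).A) := by
  rw [(ρ.isometry_incl hπ ht).isUniformInducing.isInducing.closure_eq_preimage_closure_image,
    Set.mem_preimage, map_one]
  refine closure_mono ?_ h
  rw [show ρ.incl hπ ht '' (Submodule.span ℂ r : Set (ρ.system hπ ht).A) =
    (Submodule.map (ρ.incl hπ ht).toCLM.toLinearMap (Submodule.span ℂ r) : Set X.A) from rfl,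
    Submodule.map_span]
  exact Submodule.span_mono hsr

/-- Fullness of the right and left inner products of N says that t(N)*t(N) and t(N)t(N)* span
subspaces approximating 1, which is the criterion in degrees 1 and -1. -/
theorem isFree_system (hN : N.IsMorita) : (ρ.system hπ ht).IsFree := by
  have h1 : ∀ x, ρ.lift hπ ht (ρ.t x) (ρ.t_mem_alg x) ∈ (ρ.system hπ ht).isoSub 1 := fun x => by
    rw [mem_isoSub_iff_incl, incl_lift]; exact ht x
  refine isFree_of_one_mem_closure ?_
  rintro j (rfl | rfl)
  · refine ρ.one_mem_closure_of_incl hπ ht ?_ (ρ.one_mem_closure_span_rangeTStar_mul hN)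
    rintro _ ⟨x, y, rfl⟩
    refine ⟨_, ⟨_, star_mem_isoSub (h1 x), _, h1 y, rfl⟩, ?_⟩
    rw [map_mul, map_star, incl_lift, incl_lift]
  · refine ρ.one_mem_closure_of_incl hπ ht ?_ (ρ.one_mem_closure_span_mul_rangeTStar hN)
    rintro _ ⟨x, y, rfl⟩
    refine ⟨_, ⟨_, (neg_neg (1 : ℤ)).symm ▸ h1 x, _, star_mem_isoSub (h1 y), rfl⟩, ?_⟩
    rw [map_mul, map_star, incl_lift, incl_lift]

/-- The free system generated by a homogeneous covariant representation of a Morita equivalence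
bimodule. -/
def freeSystem (hN : N.IsMorita) : FreeSystem B where
  toCStarDynamicalSystem := ρ.system hπ ht
  isFree := ρ.isFree_system hπ ht hN
  ι := ρ.systemι hπ ht
  ι_injective a b hab := ρ.injective (by
    rw [← ρ.incl_systemι hπ ht, hab, incl_systemι])
  range_ι := by
    ext x
    constructor
    · rintro ⟨b, rfl⟩ g
      refine ρ.incl_injective hπ ht ?_
      rw [incl_α, incl_systemι]
      exact mem_isoSub_zero.1 (hπ b) g
    · intro hx
      -- A fixed point lies in the closure of the degree 0 part, which is the closed set π(B).
      have h := ρ.mem_closure_W hπ ht (ρ.incl_mem hπ ht x)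
        ((ρ.mem_isoSub_iff_incl hπ ht).1 (mem_isoSub_zero.2 hx))
      rw [W_zero, ρ.isClosed_rangeπ.closure_eq] at h
      obtain ⟨b, hb⟩ := ρ.exists_of_mem_rangeπ h
      exact ⟨b, ρ.incl_injective hπ ht hb.symm⟩

/-- The inclusion of the generated free system. -/
def freeIncl (hN : N.IsMorita) : (ρ.freeSystem hπ ht hN).A →⋆ₐ[ℂ] X.A := ρ.incl hπ ht

theorem freeIncl_injective (hN : N.IsMorita) : Function.Injective (ρ.freeIncl hπ ht hN) :=
  Subtype.val_injective

/-- The linear map `N → A(1)` of the generated free system. -/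
def oneMap (hN : N.IsMorita) : N.carrier →ₗ[ℂ] ((ρ.freeSystem hπ ht hN).isotypic 1).carrier where
  toFun x := FreeSystem.isoMk (ρ.lift hπ ht (ρ.t x) (ρ.t_mem_alg x))
    ((ρ.mem_isoSub_iff_incl hπ ht).2 (ht x))
  map_add' x y := FreeSystem.valL_injective (ρ.freeIncl_injective hπ ht hN (by
    rw [map_add, map_add]
    exact ρ.t_add x y))
  map_smul' c x := FreeSystem.valL_injective (ρ.freeIncl_injective hπ ht hN (by
    rw [map_smul, map_smul]
    exact ρ.t_smul c x))

theorem freeIncl_oneMap (hN : N.IsMorita) (x : N.carrier) :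
    ρ.freeIncl hπ ht hN ((ρ.freeSystem hπ ht hN).valL 1 (ρ.oneMap hπ ht hN x)) = ρ.t x := rfl

/-- The isomorphism `N ≅ A(1)` of the generated free system. -/
def oneIso (hN : N.IsMorita) : HilbertBimodule.Iso N ((ρ.freeSystem hπ ht hN).isotypic 1) where
  toEquiv := LinearEquiv.ofBijective (ρ.oneMap hπ ht hN) (by
    constructor
    · intro x y hxy
      refine ρ.isometry_tL.injective ?_
      change ρ.t x = ρ.t y
      rw [← ρ.freeIncl_oneMap hπ ht hN, hxy, freeIncl_oneMap]
    · intro y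
      -- Surjectivity: degree 1 elements lie in the closure of t(N)π(B), which is contained in the
      -- closed subspace t(N).
      have hy := ρ.mem_closure_W hπ ht (ρ.incl_mem hπ ht ((ρ.freeSystem hπ ht hN).valL 1 y))
        ((ρ.mem_isoSub_iff_incl hπ ht).1 (FreeSystem.valL_mem y))
      have hy' := closure_mono ρ.W_one_le hy
      rw [ρ.isClosed_rangeT.closure_eq] at hy'
      obtain ⟨x, hx⟩ := ρ.exists_of_mem_rangeT hy'
      exact ⟨x, FreeSystem.valL_injective (ρ.freeIncl_injective hπ ht hN hx.symm)⟩)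
  map_smul_left b x := FreeSystem.valL_injective (ρ.freeIncl_injective hπ ht hN (by
    rw [FreeSystem.valL_smul, map_mul]
    exact ρ.t_smul_left b x))
  map_smul_right b x := FreeSystem.valL_injective (ρ.freeIncl_injective hπ ht hN (by
    rw [FreeSystem.valL_op_smul, map_mul]
    exact ρ.t_op_smul (unop b) x))
  map_rinner x y := (ρ.freeSystem hπ ht hN).ι_injective (ρ.freeIncl_injective hπ ht hN (by
    rw [FreeSystem.ι_rinner, map_mul, map_star]
    exact ρ.star_t_mul x y))
  map_linner x y := (ρ.freeSystem hπ ht hN).ι_injective (ρ.freeIncl_injective hπ ht hN (by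
    rw [FreeSystem.ι_linner, map_mul, map_star]
    exact ρ.t_mul_star x y))

end CovariantRep

/-! ### Diagonal actions on products. -/

namespace CStarDynamicalSystem

/-- The product of two `*`-automorphisms. -/
def prodEquiv {A C : Type*} [CStarAlgebra A] [CStarAlgebra C] (e : A ≃⋆ₐ[ℂ] A) (f : C ≃⋆ₐ[ℂ] C) :
    (A × C) ≃⋆ₐ[ℂ] (A × C) where
  toFun p := (e p.1, f p.2)
  invFun p := (e.symm p.1, f.symm p.2)
  left_inv _ := Prod.ext (e.symm_apply_apply _) (f.symm_apply_apply _)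
  right_inv _ := Prod.ext (e.apply_symm_apply _) (f.apply_symm_apply _)
  map_mul' p q := Prod.ext (map_mul e p.1 q.1) (map_mul f p.2 q.2)
  map_add' p q := Prod.ext (map_add e p.1 q.1) (map_add f p.2 q.2)
  map_star' p := Prod.ext (map_star e p.1) (map_star f p.2)
  map_smul' c p := Prod.ext (map_smul e c p.1) (map_smul f c p.2)

/-- The diagonal action on the product of two C*-algebras. -/
def prodHom (X Y : CStarDynamicalSystem.{u} SO2) : SO2 →* ((X.A × Y.A) ≃⋆ₐ[ℂ] (X.A × Y.A)) where
  toFun g := prodEquiv (X.α g) (Y.α g)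
  map_one' := by rw [map_one, map_one]; rfl
  map_mul' g h := by rw [map_mul, map_mul]; rfl

/-- The diagonal action on the product of two C*-algebras as a dynamical system. -/
def prod (X Y : CStarDynamicalSystem.{u} SO2) : CStarDynamicalSystem.{u} SO2 where
  A := X.A × Y.A
  α := prodHom X Y
  continuous_apply p := (X.continuous_apply p.1).prodMk (Y.continuous_apply p.2)

theorem mk_mem_isoSub_prod {X Y : CStarDynamicalSystem.{u} SO2} {k : ℤ} {x : X.A} {y : Y.A}
    (hx : x ∈ X.isoSub k) (hy : y ∈ Y.isoSub k) : (x, y) ∈ (X.prod Y).isoSub k := fun g =>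
  Prod.ext (hx g) (hy g)

end CStarDynamicalSystem

/-! ### Injectivity: a free system is determined by its component of degree one. -/

namespace FreeSystem

open CStarDynamicalSystem

/-- The algebra of a free system is generated by the fixed points and the isotypic component of
degree `1`. -/
theorem mem_of_closed {S : FreeSystem B} (V : StarSubalgebra ℂ S.A) (hV : IsClosed (V : Set S.A))
    (hι : ∀ b, S.ι b ∈ V) (h1 : ∀ x ∈ S.isoSub 1, x ∈ V) (x : S.A) : x ∈ V := by
  have hmul : ∀ k l m : ℤ, k + l = m → (∀ x ∈ S.isoSub k, x ∈ V) → (∀ x ∈ S.isoSub l, x ∈ V) →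
      ∀ x ∈ S.isoSub m, x ∈ V := fun k l m h hk hl x hx => by
    refine closure_minimal ?_ hV (S.mem_closure_span_mul h hx)
    refine SetLike.coe_subset_coe.2
      (Submodule.span_le (p := Subalgebra.toSubmodule V.toSubalgebra).2 ?_)
    rintro _ ⟨x, hx, y, hy, rfl⟩
    exact V.mul_mem (hk x hx) (hl y hy)
  have h : ∀ (k : ℤ), ∀ x ∈ S.isoSub k, x ∈ V := fun k => by
    induction k with
    | zero =>
      intro x hx
      rw [← S.ι_toB (mem_isoSub_zero.1 hx)]
      exact hι _
    | succ n ih => exact hmul _ _ _ rfl ih h1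
    | pred n ih =>
      -- Elements of degree -1 are adjoints of elements of degree 1.
      refine hmul _ (-1) _ rfl ih fun x hx => ?_
      have := h1 _ (star_mem_isoSub hx)
      exact star_star x ▸ star_mem this
  refine closure_minimal ?_ hV (S.dense_iSup_isoSub x)
  exact iSup_le (f := S.isoSub) (a := Subalgebra.toSubmodule V.toSubalgebra) h

/-- On fixed points p is ι_T after the inverse of ι_S, hence injective there and so everywhere. Its
range is then closed and contains the generators ι_T(B) and the degree 1 component. -/
theorem bijective_of_equivariant {S T : FreeSystem B} (p : S.A →⋆ₐ[ℂ] T.A)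
    (hα : ∀ g x, p (S.α g x) = T.α g (p x)) (hι : ∀ b, p (S.ι b) = T.ι b)
    (h1 : ∀ x ∈ T.isoSub 1, ∃ y, p y = x) : Function.Bijective p := by
  have hinj : Function.Injective p := injective_of_injective_fixed p hα fun x hx h => by
    rw [← S.ι_toB (mem_isoSub_zero.1 hx), hι] at h
    rw [← S.ι_toB (mem_isoSub_zero.1 hx), T.ι_injective (h.trans (map_zero T.ι).symm), map_zero]
  refine ⟨hinj, fun x => ?_⟩
  exact mem_of_closed p.range
    (NonUnitalStarAlgHom.isometry p hinj).isClosedEmbedding.isClosed_range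
    (fun b => ⟨S.ι b, hι b⟩) h1 x

variable {S T : FreeSystem B}

/-- The diagonal representation of `A(1)` given by an isomorphism of two such components. -/
def diagRep (u : HilbertBimodule.Iso (S.isotypic 1) (T.isotypic 1)) :
    CovariantRep (S.isotypic 1) (S.toCStarDynamicalSystem.prod T.toCStarDynamicalSystem).A where
  π := (S.ι.prod T.ι : B →⋆ₐ[ℂ] S.A × T.A)
  t x := ((S.valL 1 x, T.valL 1 (u.toIso x)) : S.A × T.A)
  star_t_mul x y := Prod.ext (ι_rinner x y).symm (by
    refine (ι_rinner _ _).symm.trans ?_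
    rw [u.map_rinner]; rfl)
  t_mul_star x y := Prod.ext (ι_linner x y).symm (by
    refine (ι_linner _ _).symm.trans ?_
    rw [u.map_linner]; rfl)
  injective a b hab := S.ι_injective (congrArg Prod.fst hab)

/-- The free system Γ generated by the diagonal representation is the graph of the sought
isomorphism: both coordinate projections p and q are equivariant, compatible with B and onto degree
1, hence bijective, and q ∘ p⁻¹ is the equivalence. -/
theorem equiv_of_iso (u : HilbertBimodule.Iso (S.isotypic 1) (T.isotypic 1)) :
    ∃ φ : S.A ≃⋆ₐ[ℂ] T.A,
      (∀ b, φ (S.ι b) = T.ι b) ∧ ∀ (g : SO2) (x : S.A), φ (S.α g x) = T.α g (φ x) := by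
  let ρ := diagRep u
  have hπ : ∀ b, ρ.π b ∈ (S.toCStarDynamicalSystem.prod T.toCStarDynamicalSystem).isoSub 0 :=
    fun b => mk_mem_isoSub_prod (mem_isoSub_zero.2 fun g => S.α_ι g b)
      (mem_isoSub_zero.2 fun g => T.α_ι g b)
  have ht : ∀ x, ρ.t x ∈ (S.toCStarDynamicalSystem.prod T.toCStarDynamicalSystem).isoSub 1 :=
    fun x => mk_mem_isoSub_prod (valL_mem x) (valL_mem _)
  let Γ := ρ.freeSystem hπ ht (S.isMorita 1)
  let j : Γ.A →⋆ₐ[ℂ] S.A × T.A := ρ.freeIncl hπ ht (S.isMorita 1)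
  let p : Γ.A →⋆ₐ[ℂ] S.A := (StarAlgHom.fst ℂ S.A T.A).comp j
  let q : Γ.A →⋆ₐ[ℂ] T.A := (StarAlgHom.snd ℂ S.A T.A).comp j
  have hp : Function.Bijective p := bijective_of_equivariant p (fun g x => rfl) (fun b => rfl)
    fun x hx => ⟨Γ.valL 1 ((ρ.oneIso hπ ht (S.isMorita 1)).toIso (isoMk x hx)), rfl⟩
  have hq : Function.Bijective q := bijective_of_equivariant q (fun g x => rfl) (fun b => rfl)
    fun x hx => by
      obtain ⟨y, hy⟩ := u.toIso.surjective (isoMk x hx)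
      refine ⟨Γ.valL 1 ((ρ.oneIso hπ ht (S.isMorita 1)).toIso y), ?_⟩
      change T.valL 1 (u.toIso y) = x
      rw [hy, valL_isoMk]
  let P := StarAlgEquiv.ofBijective p hp
  let Q := StarAlgEquiv.ofBijective q hq
  have key : ∀ x, (P.symm.trans Q) (p x) = q x := fun x => by
    change Q (P.symm (P x)) = Q x
    rw [StarAlgEquiv.symm_apply_apply]
  refine ⟨P.symm.trans Q, fun b => key (Γ.ι b), fun g x => ?_⟩
  obtain ⟨y, rfl⟩ := hp.2 x
  exact (key (Γ.α g y)).trans (congrArg (T.α g) (key y).symm)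

end FreeSystem

/-! ### The C*-algebra of adjointable operators. -/

namespace Correspondence

variable (E : Correspondence B)

/-- Adjointness of bounded operators for the `B`-valued inner product. -/
def IsAdjointPair (T S : E.carrier →L[ℂ] E.carrier) : Prop :=
  ∀ x y, E.rinner (T x) y = E.rinner x (S y)

variable {E}

theorem ext_rinner {x y : E.carrier} (h : ∀ z, E.rinner z x = E.rinner z y) : x = y := by
  refine eq_of_rinner_sub_self ?_
  have h1 := (rinnerL (M := E) (x - y)).map_sub x y
  exact h1.trans (sub_eq_zero.2 (h _))

theorem rinner_zero_left (x : E.carrier) : E.rinner 0 x = 0 := by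
  have h := E.rinner_add_left 0 0 x
  rw [add_zero] at h
  exact left_eq_add.1 h

theorem rinner_zero_right (x : E.carrier) : E.rinner x 0 = 0 := by
  rw [← E.star_rinner, rinner_zero_left, star_zero]

namespace IsAdjointPair

variable {T T' S S' : E.carrier →L[ℂ] E.carrier}

theorem symm (h : E.IsAdjointPair T S) : E.IsAdjointPair S T := fun x y => by
  rw [← E.star_rinner, ← h, E.star_rinner]

theorem unique (h : E.IsAdjointPair T S) (h' : E.IsAdjointPair T S') : S = S' :=
  ContinuousLinearMap.ext fun y => ext_rinner fun z => by rw [← h, ← h']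

theorem add (h : E.IsAdjointPair T S) (h' : E.IsAdjointPair T' S') :
    E.IsAdjointPair (T + T') (S + S') := fun x y => by
  rw [add_apply, add_apply, E.rinner_add_left,
    E.rinner_add_right, h, h']

theorem mul (h : E.IsAdjointPair T S) (h' : E.IsAdjointPair T' S') :
    E.IsAdjointPair (T * T') (S' * S) := fun x y => by
  change E.rinner (T (T' x)) y = E.rinner x (S' (S y))
  rw [h, h']

theorem smul (h : E.IsAdjointPair T S) (c : ℂ) : E.IsAdjointPair (c • T) (conj c • S) :=
  fun x y => by
    change E.rinner (c • T x) y = E.rinner x (conj c • S y)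
    rw [E.rinner_smul_left_complex, E.rinner_smul_right, h]

theorem one : E.IsAdjointPair 1 1 := fun _ _ => rfl

/-- The C*-inequality, from ‖Tx‖² = ‖⟨x, STx⟩‖ ≤ ‖ST‖‖x‖². -/
theorem norm_mul_self_le (h : E.IsAdjointPair T S) : ‖T‖ * ‖T‖ ≤ ‖S * T‖ := by
  have h1 : ‖T‖ ≤ √‖S * T‖ := by
    refine T.opNorm_le_bound (Real.sqrt_nonneg _) fun x => ?_
    refine (pow_le_pow_iff_left₀ (norm_nonneg _) (by positivity) two_ne_zero).1 ?_
    rw [mul_pow, Real.sq_sqrt (norm_nonneg _), E.norm_sq_eq_rinner, h]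
    refine (norm_rinner_le _ _).trans ?_
    have h2 : ‖S (T x)‖ ≤ ‖S * T‖ * ‖x‖ := (S * T).le_opNorm x
    nlinarith [norm_nonneg x]
  calc ‖T‖ * ‖T‖ ≤ √‖S * T‖ * √‖S * T‖ := by gcongr
    _ = ‖S * T‖ := Real.mul_self_sqrt (norm_nonneg _)

theorem norm_le (h : E.IsAdjointPair T S) : ‖T‖ ≤ ‖S‖ := by
  rcases (norm_nonneg T).eq_or_lt with h0 | h0
  · rw [← h0]; exact norm_nonneg S
  · exact le_of_mul_le_mul_right (h.norm_mul_self_le.trans (norm_mul_le S T)) h0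

theorem norm_eq (h : E.IsAdjointPair T S) : ‖S‖ = ‖T‖ := le_antisymm h.symm.norm_le h.norm_le

end IsAdjointPair

variable (E)

/-- The algebra of adjointable operators. -/
def adjointable : Subalgebra ℂ (E.carrier →L[ℂ] E.carrier) where
  carrier := {T | ∃ S, E.IsAdjointPair T S}
  mul_mem' := fun ⟨_, h⟩ ⟨_, h'⟩ => ⟨_, h.mul h'⟩
  add_mem' := fun ⟨_, h⟩ ⟨_, h'⟩ => ⟨_, h.add h'⟩
  algebraMap_mem' c := by
    rw [Algebra.algebraMap_eq_smul_one]
    exact ⟨_, IsAdjointPair.one.smul c⟩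

variable {E}

/-- The adjoint of an adjointable operator. -/
def adj (T : E.adjointable) : E.carrier →L[ℂ] E.carrier := T.2.choose

theorem isAdjointPair_adj (T : E.adjointable) : E.IsAdjointPair T.1 (adj T) := T.2.choose_spec

theorem adj_eq {T : E.adjointable} {S : E.carrier →L[ℂ] E.carrier} (h : E.IsAdjointPair T.1 S) :
    adj T = S := (isAdjointPair_adj T).unique h

instance : Star E.adjointable := ⟨fun T => ⟨adj T, T.1, (isAdjointPair_adj T).symm⟩⟩

instance : StarRing E.adjointable where
  star_involutive T := Subtype.ext (adj_eq (isAdjointPair_adj T).symm)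
  star_mul T T' := Subtype.ext (adj_eq ((isAdjointPair_adj T).mul (isAdjointPair_adj T')))
  star_add T T' := Subtype.ext (adj_eq ((isAdjointPair_adj T).add (isAdjointPair_adj T')))

/-- Taking adjoints preserves norms, so the adjoints of a convergent sequence are Cauchy, and their
limit is adjoint to the limit. -/
theorem isClosed_adjointable : IsClosed (E.adjointable : Set (E.carrier →L[ℂ] E.carrier)) := by
  refine isClosed_of_closure_subset fun T hT => ?_
  obtain ⟨u, hu, hlim⟩ := mem_closure_iff_seq_limit.1 hT
  choose S hS using hu
  have hneg : ∀ m n, E.IsAdjointPair (u m - u n) (S m - S n) := fun m n => by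
    have h1 := (hS m).add ((hS n).smul (-1))
    simpa [sub_eq_add_neg] using h1
  have hc : CauchySeq S := by
    refine Metric.cauchySeq_iff.2 fun ε hε => ?_
    obtain ⟨k, hk⟩ := Metric.cauchySeq_iff.1 hlim.cauchySeq ε hε
    refine ⟨k, fun m hm n hn => ?_⟩
    have := hk m hm n hn
    rwa [dist_eq_norm, (hneg m n).norm_eq, ← dist_eq_norm]
  obtain ⟨S', hS'⟩ := cauchySeq_tendsto_of_complete hc
  refine ⟨S', fun x y => ?_⟩
  have h1 : Filter.Tendsto (fun n => E.rinner (u n x) y) Filter.atTop (nhds (E.rinner (T x) y)) :=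
    ((continuous_rinner_left y).tendsto _).comp
      (((ContinuousLinearMap.apply ℂ E.carrier x).continuous.tendsto T).comp hlim)
  have h2 : Filter.Tendsto (fun n => E.rinner x (S n y)) Filter.atTop (nhds (E.rinner x (S' y))) :=
    ((continuous_rinner_right x).tendsto _).comp
      (((ContinuousLinearMap.apply ℂ E.carrier y).continuous.tendsto S').comp hS')
  simp only [fun n => hS n x y] at h1
  exact tendsto_nhds_unique h1 h2

instance : CompleteSpace E.adjointable := isClosed_adjointable.completeSpace_coe

instance : CStarRing E.adjointable where
  norm_mul_self_le T := (isAdjointPair_adj T).norm_mul_self_le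

instance : StarModule ℂ E.adjointable where
  star_smul c T := Subtype.ext (adj_eq ((isAdjointPair_adj T).smul c))

instance : CStarAlgebra E.adjointable where

variable (E) in
/-- The left action of `B` as a continuous linear map. -/
def leftL (b : B) : E.carrier →L[ℂ] E.carrier :=
  LinearMap.mkContinuous
    { toFun := fun x => b • x
      map_add' := smul_add b
      map_smul' := fun c x => by
        rw [RingHom.id_apply, ← one_smul B x, ← smul_assoc c (1 : B) x, smul_smul, smul_smul,
          mul_smul_comm, mul_one, smul_assoc] } ‖b‖ (norm_smul_le_left b)

theorem isAdjointPair_leftL (b : B) : E.IsAdjointPair (E.leftL b) (E.leftL (star b)) :=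
  fun x y => E.rinner_smul_left b x y

variable (E) in
/-- The left action of `B` as a `*`-homomorphism. -/
def leftHom : B →⋆ₐ[ℂ] E.adjointable where
  toFun b := ⟨E.leftL b, _, isAdjointPair_leftL b⟩
  map_one' := Subtype.ext (ContinuousLinearMap.ext fun x => one_smul B x)
  map_mul' a b := Subtype.ext (ContinuousLinearMap.ext fun x => mul_smul a b x)
  map_zero' := Subtype.ext (ContinuousLinearMap.ext fun x => zero_smul B x)
  map_add' a b := Subtype.ext (ContinuousLinearMap.ext fun x => add_smul a b x)
  commutes' c := Subtype.ext (ContinuousLinearMap.ext fun x => by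
    change algebraMap ℂ B c • x = c • x
    rw [Algebra.algebraMap_eq_smul_one, smul_assoc, one_smul])
  map_star' b := Subtype.ext (adj_eq (isAdjointPair_leftL b)).symm

end Correspondence

/-! ### Operators on a pre-correspondence and their extension to the completion. -/

namespace PreCorrespondence

variable (P : PreCorrespondence B)

/-- A formal adjoint inherits the bound: ‖Sv‖² = ‖⟨TSv, v⟩‖ ≤ r‖Sv‖‖v‖, then divide by ‖Sv‖. -/
theorem bound_of_adjoint {T S : P.carrier →ₗ[ℂ] P.carrier}
    (h : ∀ u v, P.rinner (T u) v = P.rinner u (S v)) {r : ℝ} (hr : ∀ u, ‖T u‖ ≤ r * ‖u‖)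
    (v : P.carrier) : ‖S v‖ ≤ r * ‖v‖ := by
  have h1 : ‖S v‖ ^ 2 ≤ r * ‖S v‖ * ‖v‖ := by
    rw [P.norm_sq, ← h]
    refine (P.norm_rinner_le _ _).trans ?_
    rw [← P.norm_def, ← P.norm_def]
    gcongr
    exact hr _
  rcases (norm_nonneg (S v)).eq_or_lt with h0 | h0
  · have h2 := (norm_nonneg _).trans (hr v)
    rwa [← h0]
  · nlinarith

/-- Extend a bounded operator to the completion. -/
def extendOp (T : P.carrier →ₗ[ℂ] P.carrier) {r : ℝ} (hr : ∀ u, ‖T u‖ ≤ r * ‖u‖) :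
    P.completion.carrier →L[ℂ] P.completion.carrier :=
  ((Completion.toComplL (𝕜 := ℂ) (E := P.carrier)).comp (T.mkContinuous r hr)).extend
    (Completion.toComplL (𝕜 := ℂ) (E := P.carrier))

/-- The canonical map to the completion. -/
def toCompletion (u : P.carrier) : P.completion.carrier := Completion.coe' u

theorem extendOp_coe (T : P.carrier →ₗ[ℂ] P.carrier) {r : ℝ} (hr : ∀ u, ‖T u‖ ≤ r * ‖u‖)
    (u : P.carrier) : P.extendOp T hr (P.toCompletion u) = P.toCompletion (T u) :=
  ContinuousLinearMap.extend_eq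
    ((Completion.toComplL (𝕜 := ℂ) (E := P.carrier)).comp (T.mkContinuous r hr))
    Completion.denseRange_coe (Completion.isUniformInducing_coe _) _

theorem rinner_toCompletion (u v : P.carrier) :
    P.completion.rinner (P.toCompletion u) (P.toCompletion v) = P.rinner u v :=
  P.completionInner_coe u v

theorem smul_toCompletion (b : B) (u : P.carrier) :
    b • P.toCompletion u = P.toCompletion (b • u) := (Completion.coe_smul b u).symm

theorem completion_ext {T S : P.completion.carrier →L[ℂ] P.completion.carrier}
    (h : ∀ u, T (P.toCompletion u) = S (P.toCompletion u)) : T = S :=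
  ContinuousLinearMap.ext fun x => Completion.induction_on (α := P.carrier) x
    (isClosed_eq T.continuous S.continuous) h

theorem isAdjointPair_extendOp {T S : P.carrier →ₗ[ℂ] P.carrier}
    (h : ∀ u v, P.rinner (T u) v = P.rinner u (S v)) {r s : ℝ} (hr : ∀ u, ‖T u‖ ≤ r * ‖u‖)
    (hs : ∀ u, ‖S u‖ ≤ s * ‖u‖) : P.completion.IsAdjointPair (P.extendOp T hr) (P.extendOp S hs) := by
  intro x y
  refine Completion.induction_on (α := P.carrier) x (isClosed_eq
    ((Correspondence.continuous_rinner_left (M := P.completion) y).comp (P.extendOp T hr).continuous)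
    (Correspondence.continuous_rinner_left (M := P.completion) _)) fun u => ?_
  refine Completion.induction_on (α := P.carrier) y (isClosed_eq
    (Correspondence.continuous_rinner_right (M := P.completion) _)
    ((Correspondence.continuous_rinner_right (M := P.completion) _).comp
      (P.extendOp S hs).continuous)) fun v => ?_
  change P.completion.rinner (P.extendOp T hr (P.toCompletion u)) (P.toCompletion v) =
    P.completion.rinner (P.toCompletion u) (P.extendOp S hs (P.toCompletion v))
  rw [extendOp_coe, extendOp_coe, rinner_toCompletion, rinner_toCompletion, h]

/-- A covariant representation on the completion of a pre-correspondence, given by operators on the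
pre-correspondence. -/
theorem exists_covariantRep {N : HilbertBimodule B} (T S : N.carrier → P.carrier →ₗ[ℂ] P.carrier)
    (hTS : ∀ x u v, P.rinner (T x u) v = P.rinner u (S x v))
    (hST : ∀ x y u, S x (T y u) = N.rinner x y • u)
    (hTS' : ∀ x y u, T x (S y u) = N.linner x y • u)
    (hinj : ∀ b : B, (∀ u : P.carrier, P.rinner (b • u) (b • u) = 0) → b = 0) :
    Nonempty (CovariantRep N P.completion.adjointable) := by
  -- Boundedness follows from the relations: ‖T_x u‖² = ‖⟨u, ⟨x,x⟩u⟩‖ ≤ ‖⟨x,x⟩‖‖u‖².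
  have hbound : ∀ x u, ‖T x u‖ ≤ √‖N.rinner x x‖ * ‖u‖ := fun x u => by
    refine (pow_le_pow_iff_left₀ (norm_nonneg _) (by positivity) two_ne_zero).1 ?_
    rw [mul_pow, Real.sq_sqrt (norm_nonneg _), P.norm_sq, hTS, hST]
    refine (P.norm_rinner_le _ _).trans ?_
    rw [← P.norm_def, ← P.norm_def]
    have := P.norm_smul_le_left (N.rinner x x) u
    nlinarith [norm_nonneg u]
  have hbound' : ∀ x u, ‖S x u‖ ≤ √‖N.rinner x x‖ * ‖u‖ := fun x =>
    P.bound_of_adjoint (hTS x) (hbound x)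
  let t : N.carrier → P.completion.adjointable := fun x =>
    ⟨P.extendOp (T x) (hbound x), _, P.isAdjointPair_extendOp (hTS x) (hbound x) (hbound' x)⟩
  have ht : ∀ x, (star (t x)).1 = P.extendOp (S x) (hbound' x) := fun x =>
    Correspondence.adj_eq (P.isAdjointPair_extendOp (hTS x) (hbound x) (hbound' x))
  refine ⟨⟨P.completion.leftHom, t, fun x y => Subtype.ext (P.completion_ext fun u => ?_),
    fun x y => Subtype.ext (P.completion_ext fun u => ?_), ?_⟩⟩
  · change (star (t x)).1 ((t y).1 (P.toCompletion u)) = N.rinner x y • P.toCompletion u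
    rw [ht, extendOp_coe, extendOp_coe, hST, smul_toCompletion]
  · change (t x).1 ((star (t y)).1 (P.toCompletion u)) = N.linner x y • P.toCompletion u
    rw [ht, extendOp_coe, extendOp_coe, hTS', smul_toCompletion]
  · refine (injective_iff_map_eq_zero _).2 fun b hb => hinj b fun u => ?_
    have h : b • P.toCompletion u = 0 :=
      congrArg (fun A : P.completion.adjointable => A.1 (P.toCompletion u)) hb
    rw [smul_toCompletion] at h
    rw [← rinner_toCompletion, h, Correspondence.rinner_zero_left]

end PreCorrespondence

/-! ### Algebraic direct sums of correspondences. -/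

namespace Correspondence

variable {ι : Type} [DecidableEq ι] (L : ι → Correspondence B)

/-- The algebraic direct sum of correspondences. -/
abbrev DirectSumCarrier : Type u := Π₀ i, (L i).carrier

variable {L}

/-- The inner product of a fixed vector with the elements of an algebraic direct sum. -/
def directSumInner (u : DirectSumCarrier L) : DirectSumCarrier L →+ B :=
  DFinsupp.sumAddHom fun i => (rinnerL (M := L i) (u i)).toLinearMap.toAddMonoidHom

theorem directSumInner_single (u : DirectSumCarrier L) (i : ι) (m : (L i).carrier) :
    directSumInner u (DFinsupp.single i m) = (L i).rinner (u i) m :=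
  DFinsupp.sumAddHom_single _ _ _

theorem directSumInner_ext {f g : DirectSumCarrier L →+ B}
    (h : ∀ i m, f (DFinsupp.single i m) = g (DFinsupp.single i m)) (u : DirectSumCarrier L) :
    f u = g u :=
  DFunLike.congr_fun (DFinsupp.addHom_ext h) u

theorem directSumInner_add (u u' v : DirectSumCarrier L) :
    directSumInner (u + u') v = directSumInner u v + directSumInner u' v := by
  refine directSumInner_ext (f := directSumInner (u + u')) (g := directSumInner u + directSumInner u')
    (fun i m => ?_) v
  rw [AddMonoidHom.add_apply, directSumInner_single, directSumInner_single, directSumInner_single,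
    DFinsupp.add_apply, rinner_add_left]

theorem directSumInner_single_left (i : ι) (m : (L i).carrier) (v : DirectSumCarrier L) :
    directSumInner (DFinsupp.single i m) v = (L i).rinner m (v i) := by
  refine directSumInner_ext (f := directSumInner (DFinsupp.single i m))
    (g := (rinnerL (M := L i) m).toLinearMap.toAddMonoidHom.comp
      (DFinsupp.evalAddMonoidHom i)) (fun j n => ?_) v
  change _ = (L i).rinner m ((DFinsupp.single j n : DirectSumCarrier L) i)
  rw [directSumInner_single]
  by_cases h : i = j
  · subst h; rw [DFinsupp.single_eq_same, DFinsupp.single_eq_same]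
  · rw [DFinsupp.single_eq_of_ne (Ne.symm h), DFinsupp.single_eq_of_ne h, rinner_zero_left,
      rinner_zero_right]

variable (L)

/-- The algebraic direct sum of correspondences with its inner product. -/
def directSum : PreCorrespondence B where
  carrier := DirectSumCarrier L
  rinner u v := directSumInner u v
  rinner_add_right u := map_add _
  rinner_op_smul_right u v b := by
    refine directSumInner_ext (f := (directSumInner u).comp
        (DistribSMul.toAddMonoidHom (DirectSumCarrier L) (op b)))
      (g := (AddMonoidHom.mulRight b).comp (directSumInner u)) (fun i m => ?_) v
    change directSumInner u (op b • DFinsupp.single i m) = directSumInner u (DFinsupp.single i m) * b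
    rw [← DFinsupp.single_smul, directSumInner_single, directSumInner_single,
      (L i).rinner_op_smul_right]
  star_rinner u v := by
    induction v using DFinsupp.induction with
    | h0 =>
      rw [map_zero, star_zero]
      exact (directSumInner_ext (f := directSumInner 0) (g := 0) (fun i m => by
        rw [directSumInner_single, DFinsupp.zero_apply, rinner_zero_left]; rfl) u).symm
    | ha i m v _ _ hv =>
      rw [map_add, star_add, hv, directSumInner_add, directSumInner_single,
        directSumInner_single_left, (L i).star_rinner]
  rinner_smul_left b u v := by
    refine directSumInner_ext (f := directSumInner (b • u)) (g := (directSumInner u).comp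
        (DistribSMul.toAddMonoidHom (DirectSumCarrier L) (star b))) (fun i m => ?_) v
    change _ = directSumInner u (star b • DFinsupp.single i m)
    rw [← DFinsupp.single_smul, directSumInner_single, directSumInner_single, DFinsupp.smul_apply,
      (L i).rinner_smul_left]
  rinner_self_nonneg u := by
    classical
    let _ := CStarAlgebra.spectralOrder B
    let _ := CStarAlgebra.spectralOrderedRing B
    rw [← CStarAlgebra.nonneg_iff_eq_star_mul_self, directSumInner, DFinsupp.sumAddHom_apply]
    refine Finset.sum_nonneg fun i _ => ?_
    obtain ⟨b, hb⟩ := (L i).rinner_self_nonneg (u i)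
    change 0 ≤ (L i).rinner (u i) (u i)
    rw [hb]; exact star_mul_self_nonneg b

end Correspondence

/-! ### Creation and annihilation operators on tensor products. -/

namespace Correspondence

variable {K M : Correspondence B}

/-- The map `z ⊗ y ↦ ⟨x, z⟩ y` on the algebraic tensor product. -/
def preAnnihilate (M : Correspondence B) (x : K.carrier) :
    TensorCarrier K M →ₗ[ℂ] M.carrier :=
  TensorProduct.lift (LinearMap.mk₂ ℂ (fun z y => K.rinner x z • y)
    (fun z z' y => by rw [K.rinner_add_right, add_smul])
    (fun c z y => by rw [K.rinner_smul_right, smul_assoc])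
    (fun z y y' => smul_add _ _ _)
    (fun c z y => ((M.leftL (K.rinner x z)).map_smul c y)))

theorem preAnnihilate_tmul (x z : K.carrier) (y : M.carrier) :
    preAnnihilate M x (TensorCarrier.tmul z y) = K.rinner x z • y := rfl

/-- Annihilation by x is the adjoint of creation y ↦ x ⊗ y; its boundedness is derived from this. -/
theorem rinner_preAnnihilate (x : K.carrier) (y : M.carrier) (s : TensorCarrier K M) :
    M.rinner y (preAnnihilate M x s) = TensorCarrier.sesq K M (TensorCarrier.tmul x y) s := by
  induction s using TensorCarrier.induction with
  | h z w => rw [preAnnihilate_tmul, TensorCarrier.sesq_tmul]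
  | hadd s t hs ht => rw [map_add, map_add, M.rinner_add_right, hs, ht]

/-- Pair the image w with itself: ‖w‖² = ‖⟨x ⊗ w, s⟩‖ ≤ ‖x‖‖w‖‖s‖ by Cauchy–Schwarz. -/
theorem norm_preAnnihilate_le (x : K.carrier) (s : (preTensor K M).carrier) :
    ‖preAnnihilate M x s‖ ≤ ‖x‖ * ‖s‖ := by
  set w := preAnnihilate M x s
  have h1 : ‖w‖ ^ 2 ≤ ‖x‖ * ‖w‖ * ‖s‖ := by
    have h2 : M.rinner w w = (preTensor K M).rinner (TensorCarrier.tmul x w) s :=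
      rinner_preAnnihilate x w s
    rw [M.norm_sq_eq_rinner, h2]
    refine ((preTensor K M).norm_rinner_le (TensorCarrier.tmul x w) s).trans ?_
    rw [← (preTensor K M).norm_def s]
    gcongr
    refine le_of_eq_of_le ?_ (norm_tmul_le x w)
    exact ((preTensor K M).norm_def _).symm.trans
      (Completion.norm_coe (E := (preTensor K M).carrier) (TensorCarrier.tmul x w)).symm
  rcases (norm_nonneg w).eq_or_lt with h0 | h0
  · rw [← h0]; positivity
  · nlinarith

/-- The annihilation operator `z ⊗ y ↦ ⟨x, z⟩ y`. -/
def annihilate (M : Correspondence B) (x : K.carrier) : (tensor K M).carrier →L[ℂ] M.carrier :=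
  extendTensor (LinearMap.mkContinuous (E := (preTensor K M).carrier) (preAnnihilate M x) ‖x‖
    (norm_preAnnihilate_le x))

theorem annihilate_tmul (x z : K.carrier) (y : M.carrier) :
    annihilate M x (tmul z y) = K.rinner x z • y := extendTensor_tmul _ z y

theorem rinner_tmul_left (x : K.carrier) (y : M.carrier) (u : (tensor K M).carrier) :
    (tensor K M).rinner (tmul x y) u = M.rinner y (annihilate M x u) := by
  induction u using tensor_induction with
  | hc => exact isClosed_eq (continuous_rinner_right _)
            ((continuous_rinner_right _).comp (annihilate M x).continuous)
  | h z w => rw [rinner_tmul, annihilate_tmul]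
  | hadd u v hu hv => rw [rinner_add_right, map_add, rinner_add_right, hu, hv]

theorem rinner_annihilate_left (x : K.carrier) (u : (tensor K M).carrier) (y : M.carrier) :
    M.rinner (annihilate M x u) y = (tensor K M).rinner u (tmul x y) := by
  rw [← star_rinner, ← rinner_tmul_left, star_rinner]

/-- Here the compatibility of the two inner products enters: x ⊗ ⟨y,z⟩w = x⟨y,z⟩ ⊗ w = _B⟨x,y⟩z ⊗ w.
-/
theorem tmul_annihilate {K : HilbertBimodule B} (x y : K.carrier)
    (u : (tensor K.toCorrespondence M).carrier) :
    tmul x (annihilate M y u) = K.linner x y • u := by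
  induction u using tensor_induction with
  | hc => exact isClosed_eq ((continuous_tmul_right _).comp (annihilate M y).continuous)
            (continuous_smul_left _)
  | h z w => rw [annihilate_tmul, ← tmul_balanced, smul_tmul, K.linner_smul]
  | hadd u v hu hv => rw [map_add, tmul_add, smul_add, hu, hv]

/-- The tensor powers `B`, `K ⊗ B`, `K ⊗ (K ⊗ B)`, ... -/
def fock (K : Correspondence B) : ℕ → Correspondence B
  | 0 => self B
  -- New factors are added on the left, where creation operators act. Starting from B, and not from
  -- K, lets one formula cover all degrees.
  | n + 1 => tensor K (fock K n)

end Correspondence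

/-! ### The two-sided Fock module of a Hilbert bimodule. -/

namespace HilbertBimodule

open Correspondence

variable (N : HilbertBimodule B)

/-- The degree `k` part of the two-sided Fock module of `N`. -/
def twoSidedFock : ℤ → Correspondence B
  | Int.ofNat n => fock N.toCorrespondence n
  | Int.negSucc n => fock N.dual.toCorrespondence (n + 1)

/-- Creation and annihilation operators between two consecutive degrees. -/
theorem exists_ladder (i j : ℤ) (h : i + 1 = j) :
    ∃ (U : N.carrier → (N.twoSidedFock i).carrier →ₗ[ℂ] (N.twoSidedFock j).carrier)
      (D : N.carrier → (N.twoSidedFock j).carrier →ₗ[ℂ] (N.twoSidedFock i).carrier),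
      (∀ x m z, (N.twoSidedFock j).rinner (U x m) z = (N.twoSidedFock i).rinner m (D x z)) ∧
      (∀ x y m, D x (U y m) = N.rinner x y • m) ∧ ∀ x y z, U x (D y z) = N.linner x y • z := by
  subst h
  -- In negative degrees the roles are exchanged: raising the degree annihilates a factor of N̄ and
  -- lowering it creates one. The relations persist because the dual swaps the left and right inner
  -- products.
  have key : ∀ M : Correspondence B,
      ∃ (U : N.carrier → (tensor N.dual.toCorrespondence M).carrier →ₗ[ℂ] M.carrier)
        (D : N.carrier → M.carrier →ₗ[ℂ] (tensor N.dual.toCorrespondence M).carrier),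
        (∀ x m z, M.rinner (U x m) z = (tensor N.dual.toCorrespondence M).rinner m (D x z)) ∧
        (∀ x y m, D x (U y m) = N.rinner x y • m) ∧ ∀ x y z, U x (D y z) = N.linner x y • z :=
    fun M => ⟨fun x => (annihilate (K := N.dual.toCorrespondence) M (N.toDual x)).toLinearMap,
      fun x => (tmulL (M := N.dual.toCorrespondence) M (N.toDual x)).toLinearMap,
      fun x => rinner_annihilate_left (K := N.dual.toCorrespondence) (N.toDual x),
      fun x y => tmul_annihilate (K := N.dual) (N.toDual x) (N.toDual y),
      fun x y => annihilate_tmul (K := N.dual.toCorrespondence) (N.toDual x) (N.toDual y)⟩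
  rcases i with n | n
  · exact ⟨fun x => (tmulL (M := N.toCorrespondence) (fock N.toCorrespondence n) x).toLinearMap,
      fun x => (annihilate (K := N.toCorrespondence) (fock N.toCorrespondence n) x).toLinearMap,
      rinner_tmul_left (K := N.toCorrespondence), annihilate_tmul (K := N.toCorrespondence),
      tmul_annihilate (K := N)⟩
  -- The step from -1 to 0 is separate only because the target index changes constructor; both Fock
  -- modules start with B.
  · rcases n with _ | n
    · exact key (fock N.dual.toCorrespondence 0)
    · exact key (fock N.dual.toCorrespondence (n + 1))

end HilbertBimodule

/-! ### Operators of degree ±1 on a ℤ-graded direct sum. -/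

namespace Correspondence

variable {L : ℤ → Correspondence B}

/-- The inclusion of a summand into a direct sum. -/
def singleL (i : ℤ) : (L i).carrier →ₗ[ℂ] DirectSumCarrier L where
  toFun m := DFinsupp.single i m
  map_add' := DFinsupp.single_add (β := fun i => (L i).carrier) i
  map_smul' c m := DFinsupp.single_smul (β := fun i => (L i).carrier) (i := i) c m

/-- The operator of degree one on a direct sum given by operators between consecutive degrees. -/
def raise (U : ∀ i j, i + 1 = j → (L i).carrier →ₗ[ℂ] (L j).carrier) :
    DirectSumCarrier L →ₗ[ℂ] DirectSumCarrier L :=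
  DFinsupp.lsum ℂ fun i =>
    (singleL (L := L) (i + 1)).comp (U i _ rfl)

/-- The operator of degree minus one on a direct sum given by operators between consecutive
degrees. -/
def lower (D : ∀ i j, i + 1 = j → (L j).carrier →ₗ[ℂ] (L i).carrier) :
    DirectSumCarrier L →ₗ[ℂ] DirectSumCarrier L :=
  DFinsupp.lsum ℂ fun j =>
    (singleL (L := L) (j - 1)).comp (D (j - 1) j (sub_add_cancel j 1))

/-- The target degree j is a variable with a proof of i + 1 = j, so no element has to be transported
between equal degrees. -/
theorem raise_single (U : ∀ i j, i + 1 = j → (L i).carrier →ₗ[ℂ] (L j).carrier) {i j : ℤ}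
    (h : i + 1 = j) (m : (L i).carrier) :
    raise U (DFinsupp.single i m) = DFinsupp.single j (U i j h m) := by
  subst h
  rw [raise, DFinsupp.lsum_single]
  rfl

theorem lower_single (D : ∀ i j, i + 1 = j → (L j).carrier →ₗ[ℂ] (L i).carrier) {i j : ℤ}
    (h : i + 1 = j) (m : (L j).carrier) :
    lower D (DFinsupp.single j m) = DFinsupp.single i (D i j h m) := by
  obtain rfl : i = j - 1 := eq_sub_of_add_eq h
  rw [lower, DFinsupp.lsum_single]
  rfl

theorem directSumInner_raise (U : ∀ i j, i + 1 = j → (L i).carrier →ₗ[ℂ] (L j).carrier)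
    (D : ∀ i j, i + 1 = j → (L j).carrier →ₗ[ℂ] (L i).carrier)
    (h : ∀ i j hij m z, (L j).rinner (U i j hij m) z = (L i).rinner m (D i j hij z))
    (u v : DirectSumCarrier L) :
    directSumInner (raise U u) v = directSumInner u (lower D v) := by
  induction u using DFinsupp.induction with
  | h0 =>
    rw [map_zero]
    have h0 : directSumInner (0 : DirectSumCarrier L) = 0 := DFinsupp.addHom_ext fun i m => by
      rw [directSumInner_single, DFinsupp.zero_apply, rinner_zero_left]; rfl
    rw [h0]; rfl
  | ha i m u _ _ hu =>
    rw [map_add, directSumInner_add, directSumInner_add, hu]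
    congr 1
    refine directSumInner_ext (f := directSumInner (raise U (DFinsupp.single i m)))
      (g := (directSumInner (DFinsupp.single i m)).comp (lower D).toAddMonoidHom)
      (fun j z => ?_) v
    change _ = directSumInner (DFinsupp.single i m) (lower D (DFinsupp.single j z))
    -- Distinct summands are orthogonal, so only consecutive degrees contribute; otherwise both
    -- sides vanish.
    by_cases hij : i + 1 = j
    · rw [raise_single U hij, lower_single D hij, directSumInner_single, directSumInner_single,
        DFinsupp.single_eq_same, DFinsupp.single_eq_same, h]
    · rw [raise_single U rfl, lower_single D (sub_add_cancel j 1), directSumInner_single,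
        directSumInner_single, DFinsupp.single_eq_of_ne (by omega),
        DFinsupp.single_eq_of_ne (by omega), rinner_zero_left, rinner_zero_left]

theorem lower_raise (U : ∀ i j, i + 1 = j → (L i).carrier →ₗ[ℂ] (L j).carrier)
    (D : ∀ i j, i + 1 = j → (L j).carrier →ₗ[ℂ] (L i).carrier) (b : B)
    (h : ∀ i j hij m, D i j hij (U i j hij m) = b • m) (u : DirectSumCarrier L) :
    lower D (raise U u) = b • u := by
  induction u using DFinsupp.induction with
  | h0 => rw [map_zero, map_zero, smul_zero]
  | ha i m u _ _ hu =>
    rw [map_add, map_add, smul_add, hu, raise_single U rfl, lower_single D rfl, h,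
      DFinsupp.single_smul]

theorem raise_lower (U : ∀ i j, i + 1 = j → (L i).carrier →ₗ[ℂ] (L j).carrier)
    (D : ∀ i j, i + 1 = j → (L j).carrier →ₗ[ℂ] (L i).carrier) (b : B)
    (h : ∀ i j hij z, U i j hij (D i j hij z) = b • z) (u : DirectSumCarrier L) :
    raise U (lower D u) = b • u := by
  induction u using DFinsupp.induction with
  | h0 => rw [map_zero, map_zero, smul_zero]
  | ha i m u _ _ hu =>
    rw [map_add, map_add, smul_add, hu, lower_single D (sub_add_cancel i 1),
      raise_single U (sub_add_cancel i 1), h, DFinsupp.single_smul]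

/-- Faithfulness of the left action is seen on a summand B, by letting b act on 1. -/
theorem eq_zero_of_directSumInner {i : ℤ} (hi : L i = self B) {b : B}
    (hb : ∀ u : DirectSumCarrier L, directSumInner (b • u) (b • u) = 0) : b = 0 := by
  have h : ∀ m : (L i).carrier, (L i).rinner (b • m) (b • m) = 0 := fun m => by
    have h := hb (DFinsupp.single i m)
    rwa [← DFinsupp.single_smul, directSumInner_single, DFinsupp.single_eq_same] at h
  rw [hi] at h
  have h1 : star (b * 1) * (b * 1) = 0 := h (1 : B)
  rw [mul_one] at h1
  exact (CStarRing.star_mul_self_eq_zero_iff b).1 h1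

end Correspondence

open Correspondence in
/-- Every Hilbert bimodule has a covariant representation, on its two-sided Fock module. -/
theorem HilbertBimodule.exists_covariantRep (N : HilbertBimodule B) :
    ∃ (C : Type u) (_ : CStarAlgebra C), Nonempty (CovariantRep N C) := by
  -- The ladder operators are adjoint and satisfy both relations degree by degree, so the assembled
  -- operators do as well; the summand B in degree 0 gives injectivity of π.
  choose U D h1 h2 h3 using N.exists_ladder
  exact ⟨(directSum N.twoSidedFock).completion.adjointable, inferInstance,
    (directSum N.twoSidedFock).exists_covariantRep
    (fun x => raise fun i j h => U i j h x) (fun x => lower fun i j h => D i j h x)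
    (fun x => directSumInner_raise _ _ fun i j h => h1 i j h x)
    (fun x y => lower_raise _ _ _ fun i j h => h2 i j h x y)
    (fun x y => raise_lower _ _ _ fun i j h => h3 i j h x y)
    fun b hb => eq_zero_of_directSumInner (L := N.twoSidedFock) (i := 0) rfl hb⟩

/-! ### Making a covariant representation homogeneous by twisting with the character. -/

namespace CovariantRep

open CStarDynamicalSystem

variable {N : HilbertBimodule B} {C : Type u} [CStarAlgebra C]

/-- The `*`-homomorphism to constant functions. -/
def constHom (C : Type u) [CStarAlgebra C] : C →⋆ₐ[ℂ] C(SO2, C) where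
  toFun := ContinuousMap.const SO2
  map_one' := rfl
  map_mul' _ _ := rfl
  map_zero' := rfl
  map_add' _ _ := rfl
  commutes' _ := rfl
  map_star' _ := rfl

/-- The covariant representation in `C(SO(2), C)` with the bimodule in degree one. -/
def twist (ρ : CovariantRep N C) : CovariantRep N (translation C).A where
  π := (constHom C).comp ρ.π
  t x := charFun 1 (ρ.t x)
  star_t_mul x y := ContinuousMap.ext fun g => by
    change star (g.character ^ (1 : ℤ) • ρ.t x) * (g.character ^ (1 : ℤ) • ρ.t y) = ρ.π _
    rw [zpow_one, star_smul, smul_mul_smul_comm, ρ.star_t_mul,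
      show star g.character * g.character = 1 from g.conj_character_mul, one_smul]
  t_mul_star x y := ContinuousMap.ext fun g => by
    change (g.character ^ (1 : ℤ) • ρ.t x) * star (g.character ^ (1 : ℤ) • ρ.t y) = ρ.π _
    rw [zpow_one, star_smul, smul_mul_smul_comm, ρ.t_mul_star,
      show g.character * star g.character = 1 from g.character_mul_conj, one_smul]
  injective a b h := ρ.injective (congrArg (fun f : C(SO2, C) => f 1) h)

end CovariantRep

/-! ### The bijection between Ext and Pic, and its description by factor systems. -/

namespace FreeSystem

open CStarDynamicalSystem

/-- Every Morita equivalence bimodule is the isotypic component of degree one of a free system. -/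
theorem exists_iso_isotypic_one (N : MoritaBimodule B) :
    ∃ S : FreeSystem B, Nonempty (HilbertBimodule.Iso N.toHilbertBimodule (S.isotypic 1)) := by
  obtain ⟨C, _, ⟨ρ⟩⟩ := N.exists_covariantRep
  -- After twisting, B acts by constant functions, which translation fixes, and N by multiples of
  -- the character, which have degree 1.
  exact ⟨_, ⟨ρ.twist.oneIso (fun b g => by rw [zpow_zero, one_smul]; rfl)
    (fun x => charFun_mem 1 (ρ.t x)) N.isMorita⟩⟩

section

variable {S T : FreeSystem B} (φ : S.A ≃⋆ₐ[ℂ] T.A)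
  (hα : ∀ (g : SO2) (x : S.A), φ (S.α g x) = T.α g (φ x)) (k : ℤ)

/-- The restriction of an equivariant isomorphism to isotypic components. -/
def isotypicEquiv : (S.isotypic k).carrier ≃ₗ[ℂ] (T.isotypic k).carrier where
  toFun x := isoMk (φ (S.valL k x)) fun g => by rw [← hα, valL_mem x g, map_smul]
  invFun x := isoMk (φ.symm (T.valL k x)) fun g => by
    apply EquivLike.injective φ
    rw [hα, map_smul, StarAlgEquiv.apply_symm_apply, valL_mem x g]
  map_add' x y := valL_injective (by simp only [valL_isoMk, map_add]; rfl)
  map_smul' c x := valL_injective (by simp only [valL_isoMk, map_smul, RingHom.id_apply]; rfl)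
  left_inv x := valL_injective (φ.symm_apply_apply (S.valL k x))
  right_inv x := valL_injective (φ.apply_symm_apply (T.valL k x))

theorem valL_isotypicEquiv (x : (S.isotypic k).carrier) :
    T.valL k (isotypicEquiv φ hα k x) = φ (S.valL k x) := rfl

/-- An equivalence of free systems restricts to the isotypic components. -/
def isotypicIso (hι : ∀ b, φ (S.ι b) = T.ι b) :
    HilbertBimodule.Iso (S.isotypic k) (T.isotypic k) where
  toEquiv := isotypicEquiv φ hα k
  map_smul_left b x := valL_injective (by
    rw [valL_isotypicEquiv, valL_smul, valL_smul, valL_isotypicEquiv, map_mul, hι])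
  map_smul_right b x := valL_injective (by
    rw [valL_isotypicEquiv, valL_op_smul, valL_op_smul, valL_isotypicEquiv, map_mul, hι])
  map_rinner x y := T.ι_injective (by
    rw [ι_rinner, ← hι, ι_rinner, map_mul, map_star, valL_isotypicEquiv, valL_isotypicEquiv])
  map_linner x y := T.ι_injective (by
    rw [ι_linner, ← hι, ι_linner, map_mul, map_star, valL_isotypicEquiv, valL_isotypicEquiv])

end

/-- The map from equivalence classes of free systems to the Picard set. -/
def picMap (B : Type u) [CStarAlgebra B] : FreeExt B → Pic B :=
  Quotient.lift (fun S => MoritaBimodule.toPic ⟨S.isotypic 1, S.isMorita 1⟩) fun _ _ ⟨φ, hι, hα⟩ =>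
    Quotient.sound ⟨isotypicIso φ hα 1 hι⟩

theorem picMap_toFreeExt (S : FreeSystem B) :
    picMap B S.toFreeExt = MoritaBimodule.toPic ⟨S.isotypic 1, S.isMorita 1⟩ := rfl

theorem picMap_eq_iff (S : FreeSystem B) (N : MoritaBimodule B) :
    picMap B S.toFreeExt = N.toPic ↔
      Nonempty (HilbertBimodule.Iso N.toHilbertBimodule (S.isotypic 1)) :=
  eq_comm.trans Quotient.eq

/-- Injectivity is the graph argument of `equiv_of_iso`; surjectivity is the Fock module
construction. -/
theorem bijective_picMap : Function.Bijective (picMap B) := by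
  refine ⟨fun s t => ?_, fun n => ?_⟩
  · refine Quotient.inductionOn₂ s t fun S T h => ?_
    obtain ⟨u⟩ := (picMap_eq_iff T ⟨S.isotypic 1, S.isMorita 1⟩).1 h.symm
    exact Quotient.sound (equiv_of_iso u)
  · refine Quotient.inductionOn n fun N => ?_
    obtain ⟨S, hS⟩ := exists_iso_isotypic_one N
    exact ⟨S.toFreeExt, (picMap_eq_iff S N).2 hS⟩

/-- From N ≅ A(1), uniqueness identifies F with the factor system read off from A. Conversely φ_1 is
an isomorphism N ≅ A(1) for the right inner products, and fullness of A(1) makes it preserve the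
left ones. -/
theorem nonempty_iso_iff_hasFactorSystem {N : HilbertBimodule B} (F : N.FactorSystem)
    (S : FreeSystem B) : Nonempty (HilbertBimodule.Iso N (S.isotypic 1)) ↔ S.HasFactorSystem F := by
  constructor
  · rintro ⟨φ⟩
    rw [eq_factorSystem φ F]
    exact hasFactorSystem φ
  · rintro ⟨φ, -, -⟩
    exact ⟨⟨φ 1, HilbertBimodule.linner_eq_of_iso (M := N) (S.isMorita 1) (φ 1)⟩⟩

end FreeSystem

end

theorem mainTheorem4 (B : Type u) [CStarAlgebra B] :
    ∃ isMorita : ∀ (S : FreeSystem B) (k : ℤ), (S.isotypic k).IsMorita,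
    ∃ Φ : FreeExt B ≃ Pic B,
      (∀ S : FreeSystem B, Φ S.toFreeExt = MoritaBimodule.toPic ⟨S.isotypic 1, isMorita S 1⟩) ∧
      ∀ N : MoritaBimodule B, ∃ F : N.FactorSystem, (∀ F' : N.FactorSystem, F' = F) ∧
        ∀ S : FreeSystem B, Φ.symm N.toPic = S.toFreeExt ↔ S.HasFactorSystem F := by
  refine ⟨FreeSystem.isMorita, Equiv.ofBijective _ FreeSystem.bijective_picMap,
    FreeSystem.picMap_toFreeExt, fun N => ?_⟩
  -- One realisation S₀ of N supplies the factor system; the comparison is then valid for every S,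
  -- since uniqueness does not depend on S₀.
  obtain ⟨S₀, ⟨φ₀⟩⟩ := FreeSystem.exists_iso_isotypic_one N
  refine ⟨FreeSystem.factorSystem φ₀, FreeSystem.eq_factorSystem φ₀, fun S => ?_⟩
  rw [Equiv.symm_apply_eq, eq_comm, ← FreeSystem.nonempty_iso_iff_hasFactorSystem]
  exact FreeSystem.picMap_eq_iff S N
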